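/- Let $\lambda\in\{1,-1\}$, let $m,n\ge 1$ be integers, and let $u:[0,\infty)\to\mathbb R$ satisfy $u\in C^{m+1}([0,\infty))$ and $(1+x)^n\partial^i u\in L^1([0,\infty))$ for $i=0,1,\dots,m+1$. Put $\sigma_3=\begin{pmatrix}1&0\\0&-1\end{pmatrix}$ and $\mathsf U(x)=\begin{pmatrix}0&u(x)\\ \lambda u(x)&0\end{pmatrix}$, write $e^{z\hat\sigma_3}A=e^{z\sigma_3}Ae^{-z\sigma_3}$, let $A^{(d)}$ and $A^{(o)}$ be the diagonal and off-diagonal parts of a $2\times2$ matrix $A$, and let $|\cdot|$ be the Euclidean (Frobenius) norm. With $\bar{\mathbb C}_\pm=\{\pm\operatorname{Im}k\ge 0\}$, the notation $k\in(\bar{\mathbb C}_+,\bar{\mathbb C}_-)$ means that a statement is made for the first column when $k\in\bar{\mathbb C}_+$ and for the second column when $k\in\bar{\mathbb C}_-$; similarly for $(\bar{\mathbb C}_-,\bar{\mathbb C}_+)$. The Volterra equations $$X(x,k)=I-\int_x^\infty e^{-ik(x'-x)\hat\sigma_3}(\mathsf UX)(x',k)\,dx',\qquad x\ge0,\ k\in(\bar{\mathbb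 C}_+,\bar{\mathbb C}_-),$$ $$Y(x,k)=I+\int_0^x e^{-ik(x'-x)\hat\sigma_3}(\mathsf UY)(x',k)\,dx',\qquad x\ge 0,\ k\in\mathbb C,$$ (with absolutely convergent integrals) uniquely define $X$ and $Y$. As functions of $x\ge0$, for $k$ as indicated, both solve $X_x-ik[\sigma_3,X]=\mathsf UX$. For each $x\ge0$, the columns of $X(x,\cdot)$ are $n$ times continuously differentiable in $k$ up to the boundary of their closed half-planes (as functions of the complex variable $k$), and $Y(x,\cdot)$ is entire. There are unique $C^1$ matrix functions $X_j,Z_j,W_j$ on $[0,\infty)$, $0\le j\le m+1$, with $X_0=Z_0=I$, $W_0=0$, such that, for $0\le j\le m$, $$X_{j+1}^{(o)}=-\tfrac i2\sigma_3\big(\partial_xX_j^{(o)}-\mathsf UX_j^{(d)}\big),\qquad \partial_xX_{j+1}^{(d)}=\tfrac i2\sigma_3\mathsf U\big(\partial_xX_j^{(o)}-\mathsf UX_j^{(d)}\big),$$ the same relations hold with $X$ replaced by $Z$, and $$W_{j+1}^{(d)}=-\tfrac i2\sigma_3\big(\partial_xW_j^{(d)}-\mathsf UW_j^{(o)}\big),\qquad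 \partial_xW_{j+1}^{(o)}=\tfrac i2\sigma_3\mathsf U\big(\partial_xW_j^{(d)}-\mathsf UW_j^{(o)}\big),$$ and, for $1\le j\le m+1$, $\lim_{x\to\infty}X_j(x)=0$ and $Z_j(0)+W_j(0)=0$. Thus the functions $$\hat X(x,k)=I+\sum_{j=1}^{m+1}\frac{X_j(x)}{k^j},\qquad \hat Y(x,k)=I+\sum_{j=1}^{m+1}\frac{Z_j(x)}{k^j}+\Big(\sum_{j=1}^{m+1}\frac{W_j(x)}{k^j}\Big)e^{-2ikx\sigma_3}$$ are well-defined. Moreover, there exist constants $K>0$ and $C>0$ (independent of $x$, $k$ and $j$) such that, for all $x\ge0$ and $j=0,1,\dots,n$, $$\Big|\frac{\partial^j}{\partial k^j}(X-\hat X)\Big|\le\frac{C}{|k|^{m+1}(1+x)^{n-j}},\qquad k\in(\bar{\mathbb C}_+,\bar{\mathbb C}_-),\ |k|>K,$$ $$\Big|\frac{\partial^j}{\partial k^j}(Y-\hat Y)\Big|\le\frac{C(1+x)^{j+2}e^{Cx/|k|^{m+1}}}{|k|^{m+1}},\qquad k\in(\bar{\mathbb C}_-,\bar{\mathbb C}_+),\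 |k|>K,$$ $$\Big|\frac{\partial^j}{\partial k^j}\big((Y-\hat Y)e^{2ikx\sigma_3}\big)\Big|\le\frac{C(1+x)^{j+2}e^{Cx/|k|^{m+1}}}{|k|^{m+1}},\qquad k\in(\bar{\mathbb C}_+,\bar{\mathbb C}_-),\ |k|>K.$$ -/

import Mathlib

open Complex Set Filter Topology MeasureTheory

noncomputable section

namespace MKdV

/-- Complex `2 × 2` matrices. -/
abbrev Mat : Type := Matrix (Fin 2) (Fin 2) ℂ

/-- The third Pauli matrix. -/
def sigma3 : Mat := !![1, 0; 0, -1]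

/-- The matrix exponential `e^{z σ₃} = diag (e^z, e^{-z})`. -/
def expSigma3 (z : ℂ) : Mat := !![Complex.exp z, 0; 0, Complex.exp (-z)]

/-- The potential matrix `U(x)` with rows `(0, u)` and `(λ u, 0)`. -/
def potU (lam : ℝ) (u : ℝ → ℝ) (x : ℝ) : Mat :=
  !![0, (u x : ℂ); (lam : ℂ) * (u x : ℂ), 0]

/-- The diagonal part of a matrix. -/
def diagPart (A : Mat) : Mat := Matrix.diagonal fun a => A a a

/-- The off-diagonal part of a matrix. -/
def offPart (A : Mat) : Mat := A - diagPart A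

/-- The column `[A]_c` as a vector in `ℂ²` with its Euclidean norm. -/
def col (A : Mat) (c : Fin 2) : EuclideanSpace ℂ (Fin 2) :=
  WithLp.toLp 2 fun a => A a c

/-- The entrywise derivative on `[0, ∞)` (one-sided at `0`) of a matrix function. -/
def dx (F : ℝ → Mat) (x : ℝ) : Mat :=
  Matrix.of fun a b => derivWithin (fun y => F y a b) (Ici 0) x

/-- The closed upper half-plane. -/
def closedUpper : Set ℂ := {k | 0 ≤ k.im}

/-- The closed lower half-plane. -/
def closedLower : Set ℂ := {k | k.im ≤ 0}

/-- `k ∈ (upper, lower)`: the first column is considered for `k` in the closed upper half-plane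
and the second column for `k` in the closed lower half-plane. -/
def domUL (c : Fin 2) : Set ℂ := if c = 0 then closedUpper else closedLower

/-- `k ∈ (lower, upper)`: the first column is considered for `k` in the closed lower half-plane
and the second column for `k` in the closed upper half-plane. -/
def domLU (c : Fin 2) : Set ℂ := if c = 0 then closedLower else closedUpper

/-- `u ∈ C^{m+1}([0,∞))` and `(1+x)^n ∂^i u ∈ L¹([0,∞))` for `i = 0, …, m+1`. -/
structure RegularDecay (m n : ℕ) (u : ℝ → ℝ) : Prop where
  contDiffOn : ContDiffOn ℝ ((m + 1 : ℕ) : WithTop ℕ∞) u (Ici 0)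
  integrableOn : ∀ i ≤ m + 1,
    IntegrableOn (fun x : ℝ => (1 + x) ^ n * iteratedDerivWithin i u (Ici 0) x) (Ici 0)

/-- The integrand `e^{-ik(x'-x) [σ₃, ·]} (U F)(x')` of the Volterra equations, where
`e^{z [σ₃, ·]} A = e^{z σ₃} A e^{-z σ₃}`.  Its column `c` only involves column `c` of `F`. -/
def volterraIntegrand (lam : ℝ) (u : ℝ → ℝ) (k : ℂ) (F : ℝ → Mat) (x x' : ℝ) : Mat :=
  expSigma3 (-(I * k * ((x' : ℂ) - (x : ℂ)))) * (potU lam u x' * F x') *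
    expSigma3 (I * k * ((x' : ℂ) - (x : ℂ)))

/-- `X` solves `X(x,k) = I + ∫_∞^x e^{-ik(x'-x) [σ₃, ·]} (U X)(x',k) dx'` for `x ≥ 0`, the first
column for `Im k ≥ 0` and the second column for `Im k ≤ 0`; the integrals converge absolutely. -/
def IsEigenX (lam : ℝ) (u : ℝ → ℝ) (X : ℝ → ℂ → Mat) : Prop :=
  ∀ c : Fin 2, ∀ k ∈ domUL c, ∀ x : ℝ, 0 ≤ x → ∀ a : Fin 2,
    IntegrableOn (fun x' => volterraIntegrand lam u k (fun y => X y k) x x' a c) (Ioi x) ∧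
    X x k a c =
      (1 : Mat) a c - ∫ x' in Ioi x, volterraIntegrand lam u k (fun y => X y k) x x' a c

/-- `Y` solves `Y(x,k) = I + ∫_0^x e^{-ik(x'-x) [σ₃, ·]} (U Y)(x',k) dx'` for `x ≥ 0` and
`k ∈ ℂ`; the integrals converge absolutely. -/
def IsEigenY (lam : ℝ) (u : ℝ → ℝ) (Y : ℝ → ℂ → Mat) : Prop :=
  ∀ k : ℂ, ∀ x : ℝ, 0 ≤ x → ∀ a c : Fin 2,
    IntervalIntegrable (fun x' => volterraIntegrand lam u k (fun y => Y y k) x x' a c)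
      volume 0 x ∧
    Y x k a c =
      (1 : Mat) a c + ∫ x' in (0 : ℝ)..x, volterraIntegrand lam u k (fun y => Y y k) x x' a c

/-- The differential equation `F_x - ik [σ₃, F] = U F` on `[0,∞)` (one-sided at `0`), for the
column `c` of `F`. -/
def SolvesXPart (lam : ℝ) (u : ℝ → ℝ) (k : ℂ) (F : ℝ → Mat) (c : Fin 2) : Prop :=
  ∀ x : ℝ, 0 ≤ x → ∀ a : Fin 2,
    HasDerivWithinAt (fun y => F y a c)
      (((I * k) • (sigma3 * F x - F x * sigma3) + potU lam u x * F x) a c) (Ici 0) x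

/-- The entries of `F 0, …, F N` are `C¹` on `[0,∞)`. -/
def CoeffC1 (N : ℕ) (F : ℕ → ℝ → Mat) : Prop :=
  ∀ j ≤ N, ∀ a b : Fin 2, ContDiffOn ℝ 1 (fun x => F j x a b) (Ici 0)

/-- The recursion, up to index `N`, for coefficients of a formal solution `∑ F_j(x) k^{-j}`. -/
def RecursionZ (lam : ℝ) (u : ℝ → ℝ) (N : ℕ) (F : ℕ → ℝ → Mat) : Prop :=
  ∀ j < N, ∀ x : ℝ, 0 ≤ x →
    offPart (F (j + 1) x) =
      (-(I / 2)) • (sigma3 * (offPart (dx (F j) x) - potU lam u x * diagPart (F j x))) ∧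
    diagPart (dx (F (j + 1)) x) =
      (I / 2) • (sigma3 * potU lam u x *
        (offPart (dx (F j) x) - potU lam u x * diagPart (F j x)))

/-- The recursion, up to index `N`, for coefficients of a formal solution
`(∑ F_j(x) k^{-j}) e^{-2ikx σ₃}`. -/
def RecursionW (lam : ℝ) (u : ℝ → ℝ) (N : ℕ) (F : ℕ → ℝ → Mat) : Prop :=
  ∀ j < N, ∀ x : ℝ, 0 ≤ x →
    diagPart (F (j + 1) x) =
      (-(I / 2)) • (sigma3 * (diagPart (dx (F j) x) - potU lam u x * offPart (F j x))) ∧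
    offPart (dx (F (j + 1)) x) =
      (I / 2) • (sigma3 * potU lam u x *
        (diagPart (dx (F j) x) - potU lam u x * offPart (F j x)))

/-- `F 0, …, F N` are the coefficients `X_0 = I, X_1, …, X_N` of the formal solution
normalized at `x = ∞`. -/
structure IsFormalX (lam : ℝ) (u : ℝ → ℝ) (N : ℕ) (F : ℕ → ℝ → Mat) : Prop where
  smooth : CoeffC1 N F
  zero : ∀ x : ℝ, 0 ≤ x → F 0 x = 1
  recursion : RecursionZ lam u N F
  tendsto : ∀ j, 1 ≤ j → j ≤ N → Tendsto (F j) atTop (𝓝 0)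

/-- `Z 0, …, Z N` and `W 0, …, W N` are the coefficients `Z_0 = I, Z_1, …, Z_N` and
`W_0 = 0, W_1, …, W_N` of the formal solution normalized at `x = 0`. -/
structure IsFormalY (lam : ℝ) (u : ℝ → ℝ) (N : ℕ) (Z W : ℕ → ℝ → Mat) : Prop where
  smoothZ : CoeffC1 N Z
  smoothW : CoeffC1 N W
  zeroZ : ∀ x : ℝ, 0 ≤ x → Z 0 x = 1
  zeroW : ∀ x : ℝ, 0 ≤ x → W 0 x = 0
  recursionZ : RecursionZ lam u N Z
  recursionW : RecursionW lam u N W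
  initial : ∀ j, 1 ≤ j → j ≤ N → Z j 0 + W j 0 = 0

/-- `F_1(x)/k + ⋯ + F_N(x)/k^N`. -/
def partialSum (N : ℕ) (F : ℕ → ℝ → Mat) (x : ℝ) (k : ℂ) : Mat :=
  ∑ j ∈ Finset.Icc 1 N, (1 / k ^ j) • F j x

/-- The truncation `I + X_1/k + ⋯ + X_N/k^N`. -/
def hatX (N : ℕ) (Xc : ℕ → ℝ → Mat) (x : ℝ) (k : ℂ) : Mat :=
  1 + partialSum N Xc x k

/-- The truncation
`I + Z_1/k + ⋯ + Z_N/k^N + (W_1/k + ⋯ + W_N/k^N) e^{-2ikx σ₃}`. -/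
def hatY (N : ℕ) (Zc Wc : ℕ → ℝ → Mat) (x : ℝ) (k : ℂ) : Mat :=
  1 + partialSum N Zc x k + partialSum N Wc x k * expSigma3 (-(2 * I * k * (x : ℂ)))

end MKdV

end

/-!
In the column `c` of a matrix solution the diagonal entry `f` and the off-diagonal entry `g` satisfy
`f' = p g`, `g' = q f - 2iκ g`, where `p` and `q` are the two entries of the potential matrix and
`κ = k` for the first, `κ = -k` for the second column (`isEigenX_iff`, `isEigenY_iff`).  Everything
is proved for this scalar system.

Eliminating `g` turns the Volterra equation into `f = T(κ) f + 1` on bounded continuous functions on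
`[x₀, ∞)` or `[0, R]`, where the iterates of `T(κ)` decay factorially (`norm_prodOp_pow_apply_le`).
Hence `1 - T(κ)` is invertible with a bound on the inverse that is uniform in `κ`, and the solution
exists and is unique.  The kernel is differentiated in `κ` by dominated convergence; each derivative
costs one moment of the potential, which is why `n` weighted moments give `n` derivatives
(`contDiffOn_resolvent`).

The coefficients of a formal solution consist of `o_j` (off-diagonal for `X_j`, `Z_j`, diagonal for
`W_j`) and `d_j`, with `o_{j+1}` obtained by differentiating `o_j` and `d_{j+1}` by integrating
`p o_{j+1}`.  By induction `o_j` has `m + 2 - j` derivatives, all in the weighted `L¹` space, and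
`d_j` has one fewer, all bounded (`FormalPair.regOn`); so the recursion can be carried out up to
`m + 1`, and the truncated sum solves the system up to a residual `k^{-(m+1)} ρ` with `ρ` again in
the weighted `L¹` space (`FormalPair.hasDerivWithinAt_sum`).

For `X`, the error at `x₀` is `k^{-(m+1)}` times the value at `x₀` of the solution on `[x₀, ∞)` of
the system with inhomogeneity `-ρ` that vanishes at infinity (`eq_tailErr`).  A derivative of order
`j` in `κ` puts the weight `(y - x₀)^j` on `ρ` and `q`, and
`∫_{x₀}^∞ (y - x₀)^j |ρ| ≤ (1 + x₀)^{-(n-j)} ∫ (1 + y)^n |ρ|`.  Since `F = T F + r` gives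
`F' = T F' + (T' F + r')`, the uniform bound on the inverse of `1 - T` yields the decay of all
derivatives by induction (`exists_bddDeriv_of_eq_add`, `exists_bddDeriv_tailErr`).

For `Y`, the error vanishes at `x = 0` and solves the system with the two residuals as
inhomogeneities.  On the interval `[0, x]` the factors `e^{2iκs}` are bounded by `e²` not only in
the closed half-plane but in the strip of width `1 / (1 + x)` around it, and stability there bounds the
error by `C |k|^{-(m+1)}` (`norm_le_of_hasDerivWithinAt_head`, `exists_headErr_le`).  The error is
analytic in `k ≠ 0`, so Cauchy's estimate on discs of radius `1 / (1 + x)` bounds its `j`-th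
derivative by `C (1 + x)^j |k|^{-(m+1)}` (`norm_iteratedDeriv_le_of_strip`), which is stronger than
the required bound.
-/

open scoped BoundedContinuousFunction

noncomputable section

namespace MKdV

/-! ### Integral operators with dominated kernels -/

/-- The kernel `K` is dominated by the integrable function `h`, and `x ↦ K x y` is continuous at
each given point for almost every `y`.  Such a kernel may jump along a null set, as the kernels
of Volterra operators do on the diagonal. -/
structure IsDominatedKernel (K : ℝ → ℝ → ℂ) (h : ℝ → ℝ) : Prop where
  aestronglyMeasurable : ∀ x, AEStronglyMeasurable (K x) volume
  integrable : Integrable h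
  norm_le : ∀ x y, ‖K x y‖ ≤ h y
  continuousAt : ∀ x₀, ∀ᵐ y, ContinuousAt (fun x => K x y) x₀

namespace IsDominatedKernel

variable {K : ℝ → ℝ → ℂ} {h : ℝ → ℝ}

lemma integrable_mul (hK : IsDominatedKernel K h) (f : ℝ →ᵇ ℂ) (x : ℝ) :
    Integrable fun y => K x y * f y := by
  refine (hK.integrable.mul_const ‖f‖).mono'
    ((hK.aestronglyMeasurable x).mul f.continuous.aestronglyMeasurable) (.of_forall fun y => ?_)
  rw [norm_mul]
  exact mul_le_mul (hK.norm_le x y) (f.norm_coe_le_norm y) (norm_nonneg _)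
    ((norm_nonneg _).trans (hK.norm_le x y))

lemma continuous_integral (hK : IsDominatedKernel K h) (f : ℝ →ᵇ ℂ) :
    Continuous fun x => ∫ y, K x y * f y := by
  refine continuous_iff_continuousAt.2 fun x₀ => ?_
  refine continuousAt_of_dominated (bound := fun y => h y * ‖f‖)
    (.of_forall fun x => (hK.integrable_mul f x).aestronglyMeasurable)
    (.of_forall fun x => .of_forall fun y => ?_) (hK.integrable.mul_const _) ?_
  · rw [norm_mul]
    exact mul_le_mul (hK.norm_le x y) (f.norm_coe_le_norm y) (norm_nonneg _)
      ((norm_nonneg _).trans (hK.norm_le x y))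
  · filter_upwards [hK.continuousAt x₀] with y hy using hy.mul continuousAt_const

lemma norm_integral_le (hK : IsDominatedKernel K h) (f : ℝ →ᵇ ℂ) (x : ℝ) :
    ‖∫ y, K x y * f y‖ ≤ (∫ y, h y) * ‖f‖ := by
  rw [← integral_mul_const]
  refine norm_integral_le_of_norm_le (hK.integrable.mul_const _) (.of_forall fun y => ?_)
  rw [norm_mul]
  exact mul_le_mul (hK.norm_le x y) (f.norm_coe_le_norm y) (norm_nonneg _)
    ((norm_nonneg _).trans (hK.norm_le x y))

/-- The integral operator of a dominated kernel on bounded continuous functions. -/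
def toCLM (hK : IsDominatedKernel K h) : (ℝ →ᵇ ℂ) →L[ℂ] (ℝ →ᵇ ℂ) :=
  LinearMap.mkContinuous
    { toFun := fun f => BoundedContinuousFunction.ofNormedAddCommGroup
        (fun x => ∫ y, K x y * f y) (hK.continuous_integral f) _ (hK.norm_integral_le f)
      map_add' := fun f g => by
        ext x
        simp only [BoundedContinuousFunction.coe_ofNormedAddCommGroup,
          BoundedContinuousFunction.coe_add, Pi.add_apply, mul_add]
        exact integral_add (hK.integrable_mul f x) (hK.integrable_mul g x)
      map_smul' := fun c f => by
        ext x
        simp only [BoundedContinuousFunction.coe_ofNormedAddCommGroup,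
          BoundedContinuousFunction.coe_smul, RingHom.id_apply, smul_eq_mul]
        rw [← integral_const_mul]
        congr 1; ext y; ring }
    (∫ y, h y) fun f => by
      have h0 : 0 ≤ ∫ y, h y := integral_nonneg fun y => (norm_nonneg _).trans (hK.norm_le 0 y)
      exact (BoundedContinuousFunction.norm_le (by positivity)).2 (hK.norm_integral_le f)

end IsDominatedKernel

open Classical in
/-- The operator `f ↦ ∫ K(·, y) f(y) dy` on bounded continuous functions, for a kernel dominated
by some integrable function; `0` for other kernels. -/
def kernelOp (K : ℝ → ℝ → ℂ) : (ℝ →ᵇ ℂ) →L[ℂ] (ℝ →ᵇ ℂ) :=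
  if hK : ∃ h, IsDominatedKernel K h then hK.choose_spec.toCLM else 0

lemma kernelOp_apply {K : ℝ → ℝ → ℂ} {h : ℝ → ℝ} (hK : IsDominatedKernel K h)
    (f : ℝ →ᵇ ℂ) (x : ℝ) : kernelOp K f x = ∫ y, K x y * f y := by
  rw [kernelOp, dif_pos ⟨h, hK⟩]; rfl

/-- A linear combination of kernel operators is bounded by any integrable function that dominates
the same combination of the kernels. -/
lemma norm_kernelOp_sub_sub_smul_le {K₁ K₂ K₃ : ℝ → ℝ → ℂ} {h₁ h₂ h₃ h : ℝ → ℝ}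
    (hK₁ : IsDominatedKernel K₁ h₁) (hK₂ : IsDominatedKernel K₂ h₂)
    (hK₃ : IsDominatedKernel K₃ h₃) (c : ℂ) (hh : Integrable h)
    (hle : ∀ x y, ‖K₁ x y - K₂ x y - c * K₃ x y‖ ≤ h y) :
    ‖kernelOp K₁ - kernelOp K₂ - c • kernelOp K₃‖ ≤ ∫ y, h y := by
  have h0 : 0 ≤ ∫ y, h y := integral_nonneg fun y => (norm_nonneg _).trans (hle 0 y)
  refine ContinuousLinearMap.opNorm_le_bound _ h0 fun f => ?_
  refine (BoundedContinuousFunction.norm_le (by positivity)).2 fun x => ?_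
  have e : (kernelOp K₁ - kernelOp K₂ - c • kernelOp K₃) f x
      = ∫ y, (K₁ x y - K₂ x y - c * K₃ x y) * f y := by
    simp only [sub_apply, smul_apply,
      BoundedContinuousFunction.coe_sub, Pi.sub_apply, BoundedContinuousFunction.coe_smul,
      kernelOp_apply hK₁, kernelOp_apply hK₂, kernelOp_apply hK₃, smul_eq_mul]
    have i₁₂ : Integrable fun y => K₁ x y * f y - K₂ x y * f y :=
      (hK₁.integrable_mul f x).sub (hK₂.integrable_mul f x)
    rw [← integral_const_mul, ← integral_sub (hK₁.integrable_mul f x) (hK₂.integrable_mul f x),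
      ← integral_sub i₁₂ ((hK₃.integrable_mul f x).const_mul c)]
    congr 1; ext y; ring
  rw [e, ← integral_mul_const]
  refine norm_integral_le_of_norm_le (hh.mul_const _) (.of_forall fun y => ?_)
  rw [norm_mul]
  exact mul_le_mul (hle x y) (f.norm_coe_le_norm y) (norm_nonneg _)
    ((norm_nonneg _).trans (hle x y))

lemma norm_kernelOp_le {K : ℝ → ℝ → ℂ} {h : ℝ → ℝ} (hK : IsDominatedKernel K h) :
    ‖kernelOp K‖ ≤ ∫ y, h y := by
  have h0 : 0 ≤ ∫ y, h y := integral_nonneg fun y => (norm_nonneg _).trans (hK.norm_le 0 y)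
  refine ContinuousLinearMap.opNorm_le_bound _ h0 fun f => ?_
  refine (BoundedContinuousFunction.norm_le (by positivity)).2 fun x => ?_
  rw [kernelOp_apply hK]
  exact hK.norm_integral_le f x

/-! ### Volterra operators with an oscillating kernel -/

/-- The geometry of a Volterra operator `f ↦ ∫_{S x} e^{iκ θ(x,y)} q(y) f(y) dy`: the regions
`S x ⊆ base` shrink along the order `y ∈ S x`, and the phase `θ` satisfies
`0 ≤ θ(x,y) ≤ weight y`. -/
structure VolterraGeometry where
  S : ℝ → Set ℝ
  base : Set ℝ
  phase : ℝ → ℝ → ℝ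
  weight : ℝ → ℝ
  measurableSet_S : ∀ x, MeasurableSet (S x)
  measurableSet_base : MeasurableSet base
  S_subset : ∀ x, S x ⊆ base
  S_trans : ∀ x y, y ∈ S x → S y ⊆ S x
  S_eventually : ∀ x₀, ∀ᵐ y, ∀ᶠ x in 𝓝 x₀, (y ∈ S x ↔ y ∈ S x₀)
  continuous_phase : Continuous fun z : ℝ × ℝ => phase z.1 z.2
  phase_nonneg : ∀ x y, 0 ≤ phase x y
  phase_le : ∀ x y, phase x y ≤ weight y
  continuous_weight : Continuous weight

namespace VolterraGeometry

variable (G : VolterraGeometry)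

lemma weight_nonneg (y : ℝ) : 0 ≤ G.weight y := (G.phase_nonneg 0 y).trans (G.phase_le 0 y)

/-- The `j`-th derivative with respect to `κ` of the kernel `1_{S x}(y) e^{iκ θ(x,y)} q(y)`. -/
def kernel (q : ℝ → ℂ) (j : ℕ) (κ : ℂ) (x y : ℝ) : ℂ :=
  (G.S x).indicator (fun y => (I * G.phase x y) ^ j * exp (κ * (I * G.phase x y)) * q y) y

/-- The integral operator with kernel `∂_κ^j (1_{S x}(y) e^{iκ θ(x,y)} q(y))`. -/
def op (q : ℝ → ℂ) (j : ℕ) (κ : ℂ) : (ℝ →ᵇ ℂ) →L[ℂ] (ℝ →ᵇ ℂ) := kernelOp (G.kernel q j κ)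

/-- The density `q` has `n` moments with respect to the weight that dominates the phase. -/
structure Admissible (n : ℕ) (q : ℝ → ℂ) : Prop where
  aestronglyMeasurable : AEStronglyMeasurable q (volume.restrict G.base)
  integrableOn : ∀ j ≤ n, IntegrableOn (fun y => G.weight y ^ j * ‖q y‖) G.base

/-- The exponentials `e^{iκ θ}` are bounded by `M` for `κ ∈ D`. -/
def ExpBound (D : Set ℂ) (M : ℝ) : Prop :=
  ∀ κ ∈ D, ∀ x y, ‖exp (κ * (I * G.phase x y))‖ ≤ M

variable {G} {n j : ℕ} {q : ℝ → ℂ} {D : Set ℂ} {M : ℝ} {κ κ' : ℂ}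

lemma ExpBound.nonneg (hM : G.ExpBound D M) (hκ : κ ∈ D) : 0 ≤ M :=
  (norm_nonneg _).trans (hM κ hκ 0 0)

lemma norm_I_mul_phase (x y : ℝ) : ‖I * (G.phase x y : ℂ)‖ = G.phase x y := by
  simp [abs_of_nonneg (G.phase_nonneg x y)]

lemma norm_kernel_le (hM : G.ExpBound D M) (hκ : κ ∈ D) (q : ℝ → ℂ) (j : ℕ) (x y : ℝ) :
    ‖G.kernel q j κ x y‖ ≤ (G.S x).indicator (fun y => M * (G.weight y ^ j * ‖q y‖)) y := by
  unfold kernel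
  by_cases hy : y ∈ G.S x
  · rw [indicator_of_mem hy, indicator_of_mem hy, norm_mul, norm_mul, norm_pow, norm_I_mul_phase]
    have h1 : G.phase x y ^ j ≤ G.weight y ^ j :=
      pow_le_pow_left₀ (G.phase_nonneg x y) (G.phase_le x y) j
    have h2 := hM κ hκ x y
    have h3 : 0 ≤ G.weight y ^ j := pow_nonneg (G.weight_nonneg y) j
    calc G.phase x y ^ j * ‖exp (κ * (I * G.phase x y))‖ * ‖q y‖
        ≤ G.weight y ^ j * M * ‖q y‖ := by gcongr
      _ = _ := by ring
  · rw [indicator_of_notMem hy, indicator_of_notMem hy, norm_zero]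

lemma indicator_S_le (x y : ℝ) {f : ℝ → ℝ} (hf : ∀ y, 0 ≤ f y) :
    (G.S x).indicator f y ≤ G.base.indicator f y :=
  indicator_le_indicator_of_subset (G.S_subset x) hf y

lemma continuousAt_kernel (q : ℝ → ℂ) (j : ℕ) (κ : ℂ) (x₀ : ℝ) :
    ∀ᵐ y, ContinuousAt (fun x => G.kernel q j κ x y) x₀ := by
  filter_upwards [G.S_eventually x₀] with y hy
  have hθ : Continuous fun x => G.phase x y :=
    G.continuous_phase.comp (continuous_id.prodMk continuous_const)
  by_cases h0 : y ∈ G.S x₀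
  · have : (fun x => G.kernel q j κ x y) =ᶠ[𝓝 x₀]
        fun x => (I * G.phase x y) ^ j * exp (κ * (I * G.phase x y)) * q y := by
      filter_upwards [hy] with x hx
      exact indicator_of_mem (hx.2 h0) _
    refine ContinuousAt.congr ?_ this.symm
    fun_prop
  · have : (fun x => G.kernel q j κ x y) =ᶠ[𝓝 x₀] fun _ => 0 := by
      filter_upwards [hy] with x hx
      exact indicator_of_notMem (fun h => h0 (hx.1 h)) _
    exact continuousAt_const.congr this.symm

lemma aestronglyMeasurable_kernel (hq : AEStronglyMeasurable q (volume.restrict G.base))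
    (j : ℕ) (κ : ℂ) (x : ℝ) : AEStronglyMeasurable (G.kernel q j κ x) volume := by
  have hθ : Continuous fun y => G.phase x y :=
    G.continuous_phase.comp (continuous_const.prodMk continuous_id)
  refine (aestronglyMeasurable_indicator_iff (G.measurableSet_S x)).2 ?_
  have : Continuous fun y => (I * (G.phase x y : ℂ)) ^ j * exp (κ * (I * G.phase x y)) := by
    fun_prop
  exact this.aestronglyMeasurable.mul
    (hq.mono_measure (Measure.restrict_mono (G.S_subset x) le_rfl))

lemma isDominatedKernel (hq : G.Admissible n q) (hj : j ≤ n) (hM : G.ExpBound D M) (hκ : κ ∈ D) :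
    IsDominatedKernel (G.kernel q j κ)
      (G.base.indicator fun y => M * (G.weight y ^ j * ‖q y‖)) where
  aestronglyMeasurable := aestronglyMeasurable_kernel hq.1 j κ
  integrable := (integrable_indicator_iff G.measurableSet_base).2 ((hq.2 j hj).const_mul M)
  norm_le x y := (norm_kernel_le hM hκ q j x y).trans <| indicator_S_le x y fun y => by
    have := hM.nonneg hκ
    have := G.weight_nonneg y
    positivity
  continuousAt := continuousAt_kernel q j κ

lemma op_apply (hq : G.Admissible n q) (hj : j ≤ n) (hM : G.ExpBound D M) (hκ : κ ∈ D)
    (f : ℝ →ᵇ ℂ) (x : ℝ) :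
    G.op q j κ f x =
      ∫ y in G.S x, (I * G.phase x y) ^ j * exp (κ * (I * G.phase x y)) * q y * f y := by
  rw [op, kernelOp_apply (isDominatedKernel hq hj hM hκ),
    ← integral_indicator (G.measurableSet_S x)]
  congr 1; ext y
  by_cases hy : y ∈ G.S x <;> simp [kernel, hy]

lemma norm_op_le (hq : G.Admissible n q) (hj : j ≤ n) (hM : G.ExpBound D M) (hκ : κ ∈ D) :
    ‖G.op q j κ‖ ≤ M * ∫ y in G.base, G.weight y ^ j * ‖q y‖ := by
  refine (norm_kernelOp_le (isDominatedKernel hq hj hM hκ)).trans_eq ?_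
  rw [integral_indicator G.measurableSet_base, integral_const_mul]

/-- A modulus of continuity in `κ` for the operators `G.op q j`. -/
def modulus (G : VolterraGeometry) (q : ℝ → ℂ) (M : ℝ) (j : ℕ) (δ : ℝ) : ℝ :=
  ∫ y in G.base, min (2 * M) (M * (G.weight y * δ)) * (G.weight y ^ j * ‖q y‖)

lemma integrableOn_modulus (hq : G.Admissible n q) (hj : j ≤ n) (hM : 0 ≤ M) {δ : ℝ} (hδ : 0 ≤ δ) :
    IntegrableOn (fun y => min (2 * M) (M * (G.weight y * δ)) * (G.weight y ^ j * ‖q y‖))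
      G.base := by
  refine ((hq.2 j hj).const_mul (2 * M)).mono' ?_ (.of_forall fun y => ?_)
  · have : Continuous fun y => min (2 * M) (M * (G.weight y * δ)) := by
      have := G.continuous_weight
      fun_prop
    exact this.aestronglyMeasurable.mul (hq.2 j hj).aestronglyMeasurable
  · have := G.weight_nonneg y
    rw [Real.norm_of_nonneg (by positivity)]
    gcongr
    exact min_le_left _ _

lemma modulus_nonneg (q : ℝ → ℂ) (j : ℕ) (hM : 0 ≤ M) {δ : ℝ} (hδ : 0 ≤ δ) :
    0 ≤ G.modulus q M j δ :=
  integral_nonneg fun y => by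
    have := G.weight_nonneg y
    simp only [Pi.zero_apply]
    positivity

lemma tendsto_modulus (hq : G.Admissible n q) (hj : j ≤ n) (hM : 0 ≤ M) :
    Tendsto (G.modulus q M j) (𝓝[≥] 0) (𝓝 0) := by
  have key : Tendsto (G.modulus q M j) (𝓝[≥] 0)
      (𝓝 (∫ y in G.base, min (2 * M) (M * (G.weight y * 0)) * (G.weight y ^ j * ‖q y‖))) := by
    refine tendsto_integral_filter_of_dominated_convergence
      (fun y => 2 * M * (G.weight y ^ j * ‖q y‖)) ?_ ?_ ((hq.2 j hj).const_mul (2 * M)) ?_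
    · filter_upwards [self_mem_nhdsWithin] with δ hδ
      exact (integrableOn_modulus hq hj hM hδ).aestronglyMeasurable
    · filter_upwards [self_mem_nhdsWithin] with δ hδ
      refine .of_forall fun y => ?_
      have := G.weight_nonneg y
      have : (0 : ℝ) ≤ δ := hδ
      rw [Real.norm_of_nonneg (by positivity)]
      gcongr
      exact min_le_left _ _
    · refine .of_forall fun y => ?_
      have : Continuous fun δ => min (2 * M) (M * (G.weight y * δ)) * (G.weight y ^ j * ‖q y‖) := by
        fun_prop
      exact (this.tendsto 0).mono_left nhdsWithin_le_nhds
  convert key using 2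
  have h2 : min (2 * M) 0 = 0 := min_eq_right (by positivity)
  simp [h2]

lemma norm_exp_sub_exp_le (hD : Convex ℝ D) (hM : G.ExpBound D M) (hκ : κ ∈ D) (hκ' : κ' ∈ D)
    (x y : ℝ) :
    ‖exp (κ' * (I * G.phase x y)) - exp (κ * (I * G.phase x y))‖ ≤
      min (2 * M) (M * (G.weight y * ‖κ' - κ‖)) := by
  refine le_min ?_ ?_
  · calc _ ≤ _ := norm_sub_le _ _
      _ ≤ M + M := add_le_add (hM κ' hκ' x y) (hM κ hκ x y)
      _ = 2 * M := by ring
  · have hd : ∀ z ∈ D, HasDerivWithinAt (fun z => exp (z * (I * G.phase x y)))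
        (exp (z * (I * G.phase x y)) * (I * G.phase x y)) D z := fun z _ => by
      simpa using ((hasDerivAt_id z).mul_const (I * (G.phase x y : ℂ))).cexp.hasDerivWithinAt
    refine (hD.norm_image_sub_le_of_norm_hasDerivWithin_le (C := M * G.weight y) hd
      (fun z hz => ?_) hκ hκ').trans_eq (by ring)
    rw [norm_mul, norm_I_mul_phase]
    exact mul_le_mul (hM z hz x y) (G.phase_le x y) (G.phase_nonneg x y) (hM.nonneg hz)

lemma norm_exp_sub_exp_sub_le (hD : Convex ℝ D) (hM : G.ExpBound D M) (hκ : κ ∈ D) (hκ' : κ' ∈ D)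
    (x y : ℝ) :
    ‖exp (κ' * (I * G.phase x y)) - exp (κ * (I * G.phase x y)) -
        (κ' - κ) * ((I * G.phase x y) * exp (κ * (I * G.phase x y)))‖ ≤
      ‖κ' - κ‖ * (G.weight y * min (2 * M) (M * (G.weight y * ‖κ' - κ‖))) := by
  set w : ℂ := I * G.phase x y with hw
  have hseg : segment ℝ κ κ' ⊆ D := hD.segment_subset hκ hκ'
  have hd : ∀ z ∈ segment ℝ κ κ', HasDerivWithinAt (fun z => exp (z * w) - z * (w * exp (κ * w)))
      (exp (z * w) * w - w * exp (κ * w)) (segment ℝ κ κ') z := fun z _ => by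
    have h1 : HasDerivAt (fun z => exp (z * w)) (exp (z * w) * w) z := by
      simpa using ((hasDerivAt_id z).mul_const w).cexp
    have h2 : HasDerivAt (fun z => z * (w * exp (κ * w))) (w * exp (κ * w)) z := by
      simpa using (hasDerivAt_id z).mul_const (w * exp (κ * w))
    exact (h1.sub h2).hasDerivWithinAt
  have hb : ∀ z ∈ segment ℝ κ κ', ‖exp (z * w) * w - w * exp (κ * w)‖ ≤
      G.weight y * min (2 * M) (M * (G.weight y * ‖κ' - κ‖)) := fun z hz => by
    have e : exp (z * w) * w - w * exp (κ * w) = w * (exp (z * w) - exp (κ * w)) := by ring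
    have hz' : ‖z - κ‖ ≤ ‖κ' - κ‖ := by
      obtain ⟨t, ht, rfl⟩ := segment_eq_image' ℝ κ κ' ▸ hz
      rw [add_sub_cancel_left, norm_smul, Real.norm_of_nonneg ht.1]
      exact mul_le_of_le_one_left (norm_nonneg _) ht.2
    rw [e, norm_mul, hw, norm_I_mul_phase, ← hw]
    have hM0 := hM.nonneg hκ
    have hw0 := G.weight_nonneg y
    refine mul_le_mul (G.phase_le x y)
      ((norm_exp_sub_exp_le hD hM hκ (hseg hz) x y).trans ?_) (norm_nonneg _) hw0
    gcongr
  have := (convex_segment κ κ').norm_image_sub_le_of_norm_hasDerivWithin_le hd hb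
    (left_mem_segment ℝ κ κ') (right_mem_segment ℝ κ κ')
  calc _ = ‖exp (κ' * w) - κ' * (w * exp (κ * w)) - (exp (κ * w) - κ * (w * exp (κ * w)))‖ := by
        congr 1; ring
    _ ≤ _ := this
    _ = _ := by ring

lemma norm_op_sub_le (hq : G.Admissible n q) (hj : j ≤ n) (hD : Convex ℝ D)
    (hM : G.ExpBound D M) (hκ : κ ∈ D) (hκ' : κ' ∈ D) :
    ‖G.op q j κ' - G.op q j κ‖ ≤ G.modulus q M j ‖κ' - κ‖ := by
  have hM0 := hM.nonneg hκ
  have := norm_kernelOp_sub_sub_smul_le (isDominatedKernel hq hj hM hκ')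
    (isDominatedKernel hq hj hM hκ) (isDominatedKernel hq hj hM hκ) 0
    ((integrable_indicator_iff G.measurableSet_base).2
      (integrableOn_modulus hq hj hM0 (norm_nonneg (κ' - κ)))) (fun x y => ?_)
  · rw [integral_indicator G.measurableSet_base] at this
    have e0 : (0 : ℂ) • kernelOp (G.kernel q j κ) = 0 := by
      ext f x
      simp
    rw [e0, sub_zero] at this
    exact this
  · have hw := G.weight_nonneg y
    refine le_trans ?_ (indicator_S_le x y fun y => by
      have := G.weight_nonneg y; positivity)
    unfold kernel
    by_cases hy : y ∈ G.S x
    · simp only [indicator_of_mem hy, zero_mul, sub_zero]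
      rw [← sub_mul, ← mul_sub, norm_mul, norm_mul, norm_pow, norm_I_mul_phase]
      have h1 : G.phase x y ^ j ≤ G.weight y ^ j :=
        pow_le_pow_left₀ (G.phase_nonneg x y) (G.phase_le x y) j
      have h2 := norm_exp_sub_exp_le hD hM hκ hκ' x y
      calc _ ≤ G.weight y ^ j * min (2 * M) (M * (G.weight y * ‖κ' - κ‖)) * ‖q y‖ := by gcongr
        _ = _ := by ring
    · simp [indicator_of_notMem hy]

lemma norm_op_sub_sub_le (hq : G.Admissible n q) (hj : j + 1 ≤ n) (hD : Convex ℝ D)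
    (hM : G.ExpBound D M) (hκ : κ ∈ D) (hκ' : κ' ∈ D) :
    ‖G.op q j κ' - G.op q j κ - (κ' - κ) • G.op q (j + 1) κ‖ ≤
      ‖κ' - κ‖ * G.modulus q M (j + 1) ‖κ' - κ‖ := by
  have hM0 := hM.nonneg hκ
  have := norm_kernelOp_sub_sub_smul_le (isDominatedKernel hq (j.le_succ.trans hj) hM hκ')
    (isDominatedKernel hq (j.le_succ.trans hj) hM hκ) (isDominatedKernel hq hj hM hκ) (κ' - κ)
    ((integrable_indicator_iff G.measurableSet_base).2
      ((integrableOn_modulus hq hj hM0 (norm_nonneg (κ' - κ))).const_mul ‖κ' - κ‖)) (fun x y => ?_)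
  · rw [integral_indicator G.measurableSet_base, integral_const_mul] at this
    exact this
  · have hw := G.weight_nonneg y
    refine le_trans ?_ (indicator_S_le x y fun y => by
      have := G.weight_nonneg y; positivity)
    unfold kernel
    by_cases hy : y ∈ G.S x
    · simp only [indicator_of_mem hy]
      have e : (I * (G.phase x y : ℂ)) ^ j * exp (κ' * (I * G.phase x y)) * q y -
          (I * G.phase x y) ^ j * exp (κ * (I * G.phase x y)) * q y -
          (κ' - κ) * ((I * G.phase x y) ^ (j + 1) * exp (κ * (I * G.phase x y)) * q y) =
          (I * G.phase x y) ^ j * (exp (κ' * (I * G.phase x y)) - exp (κ * (I * G.phase x y)) -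
            (κ' - κ) * ((I * G.phase x y) * exp (κ * (I * G.phase x y)))) * q y := by ring
      rw [e, norm_mul, norm_mul, norm_pow, norm_I_mul_phase]
      have h1 : G.phase x y ^ j ≤ G.weight y ^ j :=
        pow_le_pow_left₀ (G.phase_nonneg x y) (G.phase_le x y) j
      have h2 := norm_exp_sub_exp_sub_le hD hM hκ hκ' x y
      calc _ ≤ G.weight y ^ j *
            (‖κ' - κ‖ * (G.weight y * min (2 * M) (M * (G.weight y * ‖κ' - κ‖)))) * ‖q y‖ := by
            gcongr
        _ = _ := by ring
    · simp [indicator_of_notMem hy]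

lemma tendsto_modulus_norm_sub (hq : G.Admissible n q) (hj : j ≤ n) (hM : 0 ≤ M) (κ : ℂ) :
    Tendsto (fun κ' => G.modulus q M j ‖κ' - κ‖) (𝓝[D] κ) (𝓝 0) := by
  refine (tendsto_modulus hq hj hM).comp (tendsto_nhdsWithin_iff.2
    ⟨?_, .of_forall fun κ' => norm_nonneg _⟩)
  have : Continuous fun κ' : ℂ => ‖κ' - κ‖ := by fun_prop
  simpa using (this.tendsto κ).mono_left (nhdsWithin_le_nhds (s := D))

lemma continuousOn_op (hq : G.Admissible n q) (hj : j ≤ n) (hD : Convex ℝ D)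
    (hM : G.ExpBound D M) : ContinuousOn (G.op q j) D := fun κ hκ => by
  refine tendsto_iff_norm_sub_tendsto_zero.2 ?_
  refine squeeze_zero' (.of_forall fun _ => norm_nonneg _) ?_
    (tendsto_modulus_norm_sub (D := D) hq hj (hM.nonneg hκ) κ)
  filter_upwards [self_mem_nhdsWithin] with κ' hκ' using norm_op_sub_le hq hj hD hM hκ hκ'

lemma hasDerivWithinAt_op (hq : G.Admissible n q) (hj : j + 1 ≤ n) (hD : Convex ℝ D)
    (hM : G.ExpBound D M) (hκ : κ ∈ D) :
    HasDerivWithinAt (G.op q j) (G.op q (j + 1) κ) D κ := by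
  refine (hasDerivWithinAt_iff_tendsto (F := (ℝ →ᵇ ℂ) →L[ℂ] (ℝ →ᵇ ℂ))).2 ?_
  refine squeeze_zero' (.of_forall fun _ => by positivity) ?_
    (tendsto_modulus_norm_sub (D := D) hq hj (hM.nonneg hκ) κ)
  filter_upwards [self_mem_nhdsWithin] with κ' hκ'
  have h := norm_op_sub_sub_le hq hj hD hM hκ hκ'
  rcases eq_or_ne κ' κ with rfl | hne
  · simpa using modulus_nonneg (G := G) q (j + 1) (hM.nonneg hκ) le_rfl
  · have h0 : 0 < ‖κ' - κ‖ := norm_pos_iff.2 (sub_ne_zero.2 hne)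
    rwa [inv_mul_le_iff₀ h0]

lemma contDiffOn_op (hq : G.Admissible n q) (hD : Convex ℝ D) (hDu : UniqueDiffOn ℂ D)
    (hM : G.ExpBound D M) (l : ℕ) : ∀ j, j + l ≤ n → ContDiffOn ℂ l (G.op q j) D := by
  induction l with
  | zero => exact fun j hj => contDiffOn_zero.2 (continuousOn_op hq hj hD hM)
  | succ l ih =>
    intro j hj
    have hd : ∀ κ ∈ D, HasDerivWithinAt (G.op q j) (G.op q (j + 1) κ) D κ := fun κ hκ =>
      hasDerivWithinAt_op hq (by omega) hD hM hκ
    push_cast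
    refine (contDiffOn_succ_iff_derivWithin hDu).2
      ⟨fun κ hκ => (hd κ hκ).differentiableWithinAt, by simp, ?_⟩
    exact (ih (j + 1) (by omega)).congr fun κ hκ => (hd κ hκ).derivWithin (hDu κ hκ)

lemma iteratedDerivWithin_op (hq : G.Admissible n q) (hD : Convex ℝ D) (hDu : UniqueDiffOn ℂ D)
    (hM : G.ExpBound D M) (i : ℕ) : ∀ j, j + i ≤ n → ∀ κ ∈ D,
      iteratedDerivWithin i (G.op q j) D κ = G.op q (j + i) κ := by
  induction i with
  | zero => intro j _ κ _; simp
  | succ i ih =>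
    intro j hj κ hκ
    have hd : ∀ κ ∈ D, HasDerivWithinAt (G.op q j) (G.op q (j + 1) κ) D κ := fun κ hκ =>
      hasDerivWithinAt_op hq (by omega) hD hM hκ
    have e : EqOn (derivWithin (G.op q j) D) (G.op q (j + 1)) D := fun z hz =>
      HasDerivWithinAt.derivWithin (F := (ℝ →ᵇ ℂ) →L[ℂ] (ℝ →ᵇ ℂ)) (hd z hz) (hDu z hz)
    rw [iteratedDerivWithin_succ', iteratedDerivWithin_congr e hκ, ih (j + 1) (by omega) κ hκ]
    congr 1; omega

end VolterraGeometry

/-! ### Families with bounded derivatives -/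

section BddDeriv

variable {E F H : Type*} [NormedAddCommGroup E] [NormedSpace ℂ E] [NormedAddCommGroup F]
  [NormedSpace ℂ F] [NormedAddCommGroup H] [NormedSpace ℂ H]

/-- `f` is `C^l` on `D`, and its derivatives up to order `l` are bounded by `b` there. -/
structure BddDeriv (l : ℕ) (D : Set ℂ) (b : ℝ) (f : ℂ → E) : Prop where
  contDiffOn : ContDiffOn ℂ l f D
  norm_le : ∀ i ≤ l, ∀ κ ∈ D, ‖iteratedDerivWithin i f D κ‖ ≤ b

namespace BddDeriv

variable {l l' : ℕ} {D : Set ℂ} {a b b' : ℝ} {f f' : ℂ → E} {g : ℂ → F}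

lemma mono (hf : BddDeriv l D b f) (hl : l' ≤ l) (hb : b ≤ b') : BddDeriv l' D b' f :=
  ⟨hf.1.of_le (by exact_mod_cast hl), fun i hi κ hκ => (hf.2 i (hi.trans hl) κ hκ).trans hb⟩

lemma congr (hf : BddDeriv l D b f) (h : EqOn f' f D) : BddDeriv l D b f' :=
  ⟨hf.1.congr h, fun i hi κ hκ => by
    rw [iteratedDerivWithin_congr h hκ]; exact hf.2 i hi κ hκ⟩

lemma add (hD : UniqueDiffOn ℂ D) (hf : BddDeriv l D b f) (hf' : BddDeriv l D b' f') :
    BddDeriv l D (b + b') (fun κ => f κ + f' κ) :=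
  ⟨hf.1.add hf'.1, fun i hi κ hκ => by
    have hil : (i : WithTop ℕ∞) ≤ l := by exact_mod_cast hi
    rw [iteratedDerivWithin_fun_add hκ hD ((hf.1 κ hκ).of_le hil) ((hf'.1 κ hκ).of_le hil)]
    exact (norm_add_le _ _).trans (add_le_add (hf.2 i hi κ hκ) (hf'.2 i hi κ hκ))⟩

lemma bilinear (hD : UniqueDiffOn ℂ D) (ha : 0 ≤ a) (B : E →L[ℂ] F →L[ℂ] H)
    (hf : BddDeriv l D a f) (hg : BddDeriv l D b g) :
    BddDeriv l D (‖B‖ * (2 ^ l * (a * b))) (fun κ => B (f κ) (g κ)) := by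
  refine ⟨B.isBoundedBilinearMap.contDiff.comp_contDiffOn (hf.1.prodMk hg.1), fun i hi κ hκ => ?_⟩
  have hil : (i : WithTop ℕ∞) ≤ l := by exact_mod_cast hi
  have hb : 0 ≤ b := (norm_nonneg _).trans (hg.2 i hi κ hκ)
  rw [← norm_iteratedFDerivWithin_eq_norm_iteratedDerivWithin]
  refine (B.norm_iteratedFDerivWithin_le_of_bilinear hf.1 hg.1 hD hκ hil).trans ?_
  gcongr
  calc _ ≤ ∑ m ∈ Finset.range (i + 1), (i.choose m : ℝ) * (a * b) := by
        refine Finset.sum_le_sum fun m hm => ?_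
        have hm : m ≤ i := by simpa [Nat.lt_succ_iff] using hm
        rw [norm_iteratedFDerivWithin_eq_norm_iteratedDerivWithin,
          norm_iteratedFDerivWithin_eq_norm_iteratedDerivWithin, mul_assoc]
        gcongr
        · exact hf.2 m (hm.trans hi) κ hκ
        · exact hg.2 (i - m) ((Nat.sub_le _ _).trans hi) κ hκ
    _ = 2 ^ i * (a * b) := by
        rw [← Finset.sum_mul]
        exact_mod_cast congrArg (· * (a * b)) (by exact_mod_cast Nat.sum_range_choose i)
    _ ≤ 2 ^ l * (a * b) := by gcongr; norm_num

lemma clm_comp (hD : UniqueDiffOn ℂ D) (L : E →L[ℂ] H) (hf : BddDeriv l D b f) :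
    BddDeriv l D (‖L‖ * b) (fun κ => L (f κ)) := by
  refine ⟨L.contDiff.comp_contDiffOn hf.1, fun i hi κ hκ => ?_⟩
  have hil : (i : WithTop ℕ∞) ≤ l := by exact_mod_cast hi
  rw [← norm_iteratedFDerivWithin_eq_norm_iteratedDerivWithin]
  refine (L.norm_iteratedFDerivWithin_comp_left ((hf.1 κ hκ).of_le hil) hD hκ le_rfl).trans ?_
  rw [norm_iteratedFDerivWithin_eq_norm_iteratedDerivWithin]
  gcongr
  exact hf.2 i hi κ hκ

lemma derivWithin (hD : UniqueDiffOn ℂ D) (hf : BddDeriv (l + 1) D b f) :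
    BddDeriv l D b (derivWithin f D) := by
  refine ⟨hf.1.derivWithin hD (by norm_cast), fun i hi κ hκ => ?_⟩
  rw [← iteratedDerivWithin_succ']
  exact hf.2 (i + 1) (by omega) κ hκ

lemma of_derivWithin (hc : ContDiffOn ℂ (l + 1 : ℕ) f D) (h0 : ∀ κ ∈ D, ‖f κ‖ ≤ b)
    (h1 : BddDeriv l D b (_root_.derivWithin f D)) : BddDeriv (l + 1) D b f := by
  refine ⟨hc, fun i hi κ hκ => ?_⟩
  cases i with
  | zero => simpa using h0 κ hκ
  | succ i =>
    rw [iteratedDerivWithin_succ']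
    exact h1.2 i (by omega) κ hκ

end BddDeriv

/-- If `F = T F + r` and the equation `g = T g + h` is uniformly stable, the derivatives of `F` are
bounded linearly in terms of those of `r`, by a constant that depends only on the bounds for `T`
and the stability constant: the derivative `F'` solves the same equation with right-hand side
`T' F + r'`. -/
lemma exists_bddDeriv_of_eq_add (l : ℕ) {a ρ : ℝ} (ha : 0 ≤ a) (hρ : 0 ≤ ρ) :
    ∃ C, 0 ≤ C ∧ ∀ (D : Set ℂ) (T : ℂ → E →L[ℂ] E) (r F : ℂ → E) (b : ℝ), UniqueDiffOn ℂ D →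
      0 ≤ b → BddDeriv l D a T → (∀ κ ∈ D, ∀ g h : E, g = T κ g + h → ‖g‖ ≤ ρ * ‖h‖) →
      BddDeriv l D b r → ContDiffOn ℂ l F D → (∀ κ ∈ D, F κ = T κ (F κ) + r κ) →
      BddDeriv l D (C * b) F := by
  induction l with
  | zero =>
    refine ⟨ρ, hρ, fun D T r F b hD hb hT hs hr hF hE => ⟨hF, fun i hi κ hκ => ?_⟩⟩
    obtain rfl : i = 0 := by omega
    have := hr.2 0 le_rfl κ hκ
    simp only [iteratedDerivWithin_zero] at this ⊢
    exact (hs κ hκ _ _ (hE κ hκ)).trans (by gcongr)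
  | succ l ih =>
    obtain ⟨C, hC, ih⟩ := ih
    refine ⟨max ρ (C * (2 ^ l * (a * C) + 1)), le_max_of_le_left hρ,
      fun D T r F b hD hb hT hs hr hF hE => ?_⟩
    have hF0 : BddDeriv l D (C * b) F := ih D T r F b hD hb (hT.mono (by omega) le_rfl) hs
      (hr.mono (by omega) le_rfl) (hF.of_le (by norm_cast; omega)) hE
    have hb0 : BddDeriv l D ((2 ^ l * (a * C) + 1) * b)
        (fun κ => derivWithin T D κ (F κ) + derivWithin r D κ) := by
      refine (((hT.derivWithin hD).bilinear hD ha (ContinuousLinearMap.id ℂ (E →L[ℂ] E)) hF0).add hD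
        (hr.derivWithin hD)).mono le_rfl ?_
      have : ‖ContinuousLinearMap.id ℂ (E →L[ℂ] E)‖ ≤ 1 := ContinuousLinearMap.norm_id_le
      calc _ ≤ 1 * (2 ^ l * (a * (C * b))) + b := by gcongr
        _ = _ := by ring
    have hdiff : ∀ κ ∈ D, derivWithin F D κ =
        T κ (derivWithin F D κ) + (derivWithin T D κ (F κ) + derivWithin r D κ) := by
      intro κ hκ
      have h1 : ((l + 1 : ℕ) : WithTop ℕ∞) ≠ 0 := by norm_cast
      have dT := (hT.1.differentiableOn h1 κ hκ).hasDerivWithinAt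
      have dr := (hr.1.differentiableOn h1 κ hκ).hasDerivWithinAt
      have dF := (hF.differentiableOn h1 κ hκ).hasDerivWithinAt
      have := ((dT.clm_apply dF).add dr).congr (fun z hz => hE z hz) (hE κ hκ)
      have h2 := this.derivWithin (hD κ hκ)
      rw [add_comm (derivWithin T D κ (F κ)), add_assoc] at h2
      exact h2
    refine .of_derivWithin hF (fun κ hκ => ?_) ?_
    · have := hr.2 0 (by omega) κ hκ
      simp only [iteratedDerivWithin_zero] at this
      calc _ ≤ ρ * ‖r κ‖ := hs κ hκ _ _ (hE κ hκ)
        _ ≤ ρ * b := by gcongr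
        _ ≤ _ := by gcongr; exact le_max_left _ _
    · refine (ih D T _ _ _ hD (by positivity) (hT.mono (by omega) le_rfl) hs hb0
        (hF.derivWithin hD (by norm_cast)) hdiff).mono le_rfl ?_
      rw [← mul_assoc]
      gcongr
      exact le_max_right _ _

end BddDeriv

/-! ### The resolvent of a Volterra operator -/

namespace VolterraGeometry

variable {G : VolterraGeometry} {n : ℕ} {p q : ℝ → ℂ} {D : Set ℂ} {M : ℝ} {κ : ℂ}

variable (G) in
/-- The mass of the density `p` on the region of integration at `x`. -/
def mass (p : ℝ → ℂ) (x : ℝ) : ℝ := ∫ y in G.S x, ‖p y‖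

/-- An integrable density for which `∫_{S x} |p| mass^l ≤ mass(x)^{l+1} / (l+1)`, the estimate
responsible for the factorial decay of iterated Volterra operators. -/
structure VolterraDensity (G : VolterraGeometry) (p : ℝ → ℂ) : Prop where
  admissible : G.Admissible 0 p
  integral_le : ∀ (l : ℕ) (x : ℝ),
    ∫ y in G.S x, ‖p y‖ * G.mass p y ^ l ≤ G.mass p x ^ (l + 1) / (l + 1)

lemma Admissible.integrableOn_norm (hp : G.Admissible n p) :
    IntegrableOn (fun y => ‖p y‖) G.base := by
  simpa using hp.2 0 (Nat.zero_le _)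

lemma mass_nonneg (p : ℝ → ℂ) (x : ℝ) : 0 ≤ G.mass p x := integral_nonneg fun _ => norm_nonneg _

lemma mass_le (hp : G.Admissible n p) (x : ℝ) : G.mass p x ≤ ∫ y in G.base, ‖p y‖ :=
  setIntegral_mono_set hp.integrableOn_norm (.of_forall fun _ => norm_nonneg _)
    (G.S_subset x).eventuallyLE

lemma mass_anti (hp : G.Admissible n p) {x y : ℝ} (h : y ∈ G.S x) : G.mass p y ≤ G.mass p x :=
  setIntegral_mono_set (hp.integrableOn_norm.mono_set (G.S_subset x))
    (.of_forall fun _ => norm_nonneg _) (G.S_trans x y h).eventuallyLE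

lemma continuous_mass (hp : G.Admissible n p) : Continuous (G.mass p) := by
  have e : G.mass p = fun x => ∫ y, (G.S x).indicator (fun y => ‖p y‖) y :=
    funext fun x => (integral_indicator (G.measurableSet_S x)).symm
  rw [e]
  refine continuous_iff_continuousAt.2 fun x₀ => ?_
  refine continuousAt_of_dominated (bound := G.base.indicator fun y => ‖p y‖) ?_ ?_
    ((integrable_indicator_iff G.measurableSet_base).2 hp.integrableOn_norm) ?_
  · exact .of_forall fun x => ((integrable_indicator_iff (G.measurableSet_S x)).2
      (hp.integrableOn_norm.mono_set (G.S_subset x))).aestronglyMeasurable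
  · refine .of_forall fun x => .of_forall fun y => ?_
    rw [Real.norm_of_nonneg (indicator_nonneg (fun _ _ => norm_nonneg _) _)]
    exact indicator_S_le x y fun _ => norm_nonneg _
  · filter_upwards [G.S_eventually x₀] with y hy
    refine (continuousAt_const (y := (G.S x₀).indicator (fun y => ‖p y‖) y)).congr ?_
    filter_upwards [hy] with x hx
    by_cases h : y ∈ G.S x₀
    · rw [indicator_of_mem h, indicator_of_mem (hx.2 h)]
    · rw [indicator_of_notMem h, indicator_of_notMem (fun h' => h (hx.1 h'))]

lemma expBound_zero : G.ExpBound {0} 1 := by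
  rintro κ rfl x y
  simp

lemma op_zero_apply (hp : G.Admissible n p) (f : ℝ →ᵇ ℂ) (x : ℝ) :
    G.op p 0 0 f x = ∫ y in G.S x, p y * f y := by
  rw [op_apply hp (Nat.zero_le _) expBound_zero (mem_singleton 0)]
  simp

lemma norm_op_zero_le (hp : G.Admissible n p) : ‖G.op p 0 0‖ ≤ ∫ y in G.base, ‖p y‖ := by
  simpa using norm_op_le hp (Nat.zero_le _) expBound_zero (mem_singleton 0)

lemma norm_op_le_mul_integral (hq : G.Admissible n q) (hM : G.ExpBound D M) (hκ : κ ∈ D) :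
    ‖G.op q 0 κ‖ ≤ M * ∫ y in G.base, ‖q y‖ := by
  simpa using norm_op_le hq (Nat.zero_le _) hM hκ

variable (G) in
/-- The product `P Q_κ` of the Volterra operators with densities `p` (without oscillation)
and `q`. -/
def prodOp (p q : ℝ → ℂ) (κ : ℂ) : (ℝ →ᵇ ℂ) →L[ℂ] (ℝ →ᵇ ℂ) := G.op p 0 0 ∘L G.op q 0 κ

lemma norm_op_apply_le_of_le (hq : G.Admissible n q) (hM : G.ExpBound D M) (hκ : κ ∈ D)
    (f : ℝ →ᵇ ℂ) (x : ℝ) {b : ℝ} (hb : 0 ≤ b) (hf : ∀ y ∈ G.S x, ‖f y‖ ≤ b) :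
    ‖G.op q 0 κ f x‖ ≤ M * (∫ y in G.base, ‖q y‖) * b := by
  have hM0 := hM.nonneg hκ
  rw [op_apply hq (Nat.zero_le _) hM hκ]
  calc _ ≤ ∫ y in G.S x, M * ‖q y‖ * b := by
        refine norm_integral_le_of_norm_le
          (((hq.integrableOn_norm.mono_set (G.S_subset x)).const_mul M).mul_const b) ?_
        filter_upwards [ae_restrict_mem (G.measurableSet_S x)] with y hy
        rw [norm_mul, norm_mul, pow_zero, one_mul]
        gcongr
        · exact hM κ hκ x y
        · exact hf y hy
    _ = M * (∫ y in G.S x, ‖q y‖) * b := by rw [integral_mul_const, integral_const_mul]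
    _ ≤ _ := mul_le_mul_of_nonneg_right
        (mul_le_mul_of_nonneg_left (mass_le hq x) hM0) hb

/-- The factorial decay of the iterates of a Volterra operator: after `l` steps the kernel mass up
to `x` enters as `mass ^ l / l!`, so that no smallness of the potential is needed. -/
lemma norm_prodOp_pow_apply_le (hp : G.VolterraDensity p) (hq : G.Admissible n q)
    (hM : G.ExpBound D M) (hκ : κ ∈ D) (f : ℝ →ᵇ ℂ) (l : ℕ) : ∀ x,
    ‖((G.prodOp p q κ) ^ l) f x‖ ≤
      ‖f‖ * ((M * ∫ y in G.base, ‖q y‖) * G.mass p x) ^ l / l.factorial := by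
  set c := M * ∫ y in G.base, ‖q y‖ with hc
  have hc0 : 0 ≤ c := mul_nonneg (hM.nonneg hκ) (integral_nonneg fun _ => norm_nonneg _)
  induction l with
  | zero => intro x; simpa using f.norm_coe_le_norm x
  | succ l ih =>
    intro x
    have hl : (0 : ℝ) < l.factorial := by exact_mod_cast l.factorial_pos
    set g := ((G.prodOp p q κ) ^ l) f with hg
    have e : ((G.prodOp p q κ) ^ (l + 1)) f x = ∫ y in G.S x, p y * G.op q 0 κ g y := by
      rw [pow_succ', ← op_zero_apply hp.1]
      rfl
    rw [e]
    have hQ : ∀ y, ‖G.op q 0 κ g y‖ ≤ ‖f‖ * c ^ (l + 1) / l.factorial * G.mass p y ^ l := by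
      intro y
      have hm := mass_nonneg (G := G) p y
      refine (norm_op_apply_le_of_le hq hM hκ g y
        (b := ‖f‖ * (c * G.mass p y) ^ l / l.factorial) (by positivity) fun z hz => ?_).trans_eq ?_
      · refine (ih z).trans ?_
        have hm' := mass_nonneg (G := G) p z
        have := mass_anti hp.1 hz
        gcongr
      · rw [← hc]; ring
    have hi : IntegrableOn (fun y => ‖p y‖ * G.mass p y ^ l) (G.S x) := by
      refine ((hp.1.integrableOn_norm.mono_set (G.S_subset x)).mul_const
        ((∫ y in G.base, ‖p y‖) ^ l)).mono' ?_ (.of_forall fun y => ?_)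
      · exact (hp.1.integrableOn_norm.mono_set (G.S_subset x)).aestronglyMeasurable.mul
          ((continuous_mass hp.1).pow l).aestronglyMeasurable
      · have hm := mass_nonneg (G := G) p y
        rw [Real.norm_of_nonneg (by positivity)]
        gcongr
        exact mass_le hp.1 y
    calc _ ≤ ∫ y in G.S x, ‖f‖ * c ^ (l + 1) / l.factorial * (‖p y‖ * G.mass p y ^ l) := by
          refine norm_integral_le_of_norm_le (hi.const_mul _) (.of_forall fun y => ?_)
          rw [norm_mul]
          calc _ ≤ ‖p y‖ * (‖f‖ * c ^ (l + 1) / l.factorial * G.mass p y ^ l) := by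
                gcongr; exact hQ y
            _ = _ := by ring
      _ = ‖f‖ * c ^ (l + 1) / l.factorial * ∫ y in G.S x, ‖p y‖ * G.mass p y ^ l :=
          integral_const_mul _ _
      _ ≤ ‖f‖ * c ^ (l + 1) / l.factorial * (G.mass p x ^ (l + 1) / (l + 1)) := by
          gcongr
          exact hp.2 l x
      _ = _ := by
          rw [Nat.factorial_succ]
          push_cast
          rw [mul_pow c]
          field_simp

lemma norm_prodOp_pow_le (hp : G.VolterraDensity p) (hq : G.Admissible n q)
    (hM : G.ExpBound D M) (hκ : κ ∈ D) (l : ℕ) :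
    ‖(G.prodOp p q κ) ^ l‖ ≤
      ((M * ∫ y in G.base, ‖q y‖) * ∫ y in G.base, ‖p y‖) ^ l / l.factorial := by
  have hc0 : 0 ≤ M * ∫ y in G.base, ‖q y‖ :=
    mul_nonneg (hM.nonneg hκ) (integral_nonneg fun _ => norm_nonneg _)
  have ha : 0 ≤ ∫ y in G.base, ‖p y‖ := integral_nonneg fun _ => norm_nonneg _
  refine ContinuousLinearMap.opNorm_le_bound _ (by positivity) fun f => ?_
  refine (BoundedContinuousFunction.norm_le (by positivity)).2 fun x => ?_
  refine (norm_prodOp_pow_apply_le hp hq hM hκ f l x).trans ?_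
  have hm := mass_nonneg (G := G) p x
  have := mass_le hp.1 x
  calc _ ≤ ‖f‖ * ((M * ∫ y in G.base, ‖q y‖) * ∫ y in G.base, ‖p y‖) ^ l / l.factorial := by
        gcongr
    _ = _ := by ring

variable (G) in
/-- The stability constant of the equation `f = P Q_κ f + h`. -/
def stab (p q : ℝ → ℂ) (M : ℝ) : ℝ :=
  Real.exp ((M * ∫ y in G.base, ‖q y‖) * ∫ y in G.base, ‖p y‖)

variable (G) in
/-- The inverse of `1 - P Q_κ`. -/
def resolvent (p q : ℝ → ℂ) (κ : ℂ) : (ℝ →ᵇ ℂ) →L[ℂ] (ℝ →ᵇ ℂ) :=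
  Ring.inverse (1 - G.prodOp p q κ)

lemma summable_prodOp_pow (hp : G.VolterraDensity p) (hq : G.Admissible n q)
    (hM : G.ExpBound D M) (hκ : κ ∈ D) : Summable fun l => (G.prodOp p q κ) ^ l :=
  .of_norm_bounded (Real.summable_pow_div_factorial _) (norm_prodOp_pow_le hp hq hM hκ)

lemma isUnit_one_sub_prodOp (hp : G.VolterraDensity p) (hq : G.Admissible n q)
    (hM : G.ExpBound D M) (hκ : κ ∈ D) : IsUnit (1 - G.prodOp p q κ) :=
  have h := summable_prodOp_pow hp hq hM hκ
  ⟨⟨_, _, h.one_sub_mul_tsum_pow, h.tsum_pow_mul_one_sub⟩, rfl⟩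

lemma resolvent_eq_tsum (hp : G.VolterraDensity p) (hq : G.Admissible n q)
    (hM : G.ExpBound D M) (hκ : κ ∈ D) :
    G.resolvent p q κ = ∑' l, (G.prodOp p q κ) ^ l :=
  have h := summable_prodOp_pow hp hq hM hκ
  Ring.inverse_unit (⟨_, _, h.one_sub_mul_tsum_pow, h.tsum_pow_mul_one_sub⟩ : (_ →L[ℂ] _)ˣ)

lemma norm_resolvent_le (hp : G.VolterraDensity p) (hq : G.Admissible n q)
    (hM : G.ExpBound D M) (hκ : κ ∈ D) : ‖G.resolvent p q κ‖ ≤ G.stab p q M := by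
  rw [resolvent_eq_tsum hp hq hM hκ]
  refine tsum_of_norm_bounded ?_ (norm_prodOp_pow_le hp hq hM hκ)
  rw [stab, Real.exp_eq_exp_ℝ]
  exact NormedSpace.expSeries_div_hasSum_exp _

lemma resolvent_apply_eq (hp : G.VolterraDensity p) (hq : G.Admissible n q)
    (hM : G.ExpBound D M) (hκ : κ ∈ D) (h : ℝ →ᵇ ℂ) :
    G.resolvent p q κ h = G.prodOp p q κ (G.resolvent p q κ h) + h := by
  have e := Ring.mul_inverse_cancel _ (isUnit_one_sub_prodOp hp hq hM hκ)
  have e' : (1 - G.prodOp p q κ) (G.resolvent p q κ h) = h := congrArg (fun L => L h) e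
  rw [sub_apply, one_apply_eq_self] at e'
  rw [add_comm]
  exact sub_eq_iff_eq_add.1 e'

lemma eq_resolvent_apply (hp : G.VolterraDensity p) (hq : G.Admissible n q)
    (hM : G.ExpBound D M) (hκ : κ ∈ D) {g h : ℝ →ᵇ ℂ} (hg : g = G.prodOp p q κ g + h) :
    g = G.resolvent p q κ h := by
  have e := Ring.inverse_mul_cancel _ (isUnit_one_sub_prodOp hp hq hM hκ)
  have e' : G.resolvent p q κ ((1 - G.prodOp p q κ) g) = g := congrArg (fun L => L g) e
  rw [sub_apply, one_apply_eq_self] at e'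
  rw [← e']
  congr 1
  rw [sub_eq_iff_eq_add, add_comm]
  exact hg

lemma norm_le_of_eq_add (hp : G.VolterraDensity p) (hq : G.Admissible n q)
    (hM : G.ExpBound D M) (hκ : κ ∈ D) {g h : ℝ →ᵇ ℂ} (hg : g = G.prodOp p q κ g + h) :
    ‖g‖ ≤ G.stab p q M * ‖h‖ := by
  rw [eq_resolvent_apply hp hq hM hκ hg]
  exact (ContinuousLinearMap.le_opNorm _ _).trans
    (mul_le_mul_of_nonneg_right (norm_resolvent_le hp hq hM hκ) (norm_nonneg _))

lemma contDiffOn_prodOp (hq : G.Admissible n q) (hD : Convex ℝ D) (hDu : UniqueDiffOn ℂ D)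
    (hM : G.ExpBound D M) : ContDiffOn ℂ n (G.prodOp p q) D :=
  ContDiffOn.clm_comp (contDiffOn_const (c := G.op p 0 0))
    (contDiffOn_op hq hD hDu hM n 0 (by omega))

/-- The Neumann series of `1 - prodOp` converges by the factorial decay, and inversion is smooth. -/
lemma contDiffOn_resolvent (hp : G.VolterraDensity p) (hq : G.Admissible n q) (hD : Convex ℝ D)
    (hDu : UniqueDiffOn ℂ D) (hM : G.ExpBound D M) : ContDiffOn ℂ n (G.resolvent p q) D := by
  intro κ hκ
  have hu := isUnit_one_sub_prodOp hp hq hM hκ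
  have h1 : ContDiffAt ℂ n Ring.inverse (1 - G.prodOp p q κ) := by
    have := contDiffAt_ringInverse (R := (ℝ →ᵇ ℂ) →L[ℂ] (ℝ →ᵇ ℂ)) ℂ (n := n) hu.unit
    rwa [hu.unit_spec] at this
  exact h1.comp_contDiffWithinAt κ
    (contDiffWithinAt_const.sub (contDiffOn_prodOp hq hD hDu hM κ hκ))

lemma bddDeriv_op (hq : G.Admissible n q) (hD : Convex ℝ D) (hDu : UniqueDiffOn ℂ D)
    (hM : G.ExpBound D M) (hM0 : 0 ≤ M) {l : ℕ} (hl : l ≤ n) {b : ℝ}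
    (hb : ∀ i ≤ l, ∫ y in G.base, G.weight y ^ i * ‖q y‖ ≤ b) :
    BddDeriv l D (M * b) (G.op q 0) := by
  refine ⟨contDiffOn_op hq hD hDu hM l 0 (by omega), fun i hi κ hκ => ?_⟩
  rw [iteratedDerivWithin_op hq hD hDu hM i 0 (by omega) κ hκ, zero_add]
  exact (norm_op_le hq (hi.trans hl) hM hκ).trans (mul_le_mul_of_nonneg_left (hb i hi) hM0)

end VolterraGeometry

/-! ### Tails and primitives of integrable functions -/

section Primitive

variable {E : Type*} [NormedAddCommGroup E] [NormedSpace ℝ E] {f : ℝ → E} {c : ℝ}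

lemma integral_Ioi_eq_sub (hf : Continuous f) (hi : IntegrableOn f (Ioi c)) (x : ℝ) :
    ∫ y in Ioi x, f y = (∫ y in Ioi c, f y) - ∫ y in c..x, f y := by
  have h := intervalIntegral.integral_interval_add_Ioi' (hf.intervalIntegrable x c) hi
  rw [← h, intervalIntegral.integral_symm x c]
  abel

lemma hasDerivAt_integral_Ioi [CompleteSpace E] (hf : Continuous f) (hi : IntegrableOn f (Ioi c))
    (x : ℝ) :
    HasDerivAt (fun x => ∫ y in Ioi x, f y) (-f x) x := by
  rw [funext (integral_Ioi_eq_sub hf hi)]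
  exact (intervalIntegral.integral_hasDerivAt_right (hf.intervalIntegrable c x)
    hf.aestronglyMeasurable.stronglyMeasurableAtFilter hf.continuousAt).const_sub _

lemma tendsto_integral_Ioi_zero (hi : IntegrableOn f (Ioi c)) :
    Tendsto (fun x => ∫ y in Ioi x, f y) atTop (𝓝 0) := by
  have h := (intervalIntegral_tendsto_integral_Ioi c hi tendsto_id).const_sub (∫ y in Ioi c, f y)
  rw [sub_self] at h
  refine h.congr' ?_
  filter_upwards [eventually_ge_atTop c] with x hx
  rw [id, ← intervalIntegral.integral_Ioi_sub_Ioi hi hx]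
  abel

end Primitive

namespace VolterraGeometry

/-! ### The half-line `[x₀, ∞)` and the interval `[0, R]` -/

/-- The geometry of `f ↦ ∫_x^∞ e^{2iκ(y-x)} q(y) f(y) dy` for `x ≥ x₀`; the argument `x` is
replaced by `max x x₀`, so that the operators act on functions on the whole line. -/
def tail (x₀ : ℝ) : VolterraGeometry where
  S x := Ioi (max x x₀)
  base := Ioi x₀
  phase x y := 2 * max (y - max x x₀) 0
  weight y := 2 * max (y - x₀) 0
  measurableSet_S _ := measurableSet_Ioi
  measurableSet_base := measurableSet_Ioi
  S_subset x := Ioi_subset_Ioi (le_max_right _ _)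
  S_trans x y h := Ioi_subset_Ioi (max_le (le_max_of_le_left
    ((le_max_left x x₀).trans (mem_Ioi.1 h).le)) (le_max_right _ _))
  S_eventually x := by
    have h : ∀ᵐ y : ℝ, y ≠ max x x₀ := Measure.ae_ne volume _
    filter_upwards [h] with y hy
    have hc : Tendsto (fun z => max z x₀) (𝓝 x) (𝓝 (max x x₀)) :=
      (continuous_id.max continuous_const).tendsto x
    rcases hy.lt_or_gt with hy | hy
    · filter_upwards [hc.eventually (lt_mem_nhds hy)] with z hz
      simp only [mem_Ioi, hz.not_gt, hy.not_gt]
    · filter_upwards [hc.eventually (gt_mem_nhds hy)] with z hz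
      simp only [mem_Ioi, hz, hy]
  continuous_phase := by fun_prop
  phase_nonneg x y := by positivity
  phase_le x y := by
    have := le_max_right x x₀
    gcongr
  continuous_weight := by fun_prop

/-- The geometry of `f ↦ ∫_0^x e^{2iκ(x-y)} q(y) f(y) dy` for `0 ≤ x ≤ R`; the argument `x` is
clamped to `[0, R]`, so that the operators act on functions on the whole line. -/
def head (R : ℝ) : VolterraGeometry where
  S x := Ioc 0 (min (max x 0) R)
  base := Ioc 0 R
  phase x y := 2 * max (min (max x 0) R - max y 0) 0
  weight _ := 2 * max R 0
  measurableSet_S _ := measurableSet_Ioc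
  measurableSet_base := measurableSet_Ioc
  S_subset x := Ioc_subset_Ioc_right (min_le_right _ _)
  S_trans x y h := Ioc_subset_Ioc_right
    ((min_le_left _ _).trans (max_le h.2 (h.1.le.trans h.2)))
  S_eventually x := by
    have h : ∀ᵐ y : ℝ, y ≠ min (max x 0) R := Measure.ae_ne volume _
    filter_upwards [h] with y hy
    have hc : Tendsto (fun z => min (max z 0) R) (𝓝 x) (𝓝 (min (max x 0) R)) :=
      ((continuous_id.max continuous_const).min continuous_const).tendsto x
    rcases hy.lt_or_gt with hy | hy
    · filter_upwards [hc.eventually (lt_mem_nhds hy)] with z hz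
      simp only [mem_Ioc, hz.le, hy.le]
    · filter_upwards [hc.eventually (gt_mem_nhds hy)] with z hz
      simp only [mem_Ioc, hz.not_ge, hy.not_ge]
  continuous_phase := by fun_prop
  phase_nonneg x y := by positivity
  phase_le x y := by
    have h1 : min (max x 0) R ≤ R := min_le_right _ _
    have h2 : 0 ≤ max y 0 := le_max_right _ _
    gcongr
    linarith
  continuous_weight := by fun_prop

lemma norm_exp_mul_I_mul (κ : ℂ) (t : ℝ) : ‖exp (κ * (I * t))‖ = Real.exp (-κ.im * t) := by
  rw [norm_exp]
  congr 1
  simp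

lemma tail_expBound (x₀ : ℝ) : (tail x₀).ExpBound closedUpper 1 := fun κ hκ x y => by
  rw [norm_exp_mul_I_mul]
  have h1 : 0 ≤ κ.im := hκ
  have h2 := (tail x₀).phase_nonneg x y
  exact Real.exp_le_one_iff.2 (by nlinarith)

lemma head_phase_le {R : ℝ} (hR : 0 ≤ R) (x y : ℝ) : (head R).phase x y ≤ 2 * R := by
  have := (head R).phase_le x y
  simpa [head, max_eq_left hR] using this

lemma head_expBound {R b : ℝ} (hR : 0 ≤ R) (hb : 0 ≤ b) :
    (head R).ExpBound {κ | -b < κ.im} (Real.exp (2 * (b * R))) := fun κ hκ x y => by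
  rw [norm_exp_mul_I_mul]
  have h1 : -b < κ.im := hκ
  have h2 := (head R).phase_nonneg x y
  have h3 := head_phase_le hR x y
  refine Real.exp_le_exp.2 ?_
  nlinarith

lemma head_expBound_singleton {R M : ℝ} (hR : 0 ≤ R) {κ : ℂ}
    (h : ∀ s ∈ Icc 0 R, ‖exp (2 * I * κ * (s : ℝ))‖ ≤ M) : (head R).ExpBound {κ} M := by
  rintro _ rfl x y
  have h2 := (head R).phase_nonneg x y
  have h3 := head_phase_le hR x y
  convert h ((head R).phase x y / 2) ⟨by linarith, by linarith⟩ using 3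
  push_cast
  ring

lemma tail_volterraDensity {p : ℝ → ℂ} {x₀ : ℝ} (hp : Continuous p)
    (hi : IntegrableOn (fun y => ‖p y‖) (Ioi x₀)) : (tail x₀).VolterraDensity p := by
  refine ⟨⟨hp.aestronglyMeasurable, fun j hj => ?_⟩, fun l x => ?_⟩
  · obtain rfl : j = 0 := by omega
    simp only [pow_zero, one_mul]
    exact hi
  · set z := max x x₀ with hz
    have hz0 : x₀ ≤ z := le_max_right _ _
    set a : ℝ → ℝ := fun y => ∫ t in Ioi y, ‖p t‖ with ha
    have hd : ∀ y, HasDerivAt a (-‖p y‖) y := hasDerivAt_integral_Ioi hp.norm hi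
    have hmass : ∀ y, (tail x₀).mass p y = a (max y x₀) := fun y => rfl
    have hae : ∫ y in Ioi z, ‖p y‖ * (tail x₀).mass p y ^ l = ∫ y in Ioi z, ‖p y‖ * a y ^ l := by
      refine setIntegral_congr_fun measurableSet_Ioi fun y hy => ?_
      simp only [hmass]
      rw [max_eq_left (hz0.trans (le_of_lt hy))]
    have hD : ∀ y ∈ Ici z,
        HasDerivAt (fun y => -(a y ^ (l + 1) / (l + 1))) (‖p y‖ * a y ^ l) y := by
      intro y _
      have := (((hd y).pow (l + 1)).div_const ((l : ℝ) + 1)).neg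
      refine this.congr_deriv ?_
      push_cast
      field_simp
    have hlim : Tendsto (fun y => -(a y ^ (l + 1) / (l + 1))) atTop (𝓝 0) := by
      have := (((tendsto_integral_Ioi_zero hi).pow (l + 1)).div_const ((l : ℝ) + 1)).neg
      simpa using this
    have h0 : ∀ y ∈ Ioi z, 0 ≤ ‖p y‖ * a y ^ l := fun y _ => by
      have : 0 ≤ a y := integral_nonneg fun _ => norm_nonneg _
      positivity
    change ∫ y in Ioi z, _ ≤ _
    rw [hae, integral_Ioi_of_hasDerivAt_of_nonneg' hD h0 hlim, hmass, ← hz]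
    simp

lemma head_volterraDensity {p : ℝ → ℂ} (hp : Continuous p) (R : ℝ) :
    (head R).VolterraDensity p := by
  refine ⟨⟨hp.aestronglyMeasurable, fun j hj => ?_⟩, fun l x => ?_⟩
  · obtain rfl : j = 0 := by omega
    simp only [pow_zero, one_mul]
    exact hp.norm.integrableOn_Ioc
  · set z := min (max x 0) R with hz
    set a : ℝ → ℝ := fun y => ∫ t in (0 : ℝ)..y, ‖p t‖ with ha
    have hd : ∀ y, HasDerivAt a (‖p y‖) y := fun y =>
      intervalIntegral.integral_hasDerivAt_right (hp.norm.intervalIntegrable 0 y)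
        hp.norm.aestronglyMeasurable.stronglyMeasurableAtFilter hp.norm.continuousAt
    have hmass0 : ∀ y, (head R).mass p y = ∫ t in Ioc 0 (min (max y 0) R), ‖p t‖ := fun y => rfl
    change ∫ y in Ioc 0 z, _ ≤ _
    rw [hmass0, ← hz]
    rcases le_or_gt z 0 with h | h
    · simp [Ioc_eq_empty h.not_gt]
    have hae : ∫ y in Ioc 0 z, ‖p y‖ * (head R).mass p y ^ l =
        ∫ y in Ioc 0 z, ‖p y‖ * a y ^ l := by
      refine setIntegral_congr_fun measurableSet_Ioc fun y hy => ?_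
      have hyR : y ≤ R := hy.2.trans (min_le_right _ _)
      simp only [hmass0, ha]
      rw [max_eq_left hy.1.le, min_eq_left hyR, intervalIntegral.integral_of_le hy.1.le]
    have hD : ∀ y ∈ uIcc 0 z,
        HasDerivAt (fun y => a y ^ (l + 1) / (l + 1)) (‖p y‖ * a y ^ l) y := by
      intro y _
      have := ((hd y).pow (l + 1)).div_const ((l : ℝ) + 1)
      refine this.congr_deriv ?_
      push_cast
      field_simp
    have hca : Continuous a := continuous_iff_continuousAt.2 fun y => (hd y).continuousAt
    rw [hae, ← intervalIntegral.integral_of_le h.le,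
      intervalIntegral.integral_eq_sub_of_hasDerivAt hD
        ((hp.norm.mul (hca.pow l)).intervalIntegrable _ _)]
    simp only [ha, intervalIntegral.integral_same, intervalIntegral.integral_of_le h.le]
    simp

lemma head_admissible {q : ℝ → ℂ} (hq : Continuous q) (R : ℝ) (n : ℕ) :
    (head R).Admissible n q :=
  ⟨hq.aestronglyMeasurable, fun j _ =>
    (((head R).continuous_weight.pow j).mul hq.norm).integrableOn_Ioc⟩

end VolterraGeometry

/-! ### Weighted potentials -/

/-- `q` is continuous on the line and `(1 + y)^n q(y)` is integrable over `(0, ∞)`. -/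
structure IsPotential (n : ℕ) (q : ℝ → ℂ) : Prop where
  continuous : Continuous q
  integrableOn : IntegrableOn (fun y => (1 + y) ^ n * ‖q y‖) (Ioi 0)

/-- The weighted `L¹` norm `∫_0^∞ (1 + y)^n |q(y)| dy`. -/
def moment (n : ℕ) (q : ℝ → ℂ) : ℝ := ∫ y in Ioi (0 : ℝ), (1 + y) ^ n * ‖q y‖

section Moment

variable {n l i : ℕ} {q : ℝ → ℂ} {x₀ : ℝ}

lemma moment_nonneg (n : ℕ) (q : ℝ → ℂ) : 0 ≤ moment n q :=
  setIntegral_nonneg measurableSet_Ioi fun y hy => by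
    have : (0 : ℝ) < y := hy
    positivity

lemma IsPotential.neg (hq : IsPotential n q) : IsPotential n (-q) :=
  ⟨hq.1.neg, by simpa using hq.2⟩

lemma integrableOn_norm_of_weighted (hq : AEStronglyMeasurable q (volume.restrict (Ioi 0)))
    (hi : IntegrableOn (fun y => (1 + y) ^ n * ‖q y‖) (Ioi 0)) :
    IntegrableOn (fun y => ‖q y‖) (Ioi 0) := by
  refine hi.mono' hq.norm ?_
  filter_upwards [ae_restrict_mem measurableSet_Ioi] with y hy
  have hy : (0 : ℝ) < y := hy
  rw [norm_norm]
  exact le_mul_of_one_le_left (norm_nonneg _) (one_le_pow₀ (by linarith))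

lemma IsPotential.integrableOn_norm (hq : IsPotential n q) :
    IntegrableOn (fun y => ‖q y‖) (Ioi 0) :=
  integrableOn_norm_of_weighted hq.1.aestronglyMeasurable hq.2

lemma tail_weight_pow_le (hx₀ : 0 ≤ x₀) (hil : i ≤ l) (hl : l ≤ n) {y : ℝ} (hy : x₀ < y) :
    (VolterraGeometry.tail x₀).weight y ^ i ≤ 2 ^ n / (1 + x₀) ^ (n - l) * (1 + y) ^ n := by
  have e : (VolterraGeometry.tail x₀).weight y = 2 * (y - x₀) := by
    change 2 * max (y - x₀) 0 = _
    rw [max_eq_left (by linarith)]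
  have h1 : (0 : ℝ) < 1 + x₀ := by linarith
  have h2 : (1 + x₀) ^ (n - l) ≤ (1 + y) ^ (n - l) := by gcongr
  calc _ = 2 ^ i * (y - x₀) ^ i := by rw [e, mul_pow]
    _ ≤ 2 ^ n * (1 + y) ^ i := by
        gcongr
        · linarith
        · exact hil.trans hl
        · linarith
    _ ≤ 2 ^ n * (1 + y) ^ l := by
        gcongr
        linarith
    _ = 2 ^ n / (1 + x₀) ^ (n - l) * ((1 + x₀) ^ (n - l) * (1 + y) ^ l) := by field_simp
    _ ≤ 2 ^ n / (1 + x₀) ^ (n - l) * ((1 + y) ^ (n - l) * (1 + y) ^ l) := by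
        have : (0 : ℝ) < 1 + y := by linarith
        gcongr
    _ = _ := by rw [← pow_add, Nat.sub_add_cancel hl]

lemma tail_admissible (hx₀ : 0 ≤ x₀) (hq : AEStronglyMeasurable q (volume.restrict (Ioi 0)))
    (hi : IntegrableOn (fun y => (1 + y) ^ n * ‖q y‖) (Ioi 0)) :
    (VolterraGeometry.tail x₀).Admissible n q := by
  have hq' : AEStronglyMeasurable q (volume.restrict (Ioi x₀)) :=
    hq.mono_measure (Measure.restrict_mono (Ioi_subset_Ioi hx₀) le_rfl)
  refine ⟨hq', fun j hj => ?_⟩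
  have hi' := (hi.mono_set (Ioi_subset_Ioi hx₀)).const_mul (2 ^ n / (1 + x₀) ^ (n - n))
  refine hi'.mono' (((VolterraGeometry.tail x₀).continuous_weight.pow j).aestronglyMeasurable.mul
    hq'.norm) ?_
  filter_upwards [ae_restrict_mem measurableSet_Ioi] with y hy
  have := (VolterraGeometry.tail x₀).weight_nonneg y
  rw [Real.norm_of_nonneg (by positivity), ← mul_assoc]
  gcongr
  exact tail_weight_pow_le hx₀ hj le_rfl hy

/-- The moments of `q` on `(x₀, ∞)` decay like `(1 + x₀)^{-(n - l)}`. -/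
lemma tail_moment_le (hx₀ : 0 ≤ x₀) (hi : IntegrableOn (fun y => (1 + y) ^ n * ‖q y‖) (Ioi 0))
    (hil : i ≤ l) (hl : l ≤ n) :
    ∫ y in (VolterraGeometry.tail x₀).base, (VolterraGeometry.tail x₀).weight y ^ i * ‖q y‖ ≤
      2 ^ n * moment n q / (1 + x₀) ^ (n - l) := by
  have h1 : (0 : ℝ) < 1 + x₀ := by linarith
  have hi' := (hi.mono_set (Ioi_subset_Ioi hx₀)).const_mul (2 ^ n / (1 + x₀) ^ (n - l))
  calc _ ≤ ∫ y in Ioi x₀, 2 ^ n / (1 + x₀) ^ (n - l) * ((1 + y) ^ n * ‖q y‖) := by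
        refine integral_mono_of_nonneg (.of_forall fun y => ?_) hi' ?_
        · have := (VolterraGeometry.tail x₀).weight_nonneg y
          simp only [Pi.zero_apply]
          positivity
        · filter_upwards [ae_restrict_mem measurableSet_Ioi] with y hy
          rw [← mul_assoc]
          gcongr
          exact tail_weight_pow_le hx₀ hil hl hy
    _ = 2 ^ n / (1 + x₀) ^ (n - l) * ∫ y in Ioi x₀, (1 + y) ^ n * ‖q y‖ := integral_const_mul _ _
    _ ≤ 2 ^ n / (1 + x₀) ^ (n - l) * moment n q := by
        gcongr
        refine setIntegral_mono_set hi ?_ (Ioi_subset_Ioi hx₀).eventuallyLE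
        filter_upwards [ae_restrict_mem measurableSet_Ioi] with y hy
        have : (0 : ℝ) < y := hy
        simp only [Pi.zero_apply]
        positivity
    _ = _ := by ring

lemma IsPotential.tail_admissible (hq : IsPotential n q) (hx₀ : 0 ≤ x₀) :
    (VolterraGeometry.tail x₀).Admissible n q :=
  MKdV.tail_admissible hx₀ hq.1.aestronglyMeasurable hq.2

lemma IsPotential.tail_volterraDensity (hq : IsPotential n q) (hx₀ : 0 ≤ x₀) :
    (VolterraGeometry.tail x₀).VolterraDensity q :=
  VolterraGeometry.tail_volterraDensity hq.1
    (hq.integrableOn_norm.mono_set (Ioi_subset_Ioi hx₀))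

end Moment

lemma convex_closedUpper : Convex ℝ closedUpper := convex_halfSpace_im_ge 0

lemma uniqueDiffOn_closedUpper : UniqueDiffOn ℂ closedUpper := by
  have hi : (interior closedUpper).Nonempty := by
    refine ⟨I, mem_interior.2 ⟨{k | 0 < k.im}, fun k hk => show 0 ≤ k.im from le_of_lt hk,
      isOpen_lt continuous_const continuous_im, by simp⟩⟩
  exact uniqueDiffOn_convex_of_isRCLikeNormedField convex_closedUpper hi

/-! ### Columns normalized at infinity -/

/-- The column equations `f = 1 - ∫_x^∞ p g`, `g = -∫_x^∞ e^{2iκ(y-x)} q f` on `[0, ∞)`, with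
absolutely convergent integrals. -/
structure SolvesTail (p q : ℝ → ℂ) (κ : ℂ) (f g : ℝ → ℂ) : Prop where
  integrable_fst : ∀ x, 0 ≤ x → IntegrableOn (fun y => p y * g y) (Ioi x)
  fst_eq : ∀ x, 0 ≤ x → f x = 1 - ∫ y in Ioi x, p y * g y
  integrable_snd : ∀ x : ℝ, 0 ≤ x →
    IntegrableOn (fun y : ℝ => exp (2 * (I * κ * (y - x))) * (q y * f y)) (Ioi x)
  snd_eq : ∀ x : ℝ, 0 ≤ x → g x = -∫ y : ℝ in Ioi x, exp (2 * (I * κ * (y - x))) * (q y * f y)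

lemma norm_exp_le_one {κ : ℂ} (hκ : κ ∈ closedUpper) {t : ℝ} (ht : 0 ≤ t) :
    ‖exp (2 * (I * κ * t))‖ ≤ 1 := by
  have h : 0 ≤ κ.im := hκ
  rw [norm_exp]
  refine Real.exp_le_one_iff.2 ?_
  have : (2 * (I * κ * t)).re = -(2 * (κ.im * t)) := by simp
  rw [this]
  have := mul_nonneg h ht
  linarith

lemma exists_boundedContinuous_tail {f : ℝ → ℂ} {x₀ C : ℝ} (hf : ContinuousOn f (Ici x₀))
    (hC : ∀ x, x₀ ≤ x → ‖f x‖ ≤ C) : ∃ F : ℝ →ᵇ ℂ, ∀ x, F x = f (max x x₀) := by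
  refine ⟨BoundedContinuousFunction.ofNormedAddCommGroup (fun x => f (max x x₀)) ?_ C
    fun x => hC _ (le_max_right _ _), fun x => rfl⟩
  exact hf.comp_continuous (by fun_prop) fun x => mem_Ici.2 (le_max_right _ _)

lemma exists_norm_le_of_tendsto {f : ℝ → ℂ} {x₀ : ℝ} {L : ℂ} (hf : ContinuousOn f (Ici x₀))
    (hL : Tendsto f atTop (𝓝 L)) : ∃ C, ∀ x, x₀ ≤ x → ‖f x‖ ≤ C := by
  obtain ⟨R, hR⟩ := eventually_atTop.1 (hL.norm.eventually (gt_mem_nhds (lt_add_one ‖L‖)))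
  obtain ⟨C, hC⟩ := isCompact_Icc.exists_bound_of_continuousOn
    (hf.mono (Icc_subset_Ici_self : Icc x₀ R ⊆ _))
  refine ⟨max C (‖L‖ + 1), fun x hx => ?_⟩
  rcases le_total x R with h | h
  · exact le_max_of_le_left (hC x ⟨hx, h⟩)
  · exact le_max_of_le_right (hR x h).le

lemma continuousOn_integral_Ioi {h : ℝ → ℂ} (hi : IntegrableOn h (Ioi 0)) :
    ContinuousOn (fun x => ∫ y in Ioi x, h y) (Ici 0) := by
  have hg : Integrable ((Ioi 0).indicator h) := (integrable_indicator_iff measurableSet_Ioi).2 hi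
  have hc : Continuous fun x => (∫ y in Ioi (0 : ℝ), h y) -
      ∫ y in (0 : ℝ)..x, (Ioi 0).indicator h y :=
    continuous_const.sub
      (intervalIntegral.continuous_primitive (fun a b => hg.intervalIntegrable) 0)
  refine hc.continuousOn.congr fun x hx => ?_
  have hx : (0 : ℝ) ≤ x := hx
  have e : ∫ y in (0 : ℝ)..x, (Ioi 0).indicator h y = ∫ y in (0 : ℝ)..x, h y := by
    rw [intervalIntegral.integral_of_le hx, intervalIntegral.integral_of_le hx]
    exact setIntegral_congr_fun measurableSet_Ioc fun y hy => indicator_of_mem (mem_Ioi.2 hy.1) _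
  simp only [e]
  rw [← intervalIntegral.integral_Ioi_sub_Ioi hi hx]
  abel

section Tail

open VolterraGeometry

variable {n : ℕ} {p q : ℝ → ℂ} {x₀ : ℝ} {κ : ℂ} {f g : ℝ → ℂ}

lemma tail_op_apply (hq : (tail x₀).Admissible n q) (hκ : κ ∈ closedUpper) (F : ℝ →ᵇ ℂ) (x : ℝ) :
    (tail x₀).op q 0 κ F x =
      ∫ y : ℝ in Ioi (max x x₀), exp (2 * (I * κ * (y - (max x x₀ : ℝ)))) * (q y * F y) := by
  rw [op_apply hq (Nat.zero_le _) (tail_expBound x₀) hκ]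
  refine setIntegral_congr_fun measurableSet_Ioi fun y hy => ?_
  have hy : max x x₀ < y := hy
  have e : (tail x₀).phase x y = 2 * (y - max x x₀) := by
    change 2 * max (y - max x x₀) 0 = _
    rw [max_eq_left (by linarith)]
  simp only [e, pow_zero, one_mul]
  rw [mul_assoc]
  congr 2
  push_cast
  ring

lemma tail_op_zero_apply (hp : (tail x₀).Admissible n p) (F : ℝ →ᵇ ℂ) (x : ℝ) :
    (tail x₀).op p 0 0 F x = ∫ y in Ioi (max x x₀), p y * F y :=
  op_zero_apply hp F x

/-- A pair of bounded continuous functions that solves the inhomogeneous column equations on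
`[x₀, ∞)` solves the corresponding operator equations. -/
lemma tail_eq_prodOp_add (hp : IsPotential n p) (hq : IsPotential n q) (hx₀ : 0 ≤ x₀)
    (hκ : κ ∈ closedUpper) {F H a b : ℝ →ᵇ ℂ} (hFc : ∀ x, F x = F (max x x₀))
    (hHc : ∀ x, H x = H (max x x₀)) (hac : ∀ x, a x = a (max x x₀))
    (hbc : ∀ x, b x = b (max x x₀))
    (hF : ∀ x, x₀ ≤ x → F x = a x - ∫ y in Ioi x, p y * H y)
    (hH : ∀ x : ℝ, x₀ ≤ x →
      H x = b x - ∫ y : ℝ in Ioi x, exp (2 * (I * κ * (y - x))) * (q y * F y)) :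
    F = (tail x₀).prodOp (-p) (-q) κ F + (a + (tail x₀).op (-p) 0 0 b) ∧
      H = (tail x₀).op (-q) 0 κ F + b := by
  have h2 : H = (tail x₀).op (-q) 0 κ F + b := by
    ext x
    rw [BoundedContinuousFunction.add_apply, tail_op_apply (hq.neg.tail_admissible hx₀) hκ, hHc,
      hH _ (le_max_right _ _), hbc x, sub_eq_neg_add, ← integral_neg]
    simp
  refine ⟨?_, h2⟩
  have h1 : F = (tail x₀).op (-p) 0 0 H + a := by
    ext x
    rw [BoundedContinuousFunction.add_apply, tail_op_zero_apply (hp.neg.tail_admissible hx₀), hFc,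
      hF _ (le_max_right _ _), hac x, sub_eq_neg_add, ← integral_neg]
    simp
  have h3 : (tail x₀).op (-p) 0 0 H = (tail x₀).prodOp (-p) (-q) κ F + (tail x₀).op (-p) 0 0 b := by
    conv_lhs => rw [h2, map_add]
    rfl
  conv_lhs => rw [h1, h3]
  abel

/-- The first component of the column normalized at infinity. -/
def tailFst (p q : ℝ → ℂ) (κ : ℂ) : ℝ →ᵇ ℂ := (tail 0).resolvent (-p) (-q) κ 1

/-- The second component of the column normalized at infinity. -/
def tailSnd (p q : ℝ → ℂ) (κ : ℂ) : ℝ →ᵇ ℂ := (tail 0).op (-q) 0 κ (tailFst p q κ)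

lemma IsPotential.integrableOn_mul (hp : IsPotential n p) (hf : ContinuousOn f (Ici 0)) {C : ℝ}
    (hC : ∀ x, 0 ≤ x → ‖f x‖ ≤ C) : IntegrableOn (fun y => p y * f y) (Ioi 0) := by
  refine (hp.integrableOn_norm.mul_const C).mono' (hp.1.aestronglyMeasurable.mul
    ((hf.mono Ioi_subset_Ici_self).aestronglyMeasurable measurableSet_Ioi)) ?_
  filter_upwards [ae_restrict_mem measurableSet_Ioi] with y hy
  rw [norm_mul]
  exact mul_le_mul_of_nonneg_left (hC y (le_of_lt hy)) (norm_nonneg _)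

lemma integrableOn_exp_mul {h : ℝ → ℂ} (hκ : κ ∈ closedUpper) {x : ℝ}
    (hi : IntegrableOn h (Ioi x)) :
    IntegrableOn (fun y : ℝ => exp (2 * (I * κ * (y - x))) * h y) (Ioi x) := by
  refine hi.norm.mono' ?_ ?_
  · have : Continuous fun y : ℝ => exp (2 * (I * κ * (y - x))) := by fun_prop
    exact this.aestronglyMeasurable.mul hi.aestronglyMeasurable
  · filter_upwards [ae_restrict_mem measurableSet_Ioi] with y hy
    have hy : x < y := hy
    rw [norm_mul]
    refine mul_le_of_le_one_left (norm_nonneg _) ?_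
    exact_mod_cast norm_exp_le_one hκ (t := y - x) (by linarith)

lemma norm_integral_exp_mul_le {h : ℝ → ℂ} (hκ : κ ∈ closedUpper) {x : ℝ}
    (hi : IntegrableOn h (Ioi x)) :
    ‖∫ y : ℝ in Ioi x, exp (2 * (I * κ * (y - x))) * h y‖ ≤ ∫ y in Ioi x, ‖h y‖ := by
  refine norm_integral_le_of_norm_le hi.norm ?_
  filter_upwards [ae_restrict_mem measurableSet_Ioi] with y hy
  have hy : x < y := hy
  rw [norm_mul]
  refine mul_le_of_le_one_left (norm_nonneg _) ?_
  exact_mod_cast norm_exp_le_one hκ (t := y - x) (by linarith)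

lemma exp_two_mul_sub (κ : ℂ) (x y : ℝ) :
    exp (2 * (I * κ * (y - x))) = exp (-(2 * (I * κ * x))) * exp (2 * (I * κ * y)) := by
  rw [← Complex.exp_add]
  congr 1
  ring

lemma solvesTail_tailFst (hp : IsPotential n p) (hq : IsPotential n q) (hκ : κ ∈ closedUpper) :
    SolvesTail p q κ (tailFst p q κ) (tailSnd p q κ) := by
  have hp' := hp.neg.tail_admissible le_rfl
  have hq' := hq.neg.tail_admissible le_rfl
  have ip := hp.integrableOn_mul (tailSnd p q κ).continuous.continuousOn
    fun x _ => (tailSnd p q κ).norm_coe_le_norm x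
  have iq := hq.integrableOn_mul (tailFst p q κ).continuous.continuousOn
    fun x _ => (tailFst p q κ).norm_coe_le_norm x
  refine ⟨fun x hx => ip.mono_set (Ioi_subset_Ioi hx), fun x hx => ?_,
    fun x hx => integrableOn_exp_mul hκ (iq.mono_set (Ioi_subset_Ioi hx)), fun x hx => ?_⟩
  · have e := resolvent_apply_eq (hp.neg.tail_volterraDensity le_rfl) hq' (tail_expBound 0) hκ 1
    have e' : tailFst p q κ = (tail 0).op (-p) 0 0 (tailSnd p q κ) + 1 := e
    rw [e', BoundedContinuousFunction.add_apply, tail_op_zero_apply hp', max_eq_left hx,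
      sub_eq_neg_add, ← integral_neg]
    simp
  · rw [← integral_neg]
    conv_lhs => rw [tailSnd, tail_op_apply hq' hκ, max_eq_left hx]
    simp

namespace SolvesTail

lemma continuousOn_fst (h : SolvesTail p q κ f g) : ContinuousOn f (Ici 0) :=
  (continuousOn_const.sub (continuousOn_integral_Ioi (h.1 0 le_rfl))).congr fun x hx => h.2 x hx

lemma continuousOn_snd (h : SolvesTail p q κ f g) : ContinuousOn g (Ici 0) := by
  have hi : IntegrableOn (fun y : ℝ => exp (2 * (I * κ * y)) * (q y * f y)) (Ioi 0) := by
    simpa using h.3 0 le_rfl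
  have hc : Continuous fun x : ℝ => exp (-(2 * (I * κ * x))) := by fun_prop
  refine (hc.continuousOn.mul (continuousOn_integral_Ioi hi)).neg.congr fun x hx => ?_
  rw [h.4 x hx]
  simp only [← integral_const_mul, Pi.neg_apply, Pi.mul_apply, exp_two_mul_sub κ x,
    mul_assoc (exp (-(2 * (I * κ * x))))]

lemma tendsto_fst (h : SolvesTail p q κ f g) : Tendsto f atTop (𝓝 1) := by
  have := (tendsto_integral_Ioi_zero (h.1 0 le_rfl)).const_sub 1
  rw [sub_zero] at this
  refine this.congr' ?_
  filter_upwards [eventually_ge_atTop 0] with x hx using (h.2 x hx).symm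

lemma integrableOn_mul (hq : IsPotential n q) (h : SolvesTail p q κ f g) :
    IntegrableOn (fun y => q y * f y) (Ioi 0) := by
  obtain ⟨C, hC⟩ := exists_norm_le_of_tendsto h.continuousOn_fst h.tendsto_fst
  exact hq.integrableOn_mul h.continuousOn_fst hC

lemma tendsto_snd (hq : IsPotential n q) (hκ : κ ∈ closedUpper) (h : SolvesTail p q κ f g) :
    Tendsto g atTop (𝓝 0) := by
  have hi := h.integrableOn_mul hq
  refine squeeze_zero_norm' ?_ (tendsto_integral_Ioi_zero hi.norm)
  filter_upwards [eventually_ge_atTop 0] with x hx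
  rw [h.4 x hx, norm_neg]
  exact norm_integral_exp_mul_le hκ (hi.mono_set (Ioi_subset_Ioi hx))

/-- Uniqueness for the column equations: a solution is automatically bounded and continuous, so
that it is the one given by the resolvent. -/
lemma eq_tail (hp : IsPotential n p) (hq : IsPotential n q) (hκ : κ ∈ closedUpper)
    (h : SolvesTail p q κ f g) {x : ℝ} (hx : 0 ≤ x) :
    f x = tailFst p q κ x ∧ g x = tailSnd p q κ x := by
  obtain ⟨C, hC⟩ := exists_norm_le_of_tendsto h.continuousOn_fst h.tendsto_fst
  obtain ⟨C', hC'⟩ := exists_norm_le_of_tendsto h.continuousOn_snd (h.tendsto_snd hq hκ)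
  obtain ⟨F, hF⟩ := exists_boundedContinuous_tail h.continuousOn_fst hC
  obtain ⟨H, hH⟩ := exists_boundedContinuous_tail h.continuousOn_snd hC'
  have hF0 : ∀ x, 0 ≤ x → F x = f x := fun x hx => by rw [hF, max_eq_left hx]
  have hH0 : ∀ x, 0 ≤ x → H x = g x := fun x hx => by rw [hH, max_eq_left hx]
  obtain ⟨h1, h2⟩ := tail_eq_prodOp_add (a := 1) (b := 0) hp hq le_rfl hκ
    (fun x => by rw [hF, hF, max_eq_left (le_max_right x 0)])
    (fun x => by rw [hH, hH, max_eq_left (le_max_right x 0)]) (fun x => rfl) (fun x => rfl)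
    (fun x hx => by
      rw [hF0 x hx, h.2 x hx]
      change _ = (1 : ℂ) - _
      congr 1
      refine setIntegral_congr_fun measurableSet_Ioi fun y hy => ?_
      simp only [hH0 y (hx.trans (le_of_lt hy))])
    (fun x hx => by
      rw [hH0 x hx, h.4 x hx]
      change _ = (0 : ℂ) - _
      rw [zero_sub]
      congr 1
      refine setIntegral_congr_fun measurableSet_Ioi fun y hy => ?_
      simp only [hF0 y (hx.trans (le_of_lt hy))])
  rw [map_zero, add_zero] at h1
  rw [add_zero] at h2
  have h3 : F = tailFst p q κ := eq_resolvent_apply (hp.neg.tail_volterraDensity le_rfl)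
    (hq.neg.tail_admissible le_rfl) (tail_expBound 0) hκ h1
  rw [h3] at h2
  rw [← hF0 x hx, ← hH0 x hx, h2, h3]
  exact ⟨rfl, rfl⟩

lemma hasDerivWithinAt_fst (hp : IsPotential n p) (hq : IsPotential n q) (hκ : κ ∈ closedUpper)
    (h : SolvesTail p q κ f g) {x : ℝ} (hx : 0 ≤ x) :
    HasDerivWithinAt f (p x * g x) (Ici 0) x := by
  set H := tailSnd p q κ
  have e : ∀ x, 0 ≤ x → f x = 1 - ∫ y in Ioi x, p y * H y := fun x hx => by
    rw [h.2 x hx]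
    congr 1
    refine setIntegral_congr_fun measurableSet_Ioi fun y hy => ?_
    simp only [H, (h.eq_tail hp hq hκ (hx.trans (le_of_lt hy))).2]
  have hi := hp.integrableOn_mul H.continuous.continuousOn fun x _ => H.norm_coe_le_norm x
  have hd := (hasDerivAt_integral_Ioi (hp.1.mul H.continuous) hi x).const_sub 1
  rw [neg_neg] at hd
  rw [(h.eq_tail hp hq hκ hx).2]
  exact hd.hasDerivWithinAt.congr e (e x hx)

lemma hasDerivWithinAt_snd (hp : IsPotential n p) (hq : IsPotential n q) (hκ : κ ∈ closedUpper)
    (h : SolvesTail p q κ f g) {x : ℝ} (hx : 0 ≤ x) :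
    HasDerivWithinAt g (q x * f x - 2 * I * κ * g x) (Ici 0) x := by
  set F := tailFst p q κ
  have e : ∀ x : ℝ, 0 ≤ x → g x = -(exp (-(2 * (I * κ * x))) *
      ∫ y : ℝ in Ioi x, exp (2 * (I * κ * y)) * (q y * F y)) := fun x hx => by
    rw [h.4 x hx, ← integral_const_mul]
    congr 1
    refine setIntegral_congr_fun measurableSet_Ioi fun y hy => ?_
    simp only [F, (h.eq_tail hp hq hκ (hx.trans (le_of_lt hy))).1, exp_two_mul_sub κ x,
      mul_assoc (exp (-(2 * (I * κ * x))))]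
  have hi := integrableOn_exp_mul hκ
    (hq.integrableOn_mul F.continuous.continuousOn fun x _ => F.norm_coe_le_norm x)
  simp only [ofReal_zero, sub_zero] at hi
  have hc : Continuous fun y : ℝ => exp (2 * (I * κ * y)) * (q y * F y) := by
    have := hq.1
    fun_prop
  have hd := hasDerivAt_integral_Ioi hc hi x
  have hE : HasDerivAt (fun x : ℝ => exp (-(2 * (I * κ * x))))
      (exp (-(2 * (I * κ * x))) * (-(2 * (I * κ)))) x := by
    have h1 : HasDerivAt (fun x : ℝ => -(2 * (I * κ * (x : ℂ)))) (-(2 * (I * κ))) x := by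
      have := ((hasDerivAt_id x).ofReal_comp.const_mul (I * κ)).const_mul (-2)
      simpa using this
    exact h1.cexp
  have hm := (hE.mul hd).neg
  have hx' := e x hx
  have e3 : exp (-(2 * (I * κ * x))) * exp (2 * (I * κ * x)) = 1 := by
    rw [← Complex.exp_add, neg_add_cancel, Complex.exp_zero]
  refine (hm.hasDerivWithinAt.congr e hx').congr_deriv ?_
  rw [(h.eq_tail hp hq hκ hx).1, hx']
  linear_combination (q x * F x) * e3

end SolvesTail

/-! ### Errors of approximate solutions normalized at infinity -/

/-- The first component, on `[x₀, ∞)`, of the solution of `f' = p g`, `g' = q f - 2iκ g - ρ` that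
vanishes at infinity; it is the error of an approximate solution with residual `ρ`. -/
def tailErrFst (x₀ : ℝ) (p q ρ : ℝ → ℂ) (κ : ℂ) : ℝ →ᵇ ℂ :=
  (tail x₀).resolvent (-p) (-q) κ ((tail x₀).op (-p) 0 0 ((tail x₀).op ρ 0 κ 1))

/-- The second component of the solution described at `tailErrFst`. -/
def tailErrSnd (x₀ : ℝ) (p q ρ : ℝ → ℂ) (κ : ℂ) : ℝ →ᵇ ℂ :=
  (tail x₀).op (-q) 0 κ (tailErrFst x₀ p q ρ κ) + (tail x₀).op ρ 0 κ 1

/-- A decaying solution of the column equations with inhomogeneity `-c ρ` equals `c` times the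
error functions. -/
lemma eq_tailErr (hp : IsPotential n p) (hq : IsPotential n q) (hκ : κ ∈ closedUpper) {ρ : ℝ → ℂ}
    (hρ : ContinuousOn ρ (Ici 0)) (hρi : IntegrableOn (fun y => (1 + y) ^ n * ‖ρ y‖) (Ioi 0))
    (c : ℂ)
    (hf : ∀ x, 0 ≤ x → HasDerivWithinAt f (p x * g x) (Ici 0) x)
    (hg : ∀ x, 0 ≤ x →
      HasDerivWithinAt g (q x * f x - 2 * I * κ * g x - c * ρ x) (Ici 0) x)
    (hf0 : Tendsto f atTop (𝓝 0)) (hg0 : Tendsto g atTop (𝓝 0)) (hx₀ : 0 ≤ x₀) :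
    f x₀ = c * tailErrFst x₀ p q ρ κ x₀ ∧ g x₀ = c * tailErrSnd x₀ p q ρ κ x₀ := by
  have hfc : ContinuousOn f (Ici 0) := fun x hx => (hf x hx).continuousWithinAt
  have hgc : ContinuousOn g (Ici 0) := fun x hx => (hg x hx).continuousWithinAt
  obtain ⟨C, hC⟩ := exists_norm_le_of_tendsto hfc hf0
  obtain ⟨C', hC'⟩ := exists_norm_le_of_tendsto hgc hg0
  have ip := hp.integrableOn_mul hgc hC'
  have iq := hq.integrableOn_mul hfc hC
  have hρm : AEStronglyMeasurable ρ (volume.restrict (Ioi 0)) :=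
    (hρ.mono Ioi_subset_Ici_self).aestronglyMeasurable measurableSet_Ioi
  have iρ : IntegrableOn ρ (Ioi 0) :=
    (integrable_norm_iff hρm).1 (integrableOn_norm_of_weighted hρm hρi)
  have eqf : ∀ x, 0 ≤ x → f x = -∫ y in Ioi x, p y * g y := fun x hx => by
    rw [integral_Ioi_of_hasDerivAt_of_tendsto
      ((hf x hx).continuousWithinAt.mono (Ici_subset_Ici.2 hx))
      (fun y hy => (hf y (hx.trans (le_of_lt hy))).hasDerivAt (Ici_mem_nhds (hx.trans_lt hy)))
      (ip.mono_set (Ioi_subset_Ioi hx)) hf0]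
    ring
  have eqg : ∀ x : ℝ, 0 ≤ x → g x = -∫ y : ℝ in Ioi x, exp (2 * (I * κ * (y - x))) *
      (q y * f y - c * ρ y) := fun x hx => by
    have hE : ∀ y : ℝ, HasDerivAt (fun y : ℝ => exp (2 * (I * κ * (y - x))))
        (exp (2 * (I * κ * (y - x))) * (2 * (I * κ))) y := fun y => by
      have h1 : HasDerivAt (fun y : ℝ => 2 * (I * κ * ((y : ℂ) - x))) (2 * (I * κ)) y := by
        have := ((((hasDerivAt_id y).ofReal_comp.sub_const (x : ℂ)).const_mul (I * κ)).const_mul 2)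
        simpa using this
      exact h1.cexp
    have hlim : Tendsto (fun y : ℝ => exp (2 * (I * κ * (y - x))) * g y) atTop (𝓝 0) := by
      refine squeeze_zero_norm' ?_ (tendsto_zero_iff_norm_tendsto_zero.1 hg0)
      filter_upwards [eventually_ge_atTop x] with y hy
      rw [norm_mul]
      refine mul_le_of_le_one_left (norm_nonneg _) ?_
      exact_mod_cast norm_exp_le_one hκ (t := y - x) (by linarith)
    have hi : IntegrableOn (fun y : ℝ => exp (2 * (I * κ * (y - x))) * (q y * f y - c * ρ y))
        (Ioi x) := integrableOn_exp_mul hκ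
      ((iq.sub (iρ.const_mul c)).mono_set (Ioi_subset_Ioi hx))
    rw [integral_Ioi_of_hasDerivAt_of_tendsto (f := fun y : ℝ => exp (2 * (I * κ * (y - x))) * g y)
      ?_ (fun y hy => ?_) hi hlim]
    · simp
    · exact ((hE x).continuousAt.continuousWithinAt).mul
        ((hg x hx).continuousWithinAt.mono (Ici_subset_Ici.2 hx))
    · have hy0 : 0 < y := hx.trans_lt hy
      refine ((hE y).mul ((hg y hy0.le).hasDerivAt (Ici_mem_nhds hy0))).congr_deriv ?_
      ring
  have hmono : Ici x₀ ⊆ Ici 0 := Ici_subset_Ici.2 hx₀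
  obtain ⟨F, hF⟩ := exists_boundedContinuous_tail (hfc.mono hmono) fun x hx => hC x (hx₀.trans hx)
  obtain ⟨H, hH⟩ := exists_boundedContinuous_tail (hgc.mono hmono) fun x hx => hC' x (hx₀.trans hx)
  have hF0 : ∀ x, x₀ ≤ x → F x = f x := fun x hx => by rw [hF, max_eq_left hx]
  have hH0 : ∀ x, x₀ ≤ x → H x = g x := fun x hx => by rw [hH, max_eq_left hx]
  have hρa := tail_admissible (n := n) hx₀ hρm hρi
  obtain ⟨h1, h2⟩ := tail_eq_prodOp_add (F := F) (H := H) (a := 0)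
    (b := c • (tail x₀).op ρ 0 κ 1) hp hq hx₀ hκ
    (fun x => by rw [hF, hF, max_eq_left (le_max_right x x₀)])
    (fun x => by rw [hH, hH, max_eq_left (le_max_right x x₀)]) (fun x => rfl)
    (fun x => by
      simp only [BoundedContinuousFunction.coe_smul, tail_op_apply hρa hκ,
        max_eq_left (le_max_right x x₀)])
    (fun x hx => by
      rw [hF0 x hx, eqf x (hx₀.trans hx)]
      change _ = (0 : ℂ) - _
      rw [zero_sub]
      congr 1
      refine setIntegral_congr_fun measurableSet_Ioi fun y hy => ?_
      simp only [hH0 y (hx.trans (le_of_lt hy))])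
    (fun x hx => by
      have hx' := hx₀.trans hx
      have iq' := integrableOn_exp_mul hκ (iq.mono_set (Ioi_subset_Ioi hx'))
      have iρ' := (integrableOn_exp_mul hκ (iρ.mono_set (Ioi_subset_Ioi hx'))).const_mul c
      have e : ∫ y : ℝ in Ioi x, exp (2 * (I * κ * (y - x))) * (q y * f y - c * ρ y) =
          (∫ y : ℝ in Ioi x, exp (2 * (I * κ * (y - x))) * (q y * f y)) -
            c * ∫ y : ℝ in Ioi x, exp (2 * (I * κ * (y - x))) * ρ y := by
        rw [← integral_const_mul, ← integral_sub iq' iρ']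
        congr 1; ext y; ring
      have e' : ∫ y : ℝ in Ioi x, exp (2 * (I * κ * (y - x))) * (q y * F y) =
          ∫ y : ℝ in Ioi x, exp (2 * (I * κ * (y - x))) * (q y * f y) := by
        refine setIntegral_congr_fun measurableSet_Ioi fun y hy => ?_
        simp only [hF0 y (hx.trans (le_of_lt hy))]
      have e'' : (c • (tail x₀).op ρ 0 κ 1) x =
          c * ∫ y : ℝ in Ioi x, exp (2 * (I * κ * (y - x))) * ρ y := by
        simp [tail_op_apply hρa hκ, max_eq_left hx]
      rw [hH0 x hx, eqg x hx', e, e', e'']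
      ring)
  rw [zero_add, map_smul] at h1
  have h3 : F = c • tailErrFst x₀ p q ρ κ := by
    rw [tailErrFst, ← map_smul]
    exact eq_resolvent_apply (hp.neg.tail_volterraDensity hx₀)
      (hq.neg.tail_admissible hx₀) (tail_expBound x₀) hκ h1
  have h4 : H = c • tailErrSnd x₀ p q ρ κ := by
    rw [h2, h3, tailErrSnd, smul_add, map_smul]
  rw [← hF0 x₀ le_rfl, ← hH0 x₀ le_rfl, h3, h4]
  exact ⟨rfl, rfl⟩

end Tail

/-! ### Dependence on the spectral parameter at infinity -/

section TailBounds

open VolterraGeometry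

variable {n : ℕ} {p q ρ : ℝ → ℂ}

lemma contDiffOn_tailFst (hp : IsPotential n p) (hq : IsPotential n q) :
    ContDiffOn ℂ n (tailFst p q) closedUpper :=
  (contDiffOn_resolvent (hp.neg.tail_volterraDensity le_rfl) (hq.neg.tail_admissible le_rfl)
    convex_closedUpper uniqueDiffOn_closedUpper (tail_expBound 0)).clm_apply contDiffOn_const

lemma contDiffOn_tailSnd (hp : IsPotential n p) (hq : IsPotential n q) :
    ContDiffOn ℂ n (tailSnd p q) closedUpper :=
  (contDiffOn_op (hq.neg.tail_admissible le_rfl) convex_closedUpper uniqueDiffOn_closedUpper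
    (tail_expBound 0) n 0 (by omega)).clm_apply (contDiffOn_tailFst hp hq)

lemma moment_neg (n : ℕ) (q : ℝ → ℂ) : moment n (-q) = moment n q := by simp [moment]

lemma tail_integral_norm_le {x₀ : ℝ} (hx₀ : 0 ≤ x₀)
    (hi : IntegrableOn (fun y => (1 + y) ^ n * ‖q y‖) (Ioi 0)) :
    ∫ y in (tail x₀).base, ‖q y‖ ≤ 2 ^ n * moment n q := by
  have := tail_moment_le hx₀ hi (le_refl 0) (Nat.zero_le n)
  simp only [pow_zero, one_mul] at this
  refine this.trans (div_le_self (mul_nonneg (by positivity) (moment_nonneg n q)) ?_)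
  exact one_le_pow₀ (by linarith)

lemma tail_bddDeriv_op {x₀ : ℝ} (hx₀ : 0 ≤ x₀)
    (hq : AEStronglyMeasurable q (volume.restrict (Ioi 0)))
    (hi : IntegrableOn (fun y => (1 + y) ^ n * ‖q y‖) (Ioi 0)) {l : ℕ} (hl : l ≤ n) :
    BddDeriv l closedUpper (2 ^ n * moment n q / (1 + x₀) ^ (n - l)) ((tail x₀).op q 0) := by
  have := bddDeriv_op (tail_admissible hx₀ hq hi) convex_closedUpper uniqueDiffOn_closedUpper
    (tail_expBound x₀) zero_le_one hl (fun i hil => tail_moment_le hx₀ hi hil hl)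
  rwa [one_mul] at this

/-- The error functions are `C^j` in `κ` with derivatives `O((1 + x₀)^{-(n-j)})`, uniformly in
`κ` in the closed upper half-plane. -/
lemma exists_bddDeriv_tailErr (hp : IsPotential n p) (hq : IsPotential n q)
    (hρ : ContinuousOn ρ (Ici 0)) (hρi : IntegrableOn (fun y => (1 + y) ^ n * ‖ρ y‖) (Ioi 0)) :
    ∃ C, 0 ≤ C ∧ ∀ l ≤ n, ∀ x₀ : ℝ, 0 ≤ x₀ →
      BddDeriv l closedUpper (C / (1 + x₀) ^ (n - l)) (tailErrFst x₀ p q ρ) ∧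
      BddDeriv l closedUpper (C / (1 + x₀) ^ (n - l)) (tailErrSnd x₀ p q ρ) := by
  have hρm : AEStronglyMeasurable ρ (volume.restrict (Ioi 0)) :=
    (hρ.mono Ioi_subset_Ici_self).aestronglyMeasurable measurableSet_Ioi
  set P := 2 ^ n * moment n p with hP
  set Q := 2 ^ n * moment n q with hQ
  set W := 2 ^ n * moment n ρ with hW
  have hP0 : 0 ≤ P := mul_nonneg (by positivity) (moment_nonneg n p)
  have hQ0 : 0 ≤ Q := mul_nonneg (by positivity) (moment_nonneg n q)
  have hW0 : 0 ≤ W := mul_nonneg (by positivity) (moment_nonneg n ρ)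
  have key : ∀ l, ∃ C, 0 ≤ C ∧ (l ≤ n → ∀ x₀ : ℝ, 0 ≤ x₀ →
      BddDeriv l closedUpper (C / (1 + x₀) ^ (n - l)) (tailErrFst x₀ p q ρ) ∧
      BddDeriv l closedUpper (C / (1 + x₀) ^ (n - l)) (tailErrSnd x₀ p q ρ)) := by
    intro l
    obtain ⟨C, hC, hB⟩ := exists_bddDeriv_of_eq_add (E := ℝ →ᵇ ℂ) l (a := P * Q)
      (ρ := Real.exp (Q * P)) (by positivity) (by positivity)
    refine ⟨C * (P * W) + 2 ^ l * (Q * (C * (P * W))) + W, by positivity, fun hl x₀ hx₀ => ?_⟩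
    have hpa := hp.neg.tail_admissible hx₀
    have hqa := hq.neg.tail_admissible hx₀
    have hpd := hp.neg.tail_volterraDensity hx₀
    have hx1 : 1 ≤ (1 + x₀) ^ (n - l) := one_le_pow₀ (by linarith)
    have hx1' : 0 < (1 + x₀) ^ (n - l) := by linarith
    have hPn : ‖(tail x₀).op (-p) 0 0‖ ≤ P := by
      refine (norm_op_zero_le hpa).trans ?_
      rw [hP, ← moment_neg]
      exact tail_integral_norm_le hx₀ hp.neg.2
    have hQb : BddDeriv l closedUpper Q ((tail x₀).op (-q) 0) := by
      refine (tail_bddDeriv_op hx₀ hq.neg.1.aestronglyMeasurable hq.neg.2 hl).mono le_rfl ?_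
      rw [moment_neg, ← hQ]
      exact div_le_self hQ0 hx1
    have hT : BddDeriv l closedUpper (P * Q) ((tail x₀).prodOp (-p) (-q)) := by
      refine (hQb.clm_comp uniqueDiffOn_closedUpper
        (ContinuousLinearMap.compL ℂ _ _ _ ((tail x₀).op (-p) 0 0))).mono le_rfl ?_
      gcongr
      refine (ContinuousLinearMap.le_opNorm _ _).trans ?_
      exact (mul_le_of_le_one_left (norm_nonneg _)
        (ContinuousLinearMap.norm_compL_le ℂ (ℝ →ᵇ ℂ) (ℝ →ᵇ ℂ) (ℝ →ᵇ ℂ))).trans hPn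
    have h1 : ‖(1 : ℝ →ᵇ ℂ)‖ ≤ 1 := by simp
    have hR : BddDeriv l closedUpper (W / (1 + x₀) ^ (n - l))
        (fun κ => (tail x₀).op ρ 0 κ 1) := by
      refine ((tail_bddDeriv_op hx₀ hρm hρi hl).clm_comp uniqueDiffOn_closedUpper
        (ContinuousLinearMap.apply ℂ (ℝ →ᵇ ℂ) (1 : ℝ →ᵇ ℂ))).mono le_rfl ?_
      refine mul_le_of_le_one_left (by positivity) ?_
      refine ContinuousLinearMap.opNorm_le_bound _ zero_le_one fun L => ?_
      rw [one_mul]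
      exact (L.le_opNorm _).trans (mul_le_of_le_one_right (norm_nonneg _) h1)
    have hPR : BddDeriv l closedUpper (P * (W / (1 + x₀) ^ (n - l)))
        (fun κ => (tail x₀).op (-p) 0 0 ((tail x₀).op ρ 0 κ 1)) :=
      (hR.clm_comp uniqueDiffOn_closedUpper ((tail x₀).op (-p) 0 0)).mono le_rfl (by gcongr)
    have hstab : (tail x₀).stab (-p) (-q) 1 ≤ Real.exp (Q * P) := by
      refine Real.exp_le_exp.2 ?_
      rw [one_mul, hP, hQ, ← moment_neg n p, ← moment_neg n q]
      refine mul_le_mul (tail_integral_norm_le hx₀ hq.neg.2) (tail_integral_norm_le hx₀ hp.neg.2)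
        (integral_nonneg fun _ => norm_nonneg _) ?_
      rw [moment_neg]
      exact hQ0
    have hF : BddDeriv l closedUpper (C * (P * (W / (1 + x₀) ^ (n - l))))
        (tailErrFst x₀ p q ρ) := by
      refine hB closedUpper ((tail x₀).prodOp (-p) (-q)) _ _ _ uniqueDiffOn_closedUpper
        (by positivity) hT (fun κ hκ g h hg => ?_) hPR ?_ (fun κ hκ => ?_)
      · refine (norm_le_of_eq_add hpd hqa (tail_expBound x₀) hκ hg).trans ?_
        gcongr
      · exact ((contDiffOn_resolvent hpd hqa convex_closedUpper uniqueDiffOn_closedUpper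
          (tail_expBound x₀)).of_le (by exact_mod_cast hl)).clm_apply hPR.1
      · exact resolvent_apply_eq hpd hqa (tail_expBound x₀) hκ _
    have hH : BddDeriv l closedUpper (2 ^ l * (Q * (C * (P * (W / (1 + x₀) ^ (n - l))))) +
        W / (1 + x₀) ^ (n - l)) (tailErrSnd x₀ p q ρ) := by
      refine ((hQb.bilinear uniqueDiffOn_closedUpper hQ0
        (ContinuousLinearMap.id ℂ ((ℝ →ᵇ ℂ) →L[ℂ] (ℝ →ᵇ ℂ))) hF).add
          uniqueDiffOn_closedUpper hR).mono le_rfl ?_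
      refine add_le_add ?_ le_rfl
      exact mul_le_of_le_one_left (b := 2 ^ l * (Q * (C * (P * (W / (1 + x₀) ^ (n - l))))))
        (by positivity) (ContinuousLinearMap.norm_id_le (𝕜 := ℂ) (E := (ℝ →ᵇ ℂ) →L[ℂ] (ℝ →ᵇ ℂ)))
    refine ⟨hF.mono le_rfl ?_, hH.mono le_rfl ?_⟩
    · rw [le_div_iff₀ hx1']
      calc _ = C * (P * W) := by field_simp
        _ ≤ _ := by
          have : 0 ≤ 2 ^ l * (Q * (C * (P * W))) := by positivity
          linarith
    · rw [le_div_iff₀ hx1']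
      calc _ = 2 ^ l * (Q * (C * (P * W))) + W := by field_simp
        _ ≤ _ := by
          have : 0 ≤ C * (P * W) := by positivity
          linarith
  choose C hC hB using key
  refine ⟨∑ l ∈ Finset.range (n + 1), C l, Finset.sum_nonneg fun l _ => hC l,
    fun l hl x₀ hx₀ => ?_⟩
  have hle : C l ≤ ∑ l ∈ Finset.range (n + 1), C l :=
    Finset.single_le_sum (fun i _ => hC i) (Finset.mem_range.2 (by omega))
  have hx1 : 0 < (1 + x₀) ^ (n - l) := by positivity
  obtain ⟨h1, h2⟩ := hB l hl x₀ hx₀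
  exact ⟨h1.mono le_rfl (by gcongr), h2.mono le_rfl (by gcongr)⟩

end TailBounds

/-! ### Columns normalized at zero -/

/-- The column equations `f = 1 + ∫_0^x p g`, `g = ∫_0^x e^{2iκ(y-x)} q f` at the point `x`, with
integrable integrands. -/
structure SolvesHead (p q : ℝ → ℂ) (κ : ℂ) (f g : ℝ → ℂ) (x : ℝ) : Prop where
  integrable_fst : IntervalIntegrable (fun y => p y * g y) volume 0 x
  fst_eq : f x = 1 + ∫ y in (0 : ℝ)..x, p y * g y
  integrable_snd :
    IntervalIntegrable (fun y : ℝ => exp (2 * (I * κ * (y - x))) * (q y * f y)) volume 0 x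
  snd_eq : g x = ∫ y : ℝ in (0 : ℝ)..x, exp (2 * (I * κ * (y - x))) * (q y * f y)

section Head

open VolterraGeometry

variable {p q : ℝ → ℂ} {R M : ℝ} {κ : ℂ} {D : Set ℂ} {f g : ℝ → ℂ}

lemma exists_boundedContinuous_head (hR : 0 ≤ R) (hf : ContinuousOn f (Icc 0 R)) :
    ∃ F : ℝ →ᵇ ℂ, ∀ x, F x = f (min (max x 0) R) := by
  have hm : ∀ x, min (max x 0) R ∈ Icc 0 R := fun x =>
    ⟨le_min (le_max_right _ _) hR, min_le_right _ _⟩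
  obtain ⟨C, hC⟩ := isCompact_Icc.exists_bound_of_continuousOn hf
  exact ⟨BoundedContinuousFunction.ofNormedAddCommGroup (fun x => f (min (max x 0) R))
    (hf.comp_continuous (by fun_prop) hm) C fun x => hC _ (hm x), fun x => rfl⟩

lemma head_op_apply (hq : Continuous q) (hR : 0 ≤ R) (hM : (head R).ExpBound D M) (hκ : κ ∈ D)
    (F : ℝ →ᵇ ℂ) (x : ℝ) :
    (head R).op q 0 κ F x = ∫ y : ℝ in (0 : ℝ)..(min (max x 0) R),
      exp (2 * (I * (-κ) * (y - (min (max x 0) R : ℝ)))) * (q y * F y) := by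
  have hm : 0 ≤ min (max x 0) R := le_min (le_max_right _ _) hR
  rw [op_apply (head_admissible hq R 0) le_rfl hM hκ, intervalIntegral.integral_of_le hm]
  refine setIntegral_congr_fun measurableSet_Ioc fun y hy => ?_
  have e : (head R).phase x y = 2 * (min (max x 0) R - y) := by
    change 2 * max (min (max x 0) R - max y 0) 0 = _
    rw [max_eq_left hy.1.le, max_eq_left (by linarith [hy.2])]
  simp only [e, pow_zero, one_mul]
  rw [mul_assoc]
  congr 2
  push_cast
  ring

lemma head_op_zero_apply (hp : Continuous p) (hR : 0 ≤ R) (F : ℝ →ᵇ ℂ) (x : ℝ) :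
    (head R).op p 0 0 F x = ∫ y : ℝ in (0 : ℝ)..(min (max x 0) R), p y * F y := by
  have hm : 0 ≤ min (max x 0) R := le_min (le_max_right _ _) hR
  rw [intervalIntegral.integral_of_le hm]
  exact op_zero_apply (head_admissible hp R 0) F x

lemma setIntegral_head_congr {h h' : ℝ → ℂ} {x : ℝ} (hx : 0 ≤ x)
    (he : ∀ y, 0 ≤ y → y ≤ x → h y = h' y) : ∫ y in (0 : ℝ)..x, h y = ∫ y in (0 : ℝ)..x, h' y := by
  refine intervalIntegral.integral_congr fun y hy => ?_
  rw [uIcc_of_le hx] at hy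
  exact he y hy.1 hy.2

/-- A pair of bounded continuous functions that solves the inhomogeneous column equations on
`[0, R]` solves the corresponding operator equations. -/
lemma head_eq_prodOp_add (hp : Continuous p) (hq : Continuous q) (hR : 0 ≤ R)
    (hM : (head R).ExpBound D M) (hκ : -κ ∈ D) {F H a b : ℝ →ᵇ ℂ}
    (hF : ∀ x, F x = a x + ∫ y in (0 : ℝ)..(min (max x 0) R), p y * H y)
    (hH : ∀ x : ℝ, H x = b x + ∫ y : ℝ in (0 : ℝ)..(min (max x 0) R),
      exp (2 * (I * κ * (y - (min (max x 0) R : ℝ)))) * (q y * F y)) :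
    F = (head R).prodOp p q (-κ) F + (a + (head R).op p 0 0 b) ∧
      H = (head R).op q 0 (-κ) F + b := by
  have h2 : H = (head R).op q 0 (-κ) F + b := by
    ext x
    rw [BoundedContinuousFunction.add_apply, head_op_apply hq hR hM hκ, hH x, neg_neg, add_comm]
  refine ⟨?_, h2⟩
  have h1 : F = (head R).op p 0 0 H + a := by
    ext x
    rw [BoundedContinuousFunction.add_apply, head_op_zero_apply hp hR, hF x, add_comm]
  have h3 : (head R).op p 0 0 H = (head R).prodOp p q (-κ) F + (head R).op p 0 0 b := by
    conv_lhs => rw [h2, map_add]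
    rfl
  conv_lhs => rw [h1, h3]
  abel

/-- The first component, on `[0, R]`, of the column normalized at zero.  The kernel is
`e^{-2iκ(x-y)}` with `y < x`, so that the nonnegative phase `2(x-y)` comes with `-κ`. -/
def headSolFst (p q : ℝ → ℂ) (R : ℝ) (κ : ℂ) : ℝ →ᵇ ℂ := (head R).resolvent p q (-κ) 1

/-- The second component, on `[0, R]`, of the column normalized at zero. -/
def headSolSnd (p q : ℝ → ℂ) (R : ℝ) (κ : ℂ) : ℝ →ᵇ ℂ :=
  (head R).op q 0 (-κ) (headSolFst p q R κ)

lemma exists_expBound (hR : 0 ≤ R) (κ : ℂ) : ∃ M, (head R).ExpBound {κ} M :=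
  ⟨_, fun k hk => head_expBound (b := |κ.im| + 1) hR (by positivity) k (by
    rw [mem_singleton_iff.1 hk]
    have := neg_abs_le κ.im
    change -(|κ.im| + 1) < κ.im
    linarith)⟩

lemma headSolFst_eq (hp : Continuous p) (hq : Continuous q) (hR : 0 ≤ R) (κ : ℂ) (x : ℝ) :
    headSolFst p q R κ x =
      1 + ∫ y in (0 : ℝ)..(min (max x 0) R), p y * headSolSnd p q R κ y := by
  obtain ⟨M, hM⟩ := exists_expBound hR (-κ)
  have e := resolvent_apply_eq (head_volterraDensity hp R) (head_admissible hq R 0) hM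
    (mem_singleton _) 1
  have e' : headSolFst p q R κ = (head R).op p 0 0 (headSolSnd p q R κ) + 1 := e
  conv_lhs => rw [e', BoundedContinuousFunction.add_apply, head_op_zero_apply hp hR, add_comm]
  rfl

lemma headSolSnd_eq (hq : Continuous q) (hR : 0 ≤ R) (κ : ℂ) (x : ℝ) :
    headSolSnd p q R κ x = ∫ y : ℝ in (0 : ℝ)..(min (max x 0) R),
      exp (2 * (I * κ * (y - (min (max x 0) R : ℝ)))) * (q y * headSolFst p q R κ y) := by
  obtain ⟨M, hM⟩ := exists_expBound hR (-κ)
  conv_lhs => rw [headSolSnd, head_op_apply hq hR hM (mem_singleton _), neg_neg]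

/-- Uniqueness for the column equations on `[0, R]`. -/
lemma SolvesHead.eq_head (hp : Continuous p) (hq : Continuous q) (hR : 0 ≤ R)
    (h : ∀ x ∈ Icc 0 R, SolvesHead p q κ f g x) {x : ℝ} (hx : x ∈ Icc 0 R) :
    f x = headSolFst p q R κ x ∧ g x = headSolSnd p q R κ x := by
  have hR' : R ∈ Icc 0 R := right_mem_Icc.2 hR
  have hu : uIcc 0 R = Icc 0 R := uIcc_of_le hR
  have hfc : ContinuousOn f (Icc 0 R) := by
    have := intervalIntegral.continuousOn_primitive_interval' (h R hR').1 (left_mem_uIcc)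
    rw [hu] at this
    exact (continuousOn_const.add this).congr fun x hx => (h x hx).2
  have hgc : ContinuousOn g (Icc 0 R) := by
    have hi : IntervalIntegrable (fun y : ℝ => exp (2 * (I * κ * y)) * (q y * f y)) volume 0 R := by
      have := ((h R hR').3).const_mul (exp (2 * (I * κ * R)))
      refine this.congr fun y _ => ?_
      change exp (2 * (I * κ * R)) * (exp (2 * (I * κ * (y - R))) * (q y * f y)) = _
      have e : exp (2 * (I * κ * R)) * exp (-(2 * (I * κ * R))) = 1 := by
        rw [← Complex.exp_add, add_neg_cancel, Complex.exp_zero]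
      rw [exp_two_mul_sub]
      linear_combination (exp (2 * (I * κ * y)) * (q y * f y)) * e
    have := intervalIntegral.continuousOn_primitive_interval' hi (left_mem_uIcc)
    rw [hu] at this
    have hc : Continuous fun x : ℝ => exp (-(2 * (I * κ * x))) := by fun_prop
    refine (hc.continuousOn.mul this).congr fun x hx => ?_
    rw [(h x hx).4]
    simp only [← intervalIntegral.integral_const_mul, Pi.mul_apply, exp_two_mul_sub κ x,
      mul_assoc (exp (-(2 * (I * κ * x))))]
  obtain ⟨F, hF⟩ := exists_boundedContinuous_head hR hfc
  obtain ⟨H, hH⟩ := exists_boundedContinuous_head hR hgc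
  have hm : ∀ x, min (max x 0) R ∈ Icc 0 R := fun x =>
    ⟨le_min (le_max_right _ _) hR, min_le_right _ _⟩
  have hcl : ∀ x, 0 ≤ x → x ≤ R → min (max x 0) R = x := fun x h1 h2 => by
    rw [max_eq_left h1, min_eq_left h2]
  obtain ⟨M, hM⟩ := exists_expBound hR (-κ)
  obtain ⟨h1, h2⟩ := head_eq_prodOp_add (F := F) (H := H) (a := 1) (b := 0) hp hq hR hM
    (mem_singleton _)
    (fun x => by
      rw [hF, (h _ (hm x)).2]
      change _ = (1 : ℂ) + _
      congr 1
      refine setIntegral_head_congr (hm x).1 fun y hy hy' => ?_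
      rw [hH, hcl y hy (hy'.trans (hm x).2)])
    (fun x => by
      rw [hH, (h _ (hm x)).4]
      change _ = (0 : ℂ) + _
      rw [zero_add]
      refine setIntegral_head_congr (hm x).1 fun y hy hy' => ?_
      rw [hF, hcl y hy (hy'.trans (hm x).2)])
  rw [map_zero, add_zero] at h1
  rw [add_zero] at h2
  have h3 : F = headSolFst p q R κ := eq_resolvent_apply (head_volterraDensity hp R)
    (head_admissible hq R 0) hM (mem_singleton _) h1
  have h4 : H = headSolSnd p q R κ := by rw [h2, h3]; rfl
  rw [← h3, ← h4, hF, hH, hcl x hx.1 hx.2]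
  exact ⟨rfl, rfl⟩

/-- The first component of the column normalized at zero. -/
def headFst (p q : ℝ → ℂ) (x : ℝ) (κ : ℂ) : ℂ := headSolFst p q x κ x

/-- The second component of the column normalized at zero. -/
def headSnd (p q : ℝ → ℂ) (x : ℝ) (κ : ℂ) : ℂ := headSolSnd p q x κ x

lemma solvesHead_headSol (hp : Continuous p) (hq : Continuous q) (hR : 0 ≤ R) (κ : ℂ) {x : ℝ}
    (hx : x ∈ Icc 0 R) : SolvesHead p q κ (headSolFst p q R κ) (headSolSnd p q R κ) x := by
  have hcl : min (max x 0) R = x := by rw [max_eq_left hx.1, min_eq_left hx.2]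
  refine ⟨(hp.mul (headSolSnd p q R κ).continuous).intervalIntegrable _ _, ?_, ?_, ?_⟩
  · rw [headSolFst_eq hp hq hR, hcl]
  · have : Continuous fun y : ℝ => exp (2 * (I * κ * (y - x))) * (q y * headSolFst p q R κ y) := by
      fun_prop
    exact this.intervalIntegrable _ _
  · rw [headSolSnd_eq hq hR, hcl]

/-- The solutions on different intervals agree. -/
lemma head_eq_headSol (hp : Continuous p) (hq : Continuous q) (κ : ℂ) {x : ℝ} (hx : x ∈ Icc 0 R) :
    headFst p q x κ = headSolFst p q R κ x ∧ headSnd p q x κ = headSolSnd p q R κ x := by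
  have hR := hx.1.trans hx.2
  obtain ⟨h1, h2⟩ := SolvesHead.eq_head hp hq hx.1 (fun y hy =>
    solvesHead_headSol hp hq hR κ ⟨hy.1, hy.2.trans hx.2⟩) (right_mem_Icc.2 hx.1)
  exact ⟨h1.symm, h2.symm⟩

lemma solvesHead_head (hp : Continuous p) (hq : Continuous q) (κ : ℂ) {x : ℝ} (hx : 0 ≤ x) :
    SolvesHead p q κ (fun x => headFst p q x κ) (fun x => headSnd p q x κ) x := by
  have e : ∀ y ∈ Icc 0 x, headFst p q y κ = headSolFst p q x κ y ∧
      headSnd p q y κ = headSolSnd p q x κ y := fun y hy => head_eq_headSol hp hq κ hy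
  obtain ⟨h1, h2, h3, h4⟩ := solvesHead_headSol hp hq hx κ (right_mem_Icc.2 hx)
  refine ⟨?_, ?_, ?_, ?_⟩
  · refine h1.congr (fun y hy => ?_)
    rw [uIoc_of_le hx] at hy
    rw [(e y ⟨hy.1.le, hy.2⟩).2]
  · change headSolFst p q x κ x = _
    rw [h2]
    congr 1
    refine setIntegral_head_congr hx fun y hy hy' => ?_
    rw [(e y ⟨hy, hy'⟩).2]
  · refine h3.congr (fun y hy => ?_)
    rw [uIoc_of_le hx] at hy
    simp only [(e y ⟨hy.1.le, hy.2⟩).1]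
  · change headSolSnd p q x κ x = _
    rw [h4]
    refine setIntegral_head_congr hx fun y hy hy' => ?_
    simp only [(e y ⟨hy, hy'⟩).1]

lemma hasDerivWithinAt_headFst (hp : Continuous p) (hq : Continuous q) (κ : ℂ) {x : ℝ}
    (hx : 0 ≤ x) :
    HasDerivWithinAt (fun x => headFst p q x κ) (p x * headSnd p q x κ) (Ici 0) x := by
  have hR : 0 ≤ x + 1 := by linarith
  have hc : Continuous fun y => p y * headSolSnd p q (x + 1) κ y := by fun_prop
  have hd := ((intervalIntegral.integral_hasDerivAt_right (hc.intervalIntegrable 0 x)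
    hc.aestronglyMeasurable.stronglyMeasurableAtFilter hc.continuousAt).const_add
      1).hasDerivWithinAt (s := Ici 0)
  have e : ∀ y, 0 ≤ y → y ≤ x + 1 → headFst p q y κ =
      1 + ∫ t in (0 : ℝ)..y, p t * headSolSnd p q (x + 1) κ t := fun y hy hy' => by
    rw [(head_eq_headSol hp hq κ ⟨hy, hy'⟩).1, (solvesHead_headSol hp hq hR κ ⟨hy, hy'⟩).2]
  rw [← (head_eq_headSol hp hq κ ⟨hx, by linarith⟩).2] at hd
  refine hd.congr_of_eventuallyEq ?_ (e x hx (by linarith))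
  filter_upwards [self_mem_nhdsWithin, mem_nhdsWithin_of_mem_nhds
    (Iic_mem_nhds (lt_add_one x))] with y hy hy' using e y hy hy'

lemma hasDerivWithinAt_headSnd (hp : Continuous p) (hq : Continuous q) (κ : ℂ) {x : ℝ}
    (hx : 0 ≤ x) :
    HasDerivWithinAt (fun x => headSnd p q x κ)
      (q x * headFst p q x κ - 2 * I * κ * headSnd p q x κ) (Ici 0) x := by
  have hR : 0 ≤ x + 1 := by linarith
  have hc : Continuous fun y : ℝ => exp (2 * (I * κ * y)) * (q y * headSolFst p q (x + 1) κ y) := by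
    fun_prop
  have hd := intervalIntegral.integral_hasDerivAt_right (hc.intervalIntegrable 0 x)
    hc.aestronglyMeasurable.stronglyMeasurableAtFilter hc.continuousAt
  have hE : HasDerivAt (fun x : ℝ => exp (-(2 * (I * κ * x))))
      (exp (-(2 * (I * κ * x))) * (-(2 * (I * κ)))) x := by
    have h1 : HasDerivAt (fun x : ℝ => -(2 * (I * κ * (x : ℂ)))) (-(2 * (I * κ))) x := by
      have := ((hasDerivAt_id x).ofReal_comp.const_mul (I * κ)).const_mul (-2)
      simpa using this
    exact h1.cexp
  have hm := (hE.mul hd).hasDerivWithinAt (s := Ici 0)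
  have e : ∀ y : ℝ, 0 ≤ y → y ≤ x + 1 → headSnd p q y κ = exp (-(2 * (I * κ * y))) *
      ∫ t : ℝ in (0 : ℝ)..y, exp (2 * (I * κ * t)) * (q t * headSolFst p q (x + 1) κ t) :=
    fun y hy hy' => by
      rw [(head_eq_headSol hp hq κ ⟨hy, hy'⟩).2, (solvesHead_headSol hp hq hR κ ⟨hy, hy'⟩).4,
        ← intervalIntegral.integral_const_mul]
      simp only [exp_two_mul_sub κ y, mul_assoc (exp (-(2 * (I * κ * y))))]
  have hx' := e x hx (by linarith)
  have e3 : exp (-(2 * (I * κ * x))) * exp (2 * (I * κ * x)) = 1 := by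
    rw [← Complex.exp_add, neg_add_cancel, Complex.exp_zero]
  refine HasDerivWithinAt.congr_deriv (hm.congr_of_eventuallyEq ?_ hx') ?_
  · filter_upwards [self_mem_nhdsWithin, mem_nhdsWithin_of_mem_nhds
      (Iic_mem_nhds (lt_add_one x))] with y hy hy' using e y hy hy'
  · rw [hx', (head_eq_headSol hp hq κ ⟨hx, (lt_add_one x).le⟩).1]
    linear_combination (q x * headSolFst p q (x + 1) κ x) * e3

lemma differentiableAt_clm_neg_apply {E : Type*} [NormedAddCommGroup E] [NormedSpace ℂ E]
    {A : ℂ → E →L[ℂ] E} {v : ℂ → E} {κ : ℂ} (hA : DifferentiableAt ℂ A (-κ))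
    (hv : DifferentiableAt ℂ v κ) : DifferentiableAt ℂ (fun k => A (-k) (v k)) κ := by
  have hn : DifferentiableAt ℂ (fun k : ℂ => -k) κ := differentiableAt_id.neg
  have h : DifferentiableAt ℂ (fun k => A (-k)) κ := hA.comp κ hn
  exact h.clm_apply hv

lemma differentiable_headSol (hp : Continuous p) (hq : Continuous q) (hR : 0 ≤ R) :
    Differentiable ℂ (headSolFst p q R) ∧ Differentiable ℂ (headSolSnd p q R) := by
  refine forall_and.1 fun κ => ?_
  set D : Set ℂ := {k | -(|κ.im| + 1) < k.im} with hDdef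
  have hDo : IsOpen D := isOpen_lt continuous_const continuous_im
  have hDc : Convex ℝ D := convex_halfSpace_im_gt _
  have hκ : -κ ∈ D := by
    have := le_abs_self κ.im
    change -(|κ.im| + 1) < -κ.im
    linarith
  have hM := head_expBound (b := |κ.im| + 1) hR (by positivity)
  have hq' := head_admissible hq R 1
  have h1 : DifferentiableAt ℂ ((head R).resolvent p q) (-κ) :=
    ((contDiffOn_resolvent (head_volterraDensity hp R) hq' hDc hDo.uniqueDiffOn hM
      ).differentiableOn (by norm_num)).differentiableAt (hDo.mem_nhds hκ)
  have h2 : DifferentiableAt ℂ ((head R).op q 0) (-κ) :=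
    ((contDiffOn_op hq' hDc hDo.uniqueDiffOn hM 1 0 le_rfl).differentiableOn
      (by norm_num)).differentiableAt (hDo.mem_nhds hκ)
  have h3 : DifferentiableAt ℂ (headSolFst p q R) κ :=
    differentiableAt_clm_neg_apply h1 (differentiableAt_const _)
  exact ⟨h3, differentiableAt_clm_neg_apply h2 h3⟩

lemma differentiable_headFst (hp : Continuous p) (hq : Continuous q) {x : ℝ} (hx : 0 ≤ x) :
    Differentiable ℂ (headFst p q x) := fun κ =>
  (BoundedContinuousFunction.evalCLM ℂ x : (ℝ →ᵇ ℂ) →L[ℂ] ℂ).differentiableAt.comp κ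
    ((differentiable_headSol hp hq hx).1 κ)

lemma differentiable_headSnd (hp : Continuous p) (hq : Continuous q) {x : ℝ} (hx : 0 ≤ x) :
    Differentiable ℂ (headSnd p q x) := fun κ =>
  (BoundedContinuousFunction.evalCLM ℂ x : (ℝ →ᵇ ℂ) →L[ℂ] ℂ).differentiableAt.comp κ
    ((differentiable_headSol hp hq hx).2 κ)

/-- Stability of the column equations on `[0, R]`, with zero initial values and inhomogeneities
`α` and `β`. -/
lemma norm_le_of_hasDerivWithinAt_head (hp : Continuous p) (hq : Continuous q) (hR : 0 ≤ R)
    (hM : ∀ s ∈ Icc 0 R, ‖exp (2 * I * κ * (s : ℝ))‖ ≤ M) {α β : ℝ → ℂ}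
    (hα : ContinuousOn α (Ici 0)) (hβ : ContinuousOn β (Ici 0))
    (hf : ∀ x, 0 ≤ x → HasDerivWithinAt f (p x * g x + α x) (Ici 0) x)
    (hg : ∀ x, 0 ≤ x → HasDerivWithinAt g (q x * f x + 2 * I * κ * g x + β x) (Ici 0) x)
    (hf0 : f 0 = 0) (hg0 : g 0 = 0) {A B P Q : ℝ}
    (hA : ∫ y in Ioc 0 R, ‖α y‖ ≤ A) (hB : M * ∫ y in Ioc 0 R, ‖β y‖ ≤ B)
    (hP : ∫ y in Ioc 0 R, ‖p y‖ ≤ P) (hQ : M * ∫ y in Ioc 0 R, ‖q y‖ ≤ Q) :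
    ‖f R‖ ≤ Real.exp (Q * P) * (A + P * B) ∧
      ‖g R‖ ≤ Q * (Real.exp (Q * P) * (A + P * B)) + B := by
  have hM1 : 1 ≤ M := by simpa using hM 0 (left_mem_Icc.2 hR)
  have hfc : ContinuousOn f (Ici 0) := fun x hx => (hf x hx).continuousWithinAt
  have hgc : ContinuousOn g (Ici 0) := fun x hx => (hg x hx).continuousWithinAt
  have hA0 : 0 ≤ A := (integral_nonneg fun _ => norm_nonneg _).trans hA
  have hB0 : 0 ≤ B := le_trans (mul_nonneg (by linarith)
    (integral_nonneg fun _ => norm_nonneg _)) hB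
  have hP0 : 0 ≤ P := (integral_nonneg fun _ => norm_nonneg _).trans hP
  have hQ0 : 0 ≤ Q := le_trans (mul_nonneg (by linarith)
    (integral_nonneg fun _ => norm_nonneg _)) hQ
  have hpg : ContinuousOn (fun y => p y * g y) (Ici 0) := hp.continuousOn.mul hgc
  have hqf : ContinuousOn (fun y => q y * f y) (Ici 0) := hq.continuousOn.mul hfc
  have hpgα : ContinuousOn (fun y => p y * g y + α y) (Ici 0) := hpg.add hα
  have hii : ∀ {h : ℝ → ℂ} {x : ℝ}, ContinuousOn h (Ici 0) → 0 ≤ x →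
      IntervalIntegrable h volume 0 x := fun hh hx =>
    (hh.mono (by rw [uIcc_of_le hx]; exact Icc_subset_Ici_self)).intervalIntegrable
  have eqf : ∀ x, 0 ≤ x → f x = ∫ y in (0 : ℝ)..x, (p y * g y + α y) := fun x hx => by
    rw [intervalIntegral.integral_eq_sub_of_hasDeriv_right (f := f)
      (hfc.mono (by rw [uIcc_of_le hx]; exact Icc_subset_Ici_self))
      (fun y hy => (hf y (by rw [min_eq_left hx] at hy; exact hy.1.le)).mono
        (by rw [min_eq_left hx] at hy
            exact Ioi_subset_Ici_self.trans (Ici_subset_Ici.2 hy.1.le)))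
      (hii hpgα hx), hf0, sub_zero]
  have eqg : ∀ x : ℝ, 0 ≤ x → g x = ∫ y : ℝ in (0 : ℝ)..x,
      exp (2 * (I * (-κ) * (y - x))) * (q y * f y + β y) := fun x hx => by
    have hE : ∀ y : ℝ, HasDerivAt (fun y : ℝ => exp (2 * (I * (-κ) * (y - x))))
        (exp (2 * (I * (-κ) * (y - x))) * (2 * (I * (-κ)))) y := fun y => by
      have h1 : HasDerivAt (fun y : ℝ => 2 * (I * (-κ) * ((y : ℂ) - x))) (2 * (I * (-κ))) y := by
        have := ((((hasDerivAt_id y).ofReal_comp.sub_const (x : ℂ)).const_mul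
          (I * (-κ))).const_mul 2)
        simpa using this
      exact h1.cexp
    have hEc : Continuous fun y : ℝ => exp (2 * (I * (-κ) * (y - x))) := by fun_prop
    have hEi : ContinuousOn (fun y : ℝ => exp (2 * (I * (-κ) * (y - x))) * (q y * f y + β y))
      (Ici 0) := hEc.continuousOn.mul (hqf.add hβ)
    rw [intervalIntegral.integral_eq_sub_of_hasDeriv_right
      (f := fun y : ℝ => exp (2 * (I * (-κ) * (y - x))) * g y)
      ((hEc.continuousOn.mul hgc).mono (by rw [uIcc_of_le hx]; exact Icc_subset_Ici_self))
      (fun y hy => ?_) (hii hEi hx), hg0]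
    · simp
    · rw [min_eq_left hx] at hy
      refine HasDerivWithinAt.congr_deriv ((hE y).hasDerivWithinAt.mul ((hg y hy.1.le).mono
        (Ioi_subset_Ici_self.trans (Ici_subset_Ici.2 hy.1.le)))) ?_
      ring
  obtain ⟨F, hF⟩ := exists_boundedContinuous_head hR (hfc.mono Icc_subset_Ici_self)
  obtain ⟨H, hH⟩ := exists_boundedContinuous_head hR (hgc.mono Icc_subset_Ici_self)
  have hm : ∀ x, min (max x 0) R ∈ Icc 0 R := fun x =>
    ⟨le_min (le_max_right _ _) hR, min_le_right _ _⟩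
  have hcl : ∀ x, 0 ≤ x → x ≤ R → min (max x 0) R = x := fun x h1 h2 => by
    rw [max_eq_left h1, min_eq_left h2]
  have hEB : (head R).ExpBound {κ} M := head_expBound_singleton hR hM
  have hκ : -(-κ) ∈ ({κ} : Set ℂ) := by simp
  set a : ℝ →ᵇ ℂ := F - (head R).op p 0 0 H with ha
  set b : ℝ →ᵇ ℂ := H - (head R).op q 0 κ F with hb
  have hpn : ‖(head R).op p 0 0‖ ≤ P :=
    (norm_op_zero_le (head_admissible hp R 0)).trans hP
  have hqn : ‖(head R).op q 0 κ‖ ≤ Q :=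
    (norm_op_le_mul_integral (head_admissible hq R 0) hEB (mem_singleton κ)).trans hQ
  have iα : IntegrableOn (fun y => ‖α y‖) (Ioc 0 R) :=
    ((intervalIntegrable_iff_integrableOn_Ioc_of_le hR).1 (hii hα hR)).norm
  have iβ : IntegrableOn (fun y => ‖β y‖) (Ioc 0 R) :=
    ((intervalIntegrable_iff_integrableOn_Ioc_of_le hR).1 (hii hβ hR)).norm
  have han : ‖a‖ ≤ A := by
    refine (BoundedContinuousFunction.norm_le hA0).2 fun x => ?_
    obtain ⟨h0, h1⟩ := hm x
    have e : a x = ∫ y in Ioc 0 (min (max x 0) R), α y := by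
      rw [ha, BoundedContinuousFunction.sub_apply, head_op_zero_apply hp hR, hF, eqf _ h0,
        intervalIntegral.integral_add (hii hpg h0) (hii hα h0),
        ← intervalIntegral.integral_of_le h0]
      rw [setIntegral_head_congr h0 (h := fun y => p y * H y) (h' := fun y => p y * g y)
        fun y hy hy' => by rw [hH, hcl y hy (hy'.trans h1)]]
      ring
    rw [e]
    refine (norm_integral_le_integral_norm _).trans (le_trans ?_ hA)
    exact setIntegral_mono_set iα (.of_forall fun _ => norm_nonneg _)
      (Ioc_subset_Ioc_right h1).eventuallyLE
  have hbn : ‖b‖ ≤ B := by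
    refine (BoundedContinuousFunction.norm_le hB0).2 fun x => ?_
    obtain ⟨h0, h1⟩ := hm x
    set z := min (max x 0) R with hz
    have hEc : Continuous fun y : ℝ => exp (2 * (I * (-κ) * (y - z))) := by fun_prop
    have hEi : ContinuousOn (fun y : ℝ => exp (2 * (I * (-κ) * (y - z))) * (q y * f y + β y))
      (Ici 0) := hEc.continuousOn.mul (hqf.add hβ)
    have hEj : ContinuousOn (fun y : ℝ => exp (2 * (I * (-κ) * (y - z))) * (q y * f y))
      (Ici 0) := hEc.continuousOn.mul hqf
    have e : b x = ∫ y in Ioc 0 z, exp (2 * (I * (-κ) * (y - z))) * β y := by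
      rw [hb, BoundedContinuousFunction.sub_apply, head_op_apply hq hR hEB (mem_singleton κ), ← hz,
        hH, ← hz, eqg _ h0, ← intervalIntegral.integral_of_le h0]
      rw [setIntegral_head_congr h0 (h := fun y => exp (2 * (I * (-κ) * (y - z))) * (q y * F y))
        (h' := fun y => exp (2 * (I * (-κ) * (y - z))) * (q y * f y))
        fun y hy hy' => by rw [hF, hcl y hy (hy'.trans h1)]]
      rw [← intervalIntegral.integral_sub (hii hEi h0) (hii hEj h0)]
      congr 1; ext y; ring
    rw [e]
    refine le_trans (le_trans (norm_integral_le_of_norm_le (g := fun y => M * ‖β y‖)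
      ((iβ.mono_set (Ioc_subset_Ioc_right h1)).const_mul M) ?_) ?_) hB
    · filter_upwards [ae_restrict_mem measurableSet_Ioc] with y hy
      rw [norm_mul]
      gcongr
      have := hM (z - y) ⟨by linarith [hy.2], by linarith [hy.1]⟩
      have e1 : 2 * (I * (-κ) * ((y : ℂ) - z)) = 2 * I * κ * ((z - y : ℝ) : ℂ) := by
        push_cast
        ring
      rwa [e1]
    · rw [integral_const_mul]
      refine mul_le_mul_of_nonneg_left ?_ (by linarith)
      exact setIntegral_mono_set iβ (.of_forall fun _ => norm_nonneg _)
        (Ioc_subset_Ioc_right h1).eventuallyLE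
  have hFeq : F = (head R).prodOp p q κ F + (a + (head R).op p 0 0 b) := by
    have e1 : (head R).op p 0 0 b = (head R).op p 0 0 H - (head R).prodOp p q κ F := by
      rw [hb, map_sub]; rfl
    rw [e1, ha]
    abel
  have hFn : ‖F‖ ≤ Real.exp (Q * P) * (A + P * B) := by
    refine (norm_le_of_eq_add (head_volterraDensity hp R) (head_admissible hq R 0) hEB
      (mem_singleton κ) hFeq).trans ?_
    refine mul_le_mul (Real.exp_le_exp.2 ?_) ?_ (norm_nonneg _) (Real.exp_pos _).le
    · exact mul_le_mul hQ hP (integral_nonneg fun _ => norm_nonneg _) hQ0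
    · refine (norm_add_le _ _).trans (add_le_add han ?_)
      exact (ContinuousLinearMap.le_opNorm _ _).trans (mul_le_mul hpn hbn (norm_nonneg _) hP0)
  have hHn : ‖H‖ ≤ Q * (Real.exp (Q * P) * (A + P * B)) + B := by
    have e1 : H = (head R).op q 0 κ F + b := by rw [hb]; abel
    rw [e1]
    refine (norm_add_le _ _).trans (add_le_add ?_ hbn)
    exact (ContinuousLinearMap.le_opNorm _ _).trans (mul_le_mul hqn hFn (norm_nonneg _) hQ0)
  have hfR : f R = F R := by rw [hF, hcl R hR le_rfl]
  have hgR : g R = H R := by rw [hH, hcl R hR le_rfl]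
  rw [hfR, hgR]
  exact ⟨(F.norm_coe_le_norm R).trans hFn, (H.norm_coe_le_norm R).trans hHn⟩

end Head

/-! ### Regularity classes on the half-line -/

/-- `f` and its derivatives on `[0, ∞)` up to order `r` satisfy `Φ`. -/
def RegOn (Φ : (ℝ → ℂ) → Prop) : ℕ → (ℝ → ℂ) → Prop
  | 0, f => Φ f
  | r + 1, f => Φ f ∧ ∃ f' : ℝ → ℂ,
      (∀ x, 0 ≤ x → HasDerivWithinAt f (f' x) (Ici 0) x) ∧ RegOn Φ r f'

/-- `f` is continuous on `[0, ∞)` and `(1 + y)^n f(y)` is integrable there. -/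
def WeightedL1 (n : ℕ) (f : ℝ → ℂ) : Prop :=
  ContinuousOn f (Ici 0) ∧ IntegrableOn (fun y => (1 + y) ^ n * ‖f y‖) (Ioi 0)

/-- `f` is continuous and bounded on `[0, ∞)`. -/
def ContBdd (f : ℝ → ℂ) : Prop :=
  ContinuousOn f (Ici 0) ∧ ∃ C, ∀ x, 0 ≤ x → ‖f x‖ ≤ C

section RegOn

variable {Φ Ψ Χ : (ℝ → ℂ) → Prop} {r r' n : ℕ} {f g f' : ℝ → ℂ}

lemma RegOn.base : ∀ {r : ℕ}, RegOn Φ r f → Φ f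
  | 0, h => h
  | _ + 1, h => h.1

lemma RegOn.pred : ∀ {r : ℕ} {f : ℝ → ℂ}, RegOn Φ (r + 1) f → RegOn Φ r f
  | 0, _, h => h.1
  | _ + 1, _, ⟨h, f', hd, hf'⟩ => ⟨h, f', hd, hf'.pred⟩

lemma RegOn.mono (h : RegOn Φ r f) (hr : r' ≤ r) : RegOn Φ r' f := by
  induction r, hr using Nat.le_induction with
  | base => exact h
  | succ r _ ih => exact ih h.pred

lemma RegOn.congr (hΦ : ∀ f g, Φ f → EqOn g f (Ici 0) → Φ g) (h : RegOn Φ r f)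
    (he : EqOn g f (Ici 0)) : RegOn Φ r g := by
  cases r with
  | zero => exact hΦ _ _ h he
  | succ r =>
    obtain ⟨h0, f', hd, hf'⟩ := h
    exact ⟨hΦ _ _ h0 he, f', fun x hx => (hd x hx).congr he (he hx), hf'⟩

lemma RegOn.derivWithin (hΦ : ∀ f g, Φ f → EqOn g f (Ici 0) → Φ g) (h : RegOn Φ (r + 1) f) :
    RegOn Φ r (derivWithin f (Ici 0)) := by
  obtain ⟨_, f', hd, hf'⟩ := h
  exact hf'.congr hΦ fun x hx => (hd x hx).derivWithin (uniqueDiffOn_Ici 0 x hx)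

lemma RegOn.hasDerivWithinAt (h : RegOn Φ (r + 1) f) {x : ℝ} (hx : 0 ≤ x) :
    HasDerivWithinAt f (_root_.derivWithin f (Ici 0) x) (Ici 0) x := by
  obtain ⟨_, f', hd, _⟩ := h
  exact (hd x hx).differentiableWithinAt.hasDerivWithinAt

lemma RegOn.add (hΦ : ∀ f g, Φ f → Φ g → Φ fun x => f x + g x) :
    ∀ {r : ℕ} {f g : ℝ → ℂ}, RegOn Φ r f → RegOn Φ r g → RegOn Φ r fun x => f x + g x
  | 0, _, _, hf, hg => hΦ _ _ hf hg
  | _ + 1, _, _, ⟨hf, _, hd, hf'⟩, ⟨hg, _, hd', hg'⟩ =>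
    ⟨hΦ _ _ hf hg, _, fun x hx => (hd x hx).add (hd' x hx), RegOn.add hΦ hf' hg'⟩

lemma RegOn.const_mul (hΦ : ∀ (c : ℂ) f, Φ f → Φ fun x => c * f x) (c : ℂ) :
    ∀ {r : ℕ} {f : ℝ → ℂ}, RegOn Φ r f → RegOn Φ r fun x => c * f x
  | 0, _, hf => hΦ _ _ hf
  | _ + 1, _, ⟨hf, _, hd, hf'⟩ =>
    ⟨hΦ _ _ hf, _, fun x hx => (hd x hx).const_mul c, RegOn.const_mul hΦ c hf'⟩

lemma RegOn.mul (hΧ : ∀ f g, Χ f → Χ g → Χ fun x => f x + g x)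
    (hΦ : ∀ f g, Φ f → Ψ g → Χ fun x => f x * g x) :
    ∀ {r : ℕ} {f g : ℝ → ℂ}, RegOn Φ r f → RegOn Ψ r g → RegOn Χ r fun x => f x * g x
  | 0, _, _, hf, hg => hΦ _ _ hf hg
  | _ + 1, _, _, hF@⟨hf, _, hd, hf'⟩, hG@⟨hg, _, hd', hg'⟩ =>
    ⟨hΦ _ _ hf hg, _, fun x hx => (hd x hx).mul (hd' x hx),
      RegOn.add hΧ (RegOn.mul hΧ hΦ hf' hG.pred) (RegOn.mul hΧ hΦ hF.pred hg')⟩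

lemma WeightedL1.congr (f g : ℝ → ℂ) (h : WeightedL1 n f) (he : EqOn g f (Ici 0)) :
    WeightedL1 n g :=
  ⟨h.1.congr he, h.2.congr_fun (fun x hx => by
    simp only [he (Ioi_subset_Ici_self hx)]) measurableSet_Ioi⟩

lemma WeightedL1.aestronglyMeasurable (h : WeightedL1 n f) :
    AEStronglyMeasurable f (volume.restrict (Ioi 0)) :=
  (h.1.mono Ioi_subset_Ici_self).aestronglyMeasurable measurableSet_Ioi

lemma aestronglyMeasurable_weight_mul (n : ℕ)
    (hf : AEStronglyMeasurable f (volume.restrict (Ioi 0))) :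
    AEStronglyMeasurable (fun y : ℝ => (1 + y) ^ n * ‖f y‖) (volume.restrict (Ioi 0)) := by
  have : Continuous fun y : ℝ => (1 + y) ^ n := by fun_prop
  exact this.aestronglyMeasurable.mul hf.norm

lemma WeightedL1.add (f g : ℝ → ℂ) (hf : WeightedL1 n f) (hg : WeightedL1 n g) :
    WeightedL1 n fun x => f x + g x := by
  have hc : ContinuousOn (fun x => f x + g x) (Ici 0) := hf.1.add hg.1
  refine ⟨hc, (hf.2.add hg.2).mono' (aestronglyMeasurable_weight_mul n
    ((hc.mono Ioi_subset_Ici_self).aestronglyMeasurable measurableSet_Ioi)) ?_⟩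
  filter_upwards [ae_restrict_mem measurableSet_Ioi] with y hy
  have hy : (0 : ℝ) < y := hy
  rw [Real.norm_of_nonneg (by positivity), Pi.add_apply, ← mul_add]
  gcongr
  exact norm_add_le _ _

lemma WeightedL1.const_mul (c : ℂ) (f : ℝ → ℂ) (hf : WeightedL1 n f) :
    WeightedL1 n fun x => c * f x := by
  have h : IntegrableOn (fun y : ℝ => ‖c‖ * ((1 + y) ^ n * ‖f y‖)) (Ioi 0) := hf.2.const_mul ‖c‖
  refine ⟨continuousOn_const.mul hf.1, h.congr_fun (fun y _ => ?_) measurableSet_Ioi⟩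
  simp only [norm_mul]
  ring

lemma WeightedL1.mul_contBdd (f g : ℝ → ℂ) (hf : WeightedL1 n f) (hg : ContBdd g) :
    WeightedL1 n fun x => f x * g x := by
  obtain ⟨C, hC⟩ := hg.2
  have hc : ContinuousOn (fun x => f x * g x) (Ici 0) := hf.1.mul hg.1
  refine ⟨hc, (hf.2.mul_const C).mono' (aestronglyMeasurable_weight_mul n
    ((hc.mono Ioi_subset_Ici_self).aestronglyMeasurable measurableSet_Ioi)) ?_⟩
  filter_upwards [ae_restrict_mem measurableSet_Ioi] with y hy
  have hy : (0 : ℝ) < y := hy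
  rw [Real.norm_of_nonneg (by positivity), norm_mul, mul_assoc]
  gcongr
  exact hC y hy.le

lemma WeightedL1.integrableOn (h : WeightedL1 n f) : IntegrableOn f (Ioi 0) :=
  (integrable_norm_iff h.aestronglyMeasurable).1
    (integrableOn_norm_of_weighted h.aestronglyMeasurable h.2)

lemma ContBdd.add (f g : ℝ → ℂ) (hf : ContBdd f) (hg : ContBdd g) :
    ContBdd fun x => f x + g x := by
  obtain ⟨C, hC⟩ := hf.2
  obtain ⟨C', hC'⟩ := hg.2
  exact ⟨hf.1.add hg.1, C + C', fun x hx =>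
    (norm_add_le _ _).trans (add_le_add (hC x hx) (hC' x hx))⟩

lemma ContBdd.mul (f g : ℝ → ℂ) (hf : ContBdd f) (hg : ContBdd g) :
    ContBdd fun x => f x * g x := by
  obtain ⟨C, hC⟩ := hf.2
  obtain ⟨C', hC'⟩ := hg.2
  refine ⟨hf.1.mul hg.1, C * C', fun x hx => ?_⟩
  rw [norm_mul]
  exact mul_le_mul (hC x hx) (hC' x hx) (norm_nonneg _) ((norm_nonneg _).trans (hC x hx))

lemma integral_eq_sub_of_hasDerivWithinAt_Ici {x : ℝ} (hx : 0 ≤ x)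
    (hd : ∀ x, 0 ≤ x → HasDerivWithinAt f (f' x) (Ici 0) x) (hc : ContinuousOn f' (Ici 0)) :
    ∫ y in (0 : ℝ)..x, f' y = f x - f 0 := by
  have hsub : uIcc 0 x ⊆ Ici 0 := by rw [uIcc_of_le hx]; exact Icc_subset_Ici_self
  refine intervalIntegral.integral_eq_sub_of_hasDeriv_right
    (fun y hy => (hd y (hsub hy)).continuousWithinAt.mono hsub) (fun y hy => ?_)
    (hc.mono hsub).intervalIntegrable
  rw [min_eq_left hx] at hy
  exact (hd y hy.1.le).mono (Ioi_subset_Ici_self.trans (Ici_subset_Ici.2 hy.1.le))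

lemma norm_intervalIntegral_le_of_integrableOn (hi : IntegrableOn f (Ioi 0)) {x : ℝ} (hx : 0 ≤ x) :
    ‖∫ y in (0 : ℝ)..x, f y‖ ≤ ∫ y in Ioi (0 : ℝ), ‖f y‖ := by
  rw [intervalIntegral.integral_of_le hx]
  exact (norm_integral_le_integral_norm _).trans (setIntegral_mono_set hi.norm
    (.of_forall fun _ => norm_nonneg _) Ioc_subset_Ioi_self.eventuallyLE)

/-- A function with integrable derivative is bounded. -/
lemma RegOn.contBdd_of_weightedL1 :
    ∀ {r : ℕ} {f : ℝ → ℂ}, RegOn (WeightedL1 n) (r + 1) f → RegOn ContBdd r f := by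
  have key : ∀ f : ℝ → ℂ, RegOn (WeightedL1 n) 1 f → ContBdd f := fun f h => by
    obtain ⟨h0, f', hd, hf'⟩ := h
    refine ⟨h0.1, ‖f 0‖ + ∫ y in Ioi (0 : ℝ), ‖f' y‖, fun x hx => ?_⟩
    have e := integral_eq_sub_of_hasDerivWithinAt_Ici hx hd hf'.1
    rw [← add_sub_cancel (f 0) (f x), ← e]
    exact (norm_add_le _ _).trans (add_le_add le_rfl
      (norm_intervalIntegral_le_of_integrableOn hf'.integrableOn hx))
  intro r
  induction r with
  | zero => exact fun h => key _ h
  | succ r ih =>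
    intro f h
    obtain ⟨h0, f', hd, hf'⟩ := h
    exact ⟨key f ⟨h0, f', hd, hf'.base⟩, f', hd, ih hf'⟩

/-- An integrable function with integrable derivative tends to zero at infinity. -/
lemma RegOn.tendsto_zero (h : RegOn (WeightedL1 n) 1 f) : Tendsto f atTop (𝓝 0) := by
  obtain ⟨h0, f', hd, hf'⟩ := h
  exact tendsto_zero_of_hasDerivAt_of_integrableOn_Ioi (a := 0)
    (fun x hx => (hd x (le_of_lt hx)).hasDerivAt (Ici_mem_nhds hx)) hf'.integrableOn
    h0.integrableOn

lemma contDiffOn_one_of_hasDerivWithinAt (hd : ∀ x, 0 ≤ x → HasDerivWithinAt f (f' x) (Ici 0) x)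
    (hc : ContinuousOn f' (Ici 0)) : ContDiffOn ℝ 1 f (Ici 0) := by
  have h1 : (1 : WithTop ℕ∞) = 0 + 1 := by norm_num
  rw [h1, contDiffOn_succ_iff_derivWithin (uniqueDiffOn_Ici 0)]
  refine ⟨fun x hx => (hd x hx).differentiableWithinAt, by simp, contDiffOn_zero.2 ?_⟩
  exact hc.congr fun x hx => (hd x hx).derivWithin (uniqueDiffOn_Ici 0 x hx)

lemma hasDerivWithinAt_primitive (hc : ContinuousOn f (Ici 0)) (c : ℂ) {x : ℝ} (hx : 0 ≤ x) :
    HasDerivWithinAt (fun x => c + ∫ y in (0 : ℝ)..x, f y) (f x) (Ici 0) x := by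
  set F : ℝ → ℂ := fun y => f (max y 0) with hF
  have hFc : Continuous F := hc.comp_continuous (by fun_prop) fun y => mem_Ici.2 (le_max_right _ _)
  have e : ∀ x, 0 ≤ x → c + ∫ y in (0 : ℝ)..x, f y = c + ∫ y in (0 : ℝ)..x, F y := fun x hx => by
    rw [setIntegral_head_congr hx (h := f) (h' := F) fun y hy _ => by
      simp only [hF, max_eq_left hy]]
  have hd := ((intervalIntegral.integral_hasDerivAt_right (hFc.intervalIntegrable 0 x)
    hFc.aestronglyMeasurable.stronglyMeasurableAtFilter hFc.continuousAt).const_add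
      c).hasDerivWithinAt (s := Ici 0)
  have hFx : F x = f x := by simp only [hF, max_eq_left hx]
  rw [hFx] at hd
  exact hd.congr e (e x hx)

lemma regOn_weightedL1_zero : ∀ r, RegOn (WeightedL1 n) r fun _ => 0
  | 0 => ⟨continuousOn_const, by simp⟩
  | r + 1 => ⟨⟨continuousOn_const, by simp⟩, _, fun _ _ => hasDerivWithinAt_const _ _ _,
      regOn_weightedL1_zero r⟩

lemma regOn_contBdd_const (c : ℂ) : ∀ r, RegOn ContBdd r fun _ => c
  | 0 => ⟨continuousOn_const, ‖c‖, fun _ _ => le_rfl⟩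
  | r + 1 => ⟨⟨continuousOn_const, ‖c‖, fun _ _ => le_rfl⟩, _,
      fun _ _ => hasDerivWithinAt_const _ _ _, regOn_contBdd_const 0 r⟩

lemma ContBdd.congr (f g : ℝ → ℂ) (h : ContBdd f) (he : EqOn g f (Ici 0)) : ContBdd g := by
  obtain ⟨h0, C, hC⟩ := h
  exact ⟨h0.congr he, C, fun x hx => by rw [he hx]; exact hC x hx⟩

lemma regOn_derivWithin_sub_mul {m : ℕ} (hq : RegOn (WeightedL1 n) (m + 1) q)
    (hm : r + 1 ≤ m + 1 + 1)
    (hf : RegOn (WeightedL1 n) (r + 1) f) (hg : RegOn ContBdd r g) :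
    RegOn (WeightedL1 n) r fun x => derivWithin f (Ici 0) x - q x * g x := by
  have h1 := hf.derivWithin WeightedL1.congr
  have h2 : RegOn (WeightedL1 n) r fun x => q x * g x :=
    RegOn.mul WeightedL1.add WeightedL1.mul_contBdd (hq.mono (by omega)) hg
  have h3 := RegOn.add WeightedL1.add h1 (RegOn.const_mul WeightedL1.const_mul (-1) h2)
  refine h3.congr WeightedL1.congr fun x _ => ?_
  ring

end RegOn

/-! ### Coefficients of formal solutions -/

/-- The coefficients `o_j`, `d_j` of a formal column solution `∑ (d_j, o_j) k^{-j}`: `o_0 = 0`,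
`d_0` is constant, `o_{j+1} = s (i/2) (o_j' - q d_j)` and `d_{j+1}' = p o_{j+1}`. -/
structure FormalPair (p q : ℝ → ℂ) (s : ℂ) (d₀ : ℂ) (o d : ℕ → ℝ → ℂ) : Prop where
  o_zero : ∀ x, 0 ≤ x → o 0 x = 0
  d_zero : ∀ x, 0 ≤ x → d 0 x = d₀
  o_succ : ∀ j x, 0 ≤ x →
    o (j + 1) x = s * (I / 2) * (derivWithin (o j) (Ici 0) x - q x * d j x)
  d_succ : ∀ j x, 0 ≤ x → d (j + 1) x = d (j + 1) 0 + ∫ y in (0 : ℝ)..x, p y * o (j + 1) y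

/-- The residual of a formal column solution truncated after the order `N`. -/
def residual (q : ℝ → ℂ) (o d : ℕ → ℝ → ℂ) (N : ℕ) (x : ℝ) : ℂ :=
  derivWithin (o N) (Ici 0) x - q x * d N x

namespace FormalPair

variable {p q : ℝ → ℂ} {s d₀ : ℂ} {o d : ℕ → ℝ → ℂ} {m n : ℕ}

/-- The off-diagonal coefficient `o_j` has one derivative more than `d_j`, and all its derivatives
are integrable with the weight. -/
lemma regOn (h : FormalPair p q s d₀ o d) (hp : RegOn (WeightedL1 n) (m + 1) p)
    (hq : RegOn (WeightedL1 n) (m + 1) q) (j : ℕ) : ∀ r, j + r = m + 1 →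
      RegOn (WeightedL1 n) (r + 1) (o j) ∧ RegOn ContBdd r (d j) := by
  induction j with
  | zero =>
    exact fun r _ =>
      ⟨(regOn_weightedL1_zero (r + 1)).congr WeightedL1.congr fun x hx => h.o_zero x hx,
      (regOn_contBdd_const d₀ r).congr ContBdd.congr fun x hx => h.d_zero x hx⟩
  | succ j ih =>
    intro r hr
    obtain ⟨ho, hd⟩ := ih (r + 1) (by omega)
    have ho' : RegOn (WeightedL1 n) (r + 1) (o (j + 1)) :=
      (RegOn.const_mul WeightedL1.const_mul (s * (I / 2))
        (regOn_derivWithin_sub_mul hq (by omega) ho hd)).congr WeightedL1.congr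
          fun x hx => h.o_succ j x hx
    refine ⟨ho', ?_⟩
    have hpb : RegOn ContBdd r p := (hp.mono (by omega : r + 1 ≤ m + 1)).contBdd_of_weightedL1
    have hpo : RegOn ContBdd r fun x => p x * o (j + 1) x :=
      RegOn.mul ContBdd.add ContBdd.mul hpb ho'.contBdd_of_weightedL1
    have hi : WeightedL1 n fun x => p x * o (j + 1) x :=
      WeightedL1.mul_contBdd _ _ hp.base
        (ho'.mono (by omega : 0 + 1 ≤ r + 1)).contBdd_of_weightedL1
    have hder : ∀ x, 0 ≤ x → HasDerivWithinAt (d (j + 1)) (p x * o (j + 1) x) (Ici 0) x :=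
      fun x hx => (hasDerivWithinAt_primitive hi.1 _ hx).congr (h.d_succ j) (h.d_succ j x hx)
    have hb : ContBdd (d (j + 1)) := by
      refine ⟨fun x hx => (hder x hx).continuousWithinAt,
        ‖d (j + 1) 0‖ + ∫ y in Ioi (0 : ℝ), ‖p y * o (j + 1) y‖, fun x hx => ?_⟩
      rw [h.d_succ j x hx]
      exact (norm_add_le _ _).trans (add_le_add le_rfl
        (norm_intervalIntegral_le_of_integrableOn hi.integrableOn hx))
    cases r with
    | zero => exact hb
    | succ r => exact ⟨hb, _, hder, hpo.pred⟩

variable (h : FormalPair p q s d₀ o d) (hp : RegOn (WeightedL1 n) (m + 1) p)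
  (hq : RegOn (WeightedL1 n) (m + 1) q)
include h hp hq

lemma regOn_one {j : ℕ} (hj : j ≤ m + 1) : RegOn (WeightedL1 n) 1 (o j) :=
  (h.regOn hp hq j (m + 1 - j) (by omega)).1.mono (by omega)

lemma hasDerivWithinAt_d {j : ℕ} (hj : j ≤ m + 1) {x : ℝ} (hx : 0 ≤ x) :
    HasDerivWithinAt (d j) (p x * o j x) (Ici 0) x := by
  cases j with
  | zero =>
    rw [h.o_zero x hx, mul_zero]
    exact (hasDerivWithinAt_const x (Ici 0) d₀).congr h.d_zero (h.d_zero x hx)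
  | succ j =>
    have hi : ContinuousOn (fun x => p x * o (j + 1) x) (Ici 0) :=
      hp.base.1.mul (h.regOn_one hp hq hj).base.1
    exact (hasDerivWithinAt_primitive hi _ hx).congr (h.d_succ j) (h.d_succ j x hx)

lemma integrableOn_mul {j : ℕ} (hj : j ≤ m + 1) :
    IntegrableOn (fun x => p x * o j x) (Ioi 0) :=
  (WeightedL1.mul_contBdd _ _ hp.base
    (h.regOn_one hp hq hj).contBdd_of_weightedL1).integrableOn

lemma contDiffOn_d {j : ℕ} (hj : j ≤ m + 1) : ContDiffOn ℝ 1 (d j) (Ici 0) :=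
  contDiffOn_one_of_hasDerivWithinAt (fun _ hx => h.hasDerivWithinAt_d hp hq hj hx)
    (hp.base.1.mul (h.regOn_one hp hq hj).base.1)

lemma contDiffOn_o {j : ℕ} (hj : j ≤ m + 1) : ContDiffOn ℝ 1 (o j) (Ici 0) := by
  obtain ⟨_, f', hd, hf'⟩ := h.regOn_one hp hq hj
  exact contDiffOn_one_of_hasDerivWithinAt hd hf'.1

lemma tendsto_o {j : ℕ} (hj : j ≤ m + 1) : Tendsto (o j) atTop (𝓝 0) :=
  (h.regOn_one hp hq hj).tendsto_zero

lemma tendsto_d {j : ℕ} (hj : j + 1 ≤ m + 1) :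
    Tendsto (d (j + 1)) atTop
      (𝓝 (d (j + 1) 0 + ∫ y in Ioi (0 : ℝ), p y * o (j + 1) y)) := by
  have := (intervalIntegral_tendsto_integral_Ioi 0 (h.integrableOn_mul hp hq hj)
    tendsto_id).const_add (d (j + 1) 0)
  refine this.congr' ?_
  filter_upwards [eventually_ge_atTop 0] with x hx using (h.d_succ j x hx).symm

lemma weightedL1_residual : WeightedL1 n (residual q o d (m + 1)) := by
  obtain ⟨ho, hd⟩ := h.regOn hp hq (m + 1) 0 rfl
  exact regOn_derivWithin_sub_mul hq (by omega) ho hd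

/-- The truncated formal solution solves the column equations up to the residual. -/
lemma hasDerivWithinAt_sum (hs : s * s = 1) {k : ℂ} (hk : k ≠ 0) {x : ℝ} (hx : 0 ≤ x) :
    HasDerivWithinAt (fun x => ∑ j ∈ Finset.range (m + 1 + 1), 1 / k ^ j * d j x)
      (p x * ∑ j ∈ Finset.range (m + 1 + 1), 1 / k ^ j * o j x) (Ici 0) x ∧
    HasDerivWithinAt (fun x => ∑ j ∈ Finset.range (m + 1 + 1), 1 / k ^ j * o j x)
      (q x * (∑ j ∈ Finset.range (m + 1 + 1), 1 / k ^ j * d j x) -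
        2 * I * (s * k) * (∑ j ∈ Finset.range (m + 1 + 1), 1 / k ^ j * o j x) +
        1 / k ^ (m + 1) * residual q o d (m + 1) x) (Ici 0) x := by
  constructor
  · rw [Finset.mul_sum]
    refine (HasDerivWithinAt.fun_sum fun j hj => (h.hasDerivWithinAt_d hp hq
      (Nat.lt_succ_iff.1 (Finset.mem_range.1 hj)) hx).const_mul (1 / k ^ j)).congr_deriv ?_
    exact Finset.sum_congr rfl fun j _ => by ring
  · refine (HasDerivWithinAt.fun_sum fun j hj => ((h.regOn_one hp hq
      (Nat.lt_succ_iff.1 (Finset.mem_range.1 hj))).hasDerivWithinAt hx).const_mul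
        (1 / k ^ j)).congr_deriv ?_
    have e1 : ∀ j, derivWithin (o j) (Ici 0) x = q x * d j x - 2 * I * s * o (j + 1) x := by
      intro j
      rw [h.o_succ j x hx]
      linear_combination (s * s) * (derivWithin (o j) (Ici 0) x - q x * d j x) * I_mul_I -
        (derivWithin (o j) (Ici 0) x - q x * d j x) * hs
    have e2 : ∑ j ∈ Finset.range (m + 1 + 1), 1 / k ^ j * o j x =
        1 / k * ∑ j ∈ Finset.range (m + 1), 1 / k ^ j * o (j + 1) x := by
      rw [Finset.sum_range_succ', h.o_zero x hx, mul_zero, add_zero, Finset.mul_sum]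
      exact Finset.sum_congr rfl fun j _ => by
        field_simp
        ring
    rw [Finset.sum_range_succ, e2, Finset.sum_range_succ (fun j => 1 / k ^ j * d j x), residual,
      Finset.sum_congr rfl fun j _ => by rw [e1 j]]
    simp only [mul_sub, Finset.sum_sub_distrib]
    have e3 : ∑ j ∈ Finset.range (m + 1), 1 / k ^ j * (q x * d j x) =
        q x * ∑ j ∈ Finset.range (m + 1), 1 / k ^ j * d j x := by
      rw [Finset.mul_sum]
      exact Finset.sum_congr rfl fun j _ => by ring
    have e4 : ∑ j ∈ Finset.range (m + 1), 1 / k ^ j * (2 * I * s * o (j + 1) x) =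
        2 * I * s * ∑ j ∈ Finset.range (m + 1), 1 / k ^ j * o (j + 1) x := by
      rw [Finset.mul_sum]
      exact Finset.sum_congr rfl fun j _ => by ring
    rw [e3, e4]
    field_simp
    ring

end FormalPair

/-- The recursion for an off-diagonal coefficient. -/
def offStep (q : ℝ → ℂ) (s : ℂ) (o d : ℝ → ℂ) (x : ℝ) : ℂ :=
  s * (I / 2) * (derivWithin o (Ici 0) x - q x * d x)

/-- The coefficients `(o_j, d_j)` of the formal column solution normalized at infinity. -/
def formalTail (p q : ℝ → ℂ) (s : ℂ) : ℕ → (ℝ → ℂ) × (ℝ → ℂ)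
  | 0 => (fun _ => 0, fun _ => 1)
  | j + 1 =>
    let o := offStep q s (formalTail p q s j).1 (formalTail p q s j).2
    (o, fun x => -(∫ y in Ioi (0 : ℝ), p y * o y) + ∫ y in (0 : ℝ)..x, p y * o y)

/-- The coefficients `((o_j, d_j), (o'_j, d'_j))` of the two formal column solutions, without and
with the oscillating exponential, whose sum is normalized at zero. -/
def formalHead (p q : ℝ → ℂ) (s : ℂ) : ℕ → ((ℝ → ℂ) × (ℝ → ℂ)) × ((ℝ → ℂ) × (ℝ → ℂ))
  | 0 => ((fun _ => 0, fun _ => 1), (fun _ => 0, fun _ => 0))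
  | j + 1 =>
    let F := formalHead p q s j
    let o := offStep q s F.1.1 F.1.2
    let o' := offStep p (-s) F.2.1 F.2.2
    ((o, fun x => -o' 0 + ∫ y in (0 : ℝ)..x, p y * o y),
      (o', fun x => -o 0 + ∫ y in (0 : ℝ)..x, q y * o' y))

lemma formalPair_formalTail (p q : ℝ → ℂ) (s : ℂ) :
    FormalPair p q s 1 (fun j => (formalTail p q s j).1) (fun j => (formalTail p q s j).2) where
  o_zero _ _ := rfl
  d_zero _ _ := rfl
  o_succ _ _ _ := rfl
  d_succ j x _ := by simp [formalTail]

lemma formalPair_formalHead_fst (p q : ℝ → ℂ) (s : ℂ) :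
    FormalPair p q s 1 (fun j => (formalHead p q s j).1.1) (fun j => (formalHead p q s j).1.2) where
  o_zero _ _ := rfl
  d_zero _ _ := rfl
  o_succ _ _ _ := rfl
  d_succ j x _ := by simp [formalHead]

lemma formalPair_formalHead_snd (p q : ℝ → ℂ) (s : ℂ) :
    FormalPair q p (-s) 0 (fun j => (formalHead p q s j).2.1)
      (fun j => (formalHead p q s j).2.2) where
  o_zero _ _ := rfl
  d_zero _ _ := rfl
  o_succ _ _ _ := rfl
  d_succ j x _ := by simp [formalHead]

lemma formalHead_initial (p q : ℝ → ℂ) (s : ℂ) (j : ℕ) :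
    (formalHead p q s (j + 1)).1.2 0 = -(formalHead p q s (j + 1)).2.1 0 ∧
      (formalHead p q s (j + 1)).2.2 0 = -(formalHead p q s (j + 1)).1.1 0 := by
  simp [formalHead]

lemma tendsto_formalTail {p q : ℝ → ℂ} {m n : ℕ} (hp : RegOn (WeightedL1 n) (m + 1) p)
    (hq : RegOn (WeightedL1 n) (m + 1) q) (s : ℂ) {j : ℕ} (hj : j + 1 ≤ m + 1) :
    Tendsto (formalTail p q s (j + 1)).2 atTop (𝓝 0) := by
  have := (formalPair_formalTail p q s).tendsto_d hp hq hj
  simpa [formalTail] using this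

/-! ### Large spectral parameters -/

section Large

variable {E : Type*} [NormedAddCommGroup E] [NormedSpace ℂ E] {l N : ℕ} {D u : Set ℂ} {b : ℝ}
  {f : ℂ → E} {s : ℂ}

lemma norm_iteratedDerivWithin_inter_open (f : ℂ → E) (i : ℕ) (hu : IsOpen u) {k : ℂ}
    (hk : k ∈ u) : ‖iteratedDerivWithin i f (D ∩ u) k‖ = ‖iteratedDerivWithin i f D k‖ := by
  rw [← norm_iteratedFDerivWithin_eq_norm_iteratedDerivWithin,
    iteratedFDerivWithin_inter_open hu hk,
    norm_iteratedFDerivWithin_eq_norm_iteratedDerivWithin]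

lemma BddDeriv.inter_open (hf : BddDeriv l D b f) (hu : IsOpen u) : BddDeriv l (D ∩ u) b f :=
  ⟨hf.1.mono inter_subset_left, fun i hi k hk => by
    rw [norm_iteratedDerivWithin_inter_open f i hu hk.2]
    exact hf.2 i hi k hk.1⟩

lemma uniqueDiffOn_preimage_sign (hs : s = 1 ∨ s = -1) (hD : UniqueDiffOn ℂ D) :
    UniqueDiffOn ℂ {k | s * k ∈ D} := by
  rcases hs with rfl | rfl
  · simpa using hD
  · have : {k : ℂ | -1 * k ∈ D} = ContinuousLinearEquiv.neg ℂ (M := ℂ) ⁻¹' D := by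
      ext k
      simp
    rw [this]
    exact (ContinuousLinearEquiv.uniqueDiffOn_preimage_iff _).2 hD

lemma BddDeriv.comp_sign (hf : BddDeriv l D b f) (hs : s = 1 ∨ s = -1) (hD : UniqueDiffOn ℂ D) :
    BddDeriv l {k | s * k ∈ D} b fun k => f (s * k) := by
  refine ⟨hf.1.comp (contDiff_const.mul contDiff_id).contDiffOn fun k hk => hk,
    fun i hi k hk => ?_⟩
  have hk : s * k ∈ D := hk
  rcases hs with rfl | rfl
  · simp only [one_mul, ofPred_mem_eq] at hk ⊢
    exact hf.2 i hi k hk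
  · have h1 : {k : ℂ | -1 * k ∈ D} = LinearIsometryEquiv.neg ℂ (E := ℂ) ⁻¹' D := by
      ext k
      simp
    have h2 : (fun k : ℂ => f (-1 * k)) = f ∘ LinearIsometryEquiv.neg ℂ (E := ℂ) := by
      ext k
      simp
    rw [neg_one_mul] at hk
    rw [← norm_iteratedFDerivWithin_eq_norm_iteratedDerivWithin, h1, h2,
      LinearIsometryEquiv.norm_iteratedFDerivWithin_comp_right _ _ hD (by simpa using hk),
      norm_iteratedFDerivWithin_eq_norm_iteratedDerivWithin]
    exact hf.2 i hi (-k) hk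

lemma differentiableAt_one_div_pow (N : ℕ) {k : ℂ} (hk : k ≠ 0) :
    DifferentiableAt ℂ (fun z : ℂ => 1 / z ^ N) k :=
  DifferentiableAt.div (by fun_prop) (by fun_prop) (pow_ne_zero _ hk)

/-- Cauchy's estimate on the disc of radius `1` about `w`: since `4 < ‖k‖` and `‖w - k‖ ≤ 1`, its
points have modulus at least `‖k‖ / 2`. -/
lemma norm_iteratedDeriv_one_div_pow_le (N i : ℕ) {k w : ℂ} (hk : 4 < ‖k‖) (hw : ‖w - k‖ ≤ 1) :
    ‖iteratedDeriv i (fun z : ℂ => 1 / z ^ N) w‖ ≤ i.factorial * (2 ^ N / ‖k‖ ^ N) := by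
  have hz : ∀ z ∈ Metric.closedBall w 1, ‖k‖ / 2 ≤ ‖z‖ := fun z hz => by
    have h1 : ‖z - w‖ ≤ 1 := by rwa [Metric.mem_closedBall, dist_eq_norm] at hz
    have h2 : ‖k‖ ≤ ‖z‖ + ‖z - w‖ + ‖w - k‖ := by
      calc ‖k‖ = ‖z - (z - w) - (w - k)‖ := by congr 1; ring
        _ ≤ _ := (norm_sub_le _ _).trans (add_le_add (norm_sub_le _ _) le_rfl)
    linarith
  have h := norm_iteratedDeriv_le_of_forall_mem_sphere_norm_le (f := fun z : ℂ => 1 / z ^ N)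
    (c := w) (C := 2 ^ N / ‖k‖ ^ N) i one_pos ?_ fun z hz' => ?_
  · simpa using h
  · refine DifferentiableOn.diffContOnCl fun z hz' => ?_
    rw [closure_ball _ one_ne_zero] at hz'
    have : z ≠ 0 := norm_pos_iff.1 (by linarith [hz z hz'])
    exact (differentiableAt_one_div_pow N this).differentiableWithinAt
  · have := hz z (Metric.sphere_subset_closedBall hz')
    rw [norm_div, norm_one, norm_pow, div_le_div_iff₀ (pow_pos (by linarith) _)
      (pow_pos (by linarith) _), one_mul, ← mul_pow]
    exact pow_le_pow_left₀ (norm_nonneg _) (by linarith) _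

/-- A function `k^{-N} G(k)` has derivatives of order `|k|^{-N}` for large `k` if those of `G` are
bounded. -/
lemma norm_iteratedDerivWithin_le_of_eq_one_div_pow_smul (hD : UniqueDiffOn ℂ D)
    {F G : ℂ → E} (hG : BddDeriv l D b G) (hF : ∀ k ∈ D, k ≠ 0 → F k = (1 / k ^ N) • G k)
    {k : ℂ} (hkD : k ∈ D) (hk : 4 < ‖k‖) :
    ‖iteratedDerivWithin l F D k‖ ≤ 2 ^ l * (l.factorial * 2 ^ N * b) / ‖k‖ ^ N := by
  have hb : 0 ≤ b := (norm_nonneg _).trans (hG.2 0 (Nat.zero_le _) k hkD)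
  set u := Metric.ball k 1
  have hu : IsOpen u := Metric.isOpen_ball
  have hku : k ∈ u := Metric.mem_ball_self one_pos
  have hDu : UniqueDiffOn ℂ (D ∩ u) := hD.inter hu
  have hne : ∀ w ∈ u, w ≠ 0 := fun w hw => by
    rintro rfl
    have : ‖(0 : ℂ) - k‖ < 1 := by rw [← dist_eq_norm]; exact hw
    rw [zero_sub, norm_neg] at this
    linarith
  have hcd : ∀ w ∈ u, ∀ i : ℕ, ContDiffAt ℂ i (fun z : ℂ => 1 / z ^ N) w := fun w hw i =>
    contDiffAt_const.div (contDiffAt_id.pow N) (pow_ne_zero _ (hne w hw))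
  have h1 : BddDeriv l (D ∩ u) (l.factorial * (2 ^ N / ‖k‖ ^ N)) fun z : ℂ => 1 / z ^ N := by
    refine ⟨fun w hw => (hcd w hw.2 l).contDiffWithinAt, fun i hi w hw => ?_⟩
    rw [iteratedDerivWithin_eq_iteratedDeriv hDu (hcd w hw.2 i) hw]
    have hwk : ‖w - k‖ ≤ 1 := by rw [← dist_eq_norm]; exact (Metric.mem_ball.1 hw.2).le
    refine (norm_iteratedDeriv_one_div_pow_le N i hk hwk).trans ?_
    gcongr
  have h2 := (h1.bilinear hDu (by positivity) (ContinuousLinearMap.lsmul ℂ ℂ)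
    (hG.inter_open hu)).congr (f' := F) fun w hw => hF w hw.1 (hne w hw.2)
  rw [← norm_iteratedDerivWithin_inter_open F l hu hku]
  refine (h2.2 l le_rfl k ⟨hkD, hku⟩).trans ?_
  have h3 : ‖(ContinuousLinearMap.lsmul ℂ ℂ : ℂ →L[ℂ] E →L[ℂ] E)‖ ≤ 1 :=
    ContinuousLinearMap.opNorm_lsmul_le
  calc _ ≤ 1 * (2 ^ l * (l.factorial * (2 ^ N / ‖k‖ ^ N) * b)) := by gcongr
    _ = _ := by ring

/-- Cauchy's estimate on the disc of radius `1 / (1 + x)`: a bound in the strip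
`σ Im z ≤ 1 / (1 + x)` costs a factor `1 + x` for each derivative in `σ Im k ≤ 0`. -/
lemma norm_iteratedDeriv_le_of_strip [CompleteSpace E] {F : ℂ → E} {σ x : ℝ}
    (hσ : σ = 1 ∨ σ = -1) (hx : 0 ≤ x) (hF : ∀ z ≠ 0, DifferentiableAt ℂ F z)
    (hb : ∀ z ≠ 0, σ * z.im ≤ 1 / (1 + x) → ‖F z‖ ≤ b / ‖z‖ ^ N) (hb0 : 0 ≤ b) (j : ℕ) {k : ℂ}
    (hk : 2 < ‖k‖) (hkσ : σ * k.im ≤ 0) :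
    ‖iteratedDeriv j F k‖ ≤ j.factorial * 2 ^ N * b * (1 + x) ^ j / ‖k‖ ^ N := by
  have hx1 : 0 < 1 + x := by linarith
  have hr : 0 < 1 / (1 + x) := by positivity
  have hr1 : 1 / (1 + x) ≤ 1 := by rw [div_le_one hx1]; linarith
  have hz : ∀ z ∈ Metric.closedBall k (1 / (1 + x)), ‖k‖ / 2 ≤ ‖z‖ ∧ σ * z.im ≤ 1 / (1 + x) :=
    fun z hz => by
      have h1 : ‖z - k‖ ≤ 1 / (1 + x) := by rwa [Metric.mem_closedBall, dist_eq_norm] at hz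
      constructor
      · have h2 : ‖k‖ ≤ ‖z‖ + ‖z - k‖ := by
          calc ‖k‖ = ‖z - (z - k)‖ := by congr 1; ring
            _ ≤ _ := norm_sub_le _ _
        linarith
      · have h3 := (abs_im_le_norm (z - k)).trans h1
        rw [sub_im, abs_le] at h3
        rcases hσ with rfl | rfl <;> linarith
  have h := norm_iteratedDeriv_le_of_forall_mem_sphere_norm_le (f := F)
    (c := k) (C := b * 2 ^ N / ‖k‖ ^ N) j hr ?_ fun z hz' => ?_
  · refine h.trans (le_of_eq ?_)
    rw [div_pow, one_pow]
    field_simp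
  · refine DifferentiableOn.diffContOnCl fun z hz' => ?_
    rw [closure_ball _ hr.ne'] at hz'
    exact (hF z (norm_pos_iff.1 (by linarith [(hz z hz').1]))).differentiableWithinAt
  · obtain ⟨h1, h2⟩ := hz z (Metric.sphere_subset_closedBall hz')
    have hz0 : 0 < ‖z‖ := by linarith
    refine (hb z (norm_pos_iff.1 hz0) h2).trans ?_
    rw [div_le_div_iff₀ (pow_pos hz0 _) (pow_pos (by linarith) _), mul_assoc, ← mul_pow]
    gcongr
    linarith

end Large

/-! ### Errors of the truncated formal solutions -/

section Errors

variable {p q : ℝ → ℂ} {s : ℂ} {m n : ℕ}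

/-- The partial sum `a_0 + a_1(x)/k + ⋯ + a_N(x)/k^N`. -/
def truncSum (N : ℕ) (a : ℕ → ℝ → ℂ) (x : ℝ) (k : ℂ) : ℂ :=
  ∑ j ∈ Finset.range (N + 1), 1 / k ^ j * a j x

lemma differentiableAt_truncSum (N : ℕ) (a : ℕ → ℝ → ℂ) (x : ℝ) {k : ℂ} (hk : k ≠ 0) :
    DifferentiableAt ℂ (truncSum N a x) k := by
  refine DifferentiableAt.fun_sum fun j _ => ?_
  exact (differentiableAt_one_div_pow j hk).mul_const _

lemma tendsto_truncSum {N : ℕ} {a : ℕ → ℝ → ℂ} {L : ℂ} (h0 : Tendsto (a 0) atTop (𝓝 L))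
    (h : ∀ j < N, Tendsto (a (j + 1)) atTop (𝓝 0)) (k : ℂ) :
    Tendsto (fun x => truncSum N a x k) atTop (𝓝 L) := by
  have h1 : Tendsto (fun x => ∑ j ∈ Finset.range N, 1 / k ^ (j + 1) * a (j + 1) x) atTop
      (𝓝 (∑ j ∈ Finset.range N, 1 / k ^ (j + 1) * 0)) :=
    tendsto_finsetSum _ fun j hj => (h j (Finset.mem_range.1 hj)).const_mul _
  have h2 := h1.add (h0.const_mul (1 / k ^ 0))
  simp only [mul_zero, Finset.sum_const_zero, pow_zero, div_one, one_mul, zero_add] at h2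
  refine h2.congr fun x => ?_
  rw [truncSum, Finset.sum_range_succ']
  simp

variable (hp : IsPotential n p) (hq : IsPotential n q)
  (hpr : RegOn (WeightedL1 n) (m + 1) p) (hqr : RegOn (WeightedL1 n) (m + 1) q)
include hp hq hpr hqr

/-- The error of the truncated formal solution normalized at infinity is `k^{-(m+1)}` times the
solution of the column equations with the residual as inhomogeneity. -/
lemma tail_sub_truncSum_eq (hs : s * s = 1) {k : ℂ} (hk : k ≠ 0) (hκ : s * k ∈ closedUpper) {x : ℝ}
    (hx : 0 ≤ x) {ρ : ℝ → ℂ} (hρ : ρ = residual q (fun j => (formalTail p q s j).1)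
      (fun j => (formalTail p q s j).2) (m + 1)) :
    tailFst p q (s * k) x - truncSum (m + 1) (fun j => (formalTail p q s j).2) x k =
        1 / k ^ (m + 1) * tailErrFst x p q ρ (s * k) x ∧
      tailSnd p q (s * k) x - truncSum (m + 1) (fun j => (formalTail p q s j).1) x k =
        1 / k ^ (m + 1) * tailErrSnd x p q ρ (s * k) x := by
  have hF := formalPair_formalTail p q s
  have hS := solvesTail_tailFst hp hq hκ
  have hr := hF.weightedL1_residual hpr hqr
  rw [← hρ] at hr
  refine eq_tailErr (f := fun x => tailFst p q (s * k) x -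
      truncSum (m + 1) (fun j => (formalTail p q s j).2) x k)
    (g := fun x => tailSnd p q (s * k) x -
      truncSum (m + 1) (fun j => (formalTail p q s j).1) x k) hp hq hκ hr.1 hr.2 (1 / k ^ (m + 1))
    (fun x hx => ?_) (fun x hx => ?_) ?_ ?_ hx
  · exact ((hS.hasDerivWithinAt_fst hp hq hκ hx).sub
      (hF.hasDerivWithinAt_sum hpr hqr hs hk hx).1).congr_deriv (by rw [truncSum]; ring)
  · exact ((hS.hasDerivWithinAt_snd hp hq hκ hx).sub
      (hF.hasDerivWithinAt_sum hpr hqr hs hk hx).2).congr_deriv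
        (by rw [hρ, truncSum, truncSum]; ring)
  · have := hS.tendsto_fst.sub (tendsto_truncSum (N := m + 1) (a := fun j => (formalTail p q s j).2)
      (L := 1) tendsto_const_nhds (fun j hj => tendsto_formalTail hpr hqr s (by omega)) k)
    rwa [sub_self] at this
  · have := (hS.tendsto_snd hq hκ).sub (tendsto_truncSum (N := m + 1)
      (a := fun j => (formalTail p q s j).1) (L := 0) tendsto_const_nhds
      (fun j hj => hF.tendsto_o hpr hqr (by omega)) k)
    rwa [sub_self] at this

omit hp hq hpr hqr

/-- The first component of the error of the truncated formal solution normalized at zero. -/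
def headErrFst (p q : ℝ → ℂ) (s : ℂ) (N : ℕ) (x : ℝ) (z : ℂ) : ℂ :=
  headFst p q x (s * z) - truncSum N (fun j => (formalHead p q s j).1.2) x z -
    exp (-(2 * I * (s * z) * x)) * truncSum N (fun j => (formalHead p q s j).2.1) x z

/-- The second component of the error of the truncated formal solution normalized at zero. -/
def headErrSnd (p q : ℝ → ℂ) (s : ℂ) (N : ℕ) (x : ℝ) (z : ℂ) : ℂ :=
  headSnd p q x (s * z) - truncSum N (fun j => (formalHead p q s j).1.1) x z -
    exp (-(2 * I * (s * z) * x)) * truncSum N (fun j => (formalHead p q s j).2.2) x z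

lemma differentiableAt_headErr (hp : Continuous p) (hq : Continuous q) (s : ℂ) (N : ℕ) {x : ℝ}
    (hx : 0 ≤ x) {z : ℂ} (hz : z ≠ 0) : DifferentiableAt ℂ (headErrFst p q s N x) z ∧
      DifferentiableAt ℂ (headErrSnd p q s N x) z := by
  have hm : Differentiable ℂ fun z : ℂ => s * z := by fun_prop
  have he : DifferentiableAt ℂ (fun z : ℂ => exp (-(2 * I * (s * z) * x))) z := by fun_prop
  have h1 : DifferentiableAt ℂ (fun z => headFst p q x (s * z)) z :=
    ((differentiable_headFst hp hq hx).comp hm).differentiableAt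
  have h2 : DifferentiableAt ℂ (fun z => headSnd p q x (s * z)) z :=
    ((differentiable_headSnd hp hq hx).comp hm).differentiableAt
  exact ⟨(h1.sub (differentiableAt_truncSum N _ x hz)).sub
      (he.mul (differentiableAt_truncSum N _ x hz)),
    (h2.sub (differentiableAt_truncSum N _ x hz)).sub
      (he.mul (differentiableAt_truncSum N _ x hz))⟩

lemma norm_exp_le_exp_two {κ : ℂ} {x y : ℝ} (hκ : -κ.im ≤ 1 / (1 + x)) (hy : y ∈ Icc 0 x) :
    ‖exp (2 * I * κ * y)‖ ≤ Real.exp 2 := by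
  rw [norm_exp, Real.exp_le_exp]
  have e : (2 * I * κ * y).re = 2 * (-κ.im * y) := by
    simp
    ring
  have h0 : 0 ≤ y := hy.1
  have hx : 0 < 1 + x := by linarith [hy.2]
  have h1 : -κ.im * y ≤ 1 / (1 + x) * y := by gcongr
  have h2 : 1 / (1 + x) * y ≤ 1 := by
    rw [one_div_mul_eq_div, div_le_one hx]
    linarith [hy.2]
  rw [e]
  linarith

lemma integral_norm_mul_le {w ρ : ℝ → ℂ} {R M : ℝ} (hw : ∀ y ∈ Icc 0 R, ‖w y‖ ≤ M)
    (hM : 0 ≤ M) (hρ : IntegrableOn ρ (Ioi 0)) :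
    ∫ y in Ioc 0 R, ‖w y * ρ y‖ ≤ M * ∫ y in Ioi (0 : ℝ), ‖ρ y‖ := by
  have hi : IntegrableOn (fun y => M * ‖ρ y‖) (Ioi 0) := hρ.norm.const_mul M
  calc ∫ y in Ioc 0 R, ‖w y * ρ y‖ ≤ ∫ y in Ioc 0 R, M * ‖ρ y‖ := by
        refine integral_mono_of_nonneg (.of_forall fun _ => norm_nonneg _)
          (hi.mono_set Ioc_subset_Ioi_self) ?_
        filter_upwards [ae_restrict_mem measurableSet_Ioc] with y hy
        rw [norm_mul]
        exact mul_le_mul_of_nonneg_right (hw y ⟨hy.1.le, hy.2⟩) (norm_nonneg _)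
    _ ≤ ∫ y in Ioi (0 : ℝ), M * ‖ρ y‖ := setIntegral_mono_set hi
        (.of_forall fun _ => mul_nonneg hM (norm_nonneg _)) Ioc_subset_Ioi_self.eventuallyLE
    _ = _ := integral_const_mul _ _

lemma hasDerivAt_exp_two_mul (κ : ℂ) (x : ℝ) :
    HasDerivAt (fun x : ℝ => exp (2 * I * κ * x)) (2 * I * κ * exp (2 * I * κ * x)) x := by
  have h1 : HasDerivAt (fun x : ℝ => 2 * I * κ * (x : ℂ)) (2 * I * κ) x := by
    have := (hasDerivAt_id x).ofReal_comp.const_mul (2 * I * κ)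
    simpa using this
  exact h1.cexp.congr_deriv (mul_comm _ _)

lemma headErr_zero (p q : ℝ → ℂ) (s : ℂ) (N : ℕ) (z : ℂ) (hp : Continuous p) (hq : Continuous q) :
    headErrFst p q s N 0 z = 0 ∧ headErrSnd p q s N 0 z = 0 := by
  obtain ⟨-, h1, -, h2⟩ := solvesHead_head hp hq (s * z) le_rfl
  simp only [intervalIntegral.integral_same, add_zero] at h1 h2
  have e : ∀ a b : ℕ → ℝ → ℂ, (∀ j, a (j + 1) 0 = -b (j + 1) 0) →
      truncSum N a 0 z + truncSum N b 0 z = a 0 0 + b 0 0 := fun a b h => by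
    rw [truncSum, truncSum, ← Finset.sum_add_distrib, Finset.sum_range_succ',
      Finset.sum_eq_zero fun j _ => by rw [h j]; ring]
    simp
  have e1 := e (fun j => (formalHead p q s j).1.2) (fun j => (formalHead p q s j).2.1)
    fun j => (formalHead_initial p q s j).1
  have e2 := e (fun j => (formalHead p q s j).2.2) (fun j => (formalHead p q s j).1.1)
    fun j => (formalHead_initial p q s j).2
  simp only [formalHead] at e1 e2
  simp only [headErrFst, headErrSnd, h1, h2, ofReal_zero, mul_zero, neg_zero, Complex.exp_zero,
    one_mul]
  exact ⟨by linear_combination -e1, by linear_combination -e2⟩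

include hp hq hpr hqr

/-- The two halves of the formal solution contribute one residual each; that of the half multiplied
by `e^{-2iκx}` keeps this factor, and enters the first equation since the roles of the components
are exchanged there. -/
lemma hasDerivWithinAt_headErr (hs : s * s = 1) {z : ℂ} (hz : z ≠ 0) {x : ℝ} (hx : 0 ≤ x) :
    HasDerivWithinAt (fun x => headErrFst p q s (m + 1) x z)
      (p x * headErrSnd p q s (m + 1) x z + -(exp (-(2 * I * (s * z) * x)) * (1 / z ^ (m + 1) *
        residual p (fun j => (formalHead p q s j).2.1) (fun j => (formalHead p q s j).2.2)
          (m + 1) x))) (Ici 0) x ∧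
    HasDerivWithinAt (fun x => headErrSnd p q s (m + 1) x z)
      (q x * headErrFst p q s (m + 1) x z - 2 * I * (s * z) * headErrSnd p q s (m + 1) x z +
        -(1 / z ^ (m + 1) * residual q (fun j => (formalHead p q s j).1.1)
          (fun j => (formalHead p q s j).1.2) (m + 1) x)) (Ici 0) x := by
  have hZ := (formalPair_formalHead_fst p q s).hasDerivWithinAt_sum hpr hqr hs hz hx
  have hW := (formalPair_formalHead_snd p q s).hasDerivWithinAt_sum hqr hpr
    (by rw [neg_mul_neg, hs]) hz hx
  have h1 := hasDerivWithinAt_headFst hp.1 hq.1 (s * z) hx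
  have h2 := hasDerivWithinAt_headSnd hp.1 hq.1 (s * z) hx
  have hE := (hasDerivAt_exp_two_mul (-(s * z)) x).hasDerivWithinAt (s := Ici 0)
  have ee : ∀ x : ℝ, exp (2 * I * -(s * z) * x) = exp (-(2 * I * (s * z) * x)) := fun x => by
    congr 1
    ring
  simp only [ee] at hE
  constructor
  · refine ((h1.sub hZ.1).sub (hE.mul hW.2)).congr_deriv ?_
    simp only [headErrSnd, truncSum]
    ring
  · refine ((h2.sub hZ.2).sub (hE.mul hW.1)).congr_deriv ?_
    simp only [headErrFst, headErrSnd, truncSum]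
    ring

/-- Bounds for the error of the truncated formal solution normalized at zero, in a strip of
width `1 / (1 + x)` around the half-plane where the solution is bounded. -/
lemma exists_headErr_le (hs : s * s = 1) : ∃ C, 0 ≤ C ∧ ∀ x : ℝ, 0 ≤ x → ∀ z : ℂ, z ≠ 0 →
    ((s * z).im ≤ 1 / (1 + x) → ‖headErrFst p q s (m + 1) x z‖ ≤ C / ‖z‖ ^ (m + 1) ∧
      ‖headErrSnd p q s (m + 1) x z‖ ≤ C / ‖z‖ ^ (m + 1)) ∧
    (-(s * z).im ≤ 1 / (1 + x) →
      ‖exp (2 * I * (s * z) * x) * headErrFst p q s (m + 1) x z‖ ≤ C / ‖z‖ ^ (m + 1) ∧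
      ‖exp (2 * I * (s * z) * x) * headErrSnd p q s (m + 1) x z‖ ≤ C / ‖z‖ ^ (m + 1)) := by
  set ρ := residual q (fun j => (formalHead p q s j).1.1) (fun j => (formalHead p q s j).1.2)
    (m + 1) with hρ
  set ρ' := residual p (fun j => (formalHead p q s j).2.1) (fun j => (formalHead p q s j).2.2)
    (m + 1) with hρ'
  have hρw : WeightedL1 n ρ := (formalPair_formalHead_fst p q s).weightedL1_residual hpr hqr
  have hρw' : WeightedL1 n ρ' := (formalPair_formalHead_snd p q s).weightedL1_residual hqr hpr
  set M := Real.exp 2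
  have hM : 0 < M := Real.exp_pos 2
  set P := ∫ y in Ioi (0 : ℝ), ‖p y‖
  set Q := ∫ y in Ioi (0 : ℝ), ‖q y‖
  set V := ∫ y in Ioi (0 : ℝ), ‖ρ y‖
  set V' := ∫ y in Ioi (0 : ℝ), ‖ρ' y‖
  have hP0 : 0 ≤ P := integral_nonneg fun _ => norm_nonneg _
  have hQ0 : 0 ≤ Q := integral_nonneg fun _ => norm_nonneg _
  have hV0 : 0 ≤ V := integral_nonneg fun _ => norm_nonneg _
  have hV0' : 0 ≤ V' := integral_nonneg fun _ => norm_nonneg _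
  have le_of : ∀ {h : ℝ → ℂ} (R : ℝ), IntegrableOn h (Ioi 0) →
      ∫ y in Ioc 0 R, ‖h y‖ ≤ ∫ y in Ioi (0 : ℝ), ‖h y‖ := fun R hi =>
    setIntegral_mono_set hi.norm (.of_forall fun _ => norm_nonneg _)
      Ioc_subset_Ioi_self.eventuallyLE
  have hpi : IntegrableOn p (Ioi 0) := hpr.base.integrableOn
  have hqi : IntegrableOn q (Ioi 0) := hqr.base.integrableOn
  -- the constants produced by the stability estimate with the roles of `p` and `q` as given
  set C₁ := Real.exp (M * Q * P) * (M * V' + P * (M * V)) with hC₁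
  set C₂ := Real.exp (M * P * Q) * (M * V + Q * (M * V')) with hC₂
  have hC₁0 : 0 ≤ C₁ := by positivity
  have hC₂0 : 0 ≤ C₂ := by positivity
  refine ⟨C₁ + (M * Q * C₁ + M * V) + (C₂ + (M * P * C₂ + M * V')), by positivity,
    fun x hx z hz => ?_⟩
  set c : ℂ := 1 / z ^ (m + 1) with hc
  have hcn : ‖c‖ = 1 / ‖z‖ ^ (m + 1) := by rw [hc, norm_div, norm_one, norm_pow]
  have hc0 : 0 ≤ ‖c‖ := norm_nonneg c
  obtain ⟨z1, z2⟩ := headErr_zero p q s (m + 1) z hp.1 hq.1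
  have hd := fun (x : ℝ) (hx : 0 ≤ x) =>
    hasDerivWithinAt_headErr hp hq hpr hqr (m := m) hs hz hx
  simp only [← hρ, ← hρ', ← hc] at hd
  have hexp : ∀ κ : ℂ, Continuous fun y : ℝ => exp (2 * I * κ * y) := fun κ => by fun_prop
  have hV : ∀ w : ℝ → ℂ, (∀ y ∈ Icc 0 x, ‖w y‖ ≤ M) → ∀ h : ℝ → ℂ, IntegrableOn h (Ioi 0) →
      ∫ y in Ioc 0 x, ‖-(w y * (c * h y))‖ ≤ M * (∫ y in Ioi (0 : ℝ), ‖h y‖) * ‖c‖ := by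
    intro w hw h hi
    have := integral_norm_mul_le (R := x) hw hM.le (hi.const_mul c)
    simp only [norm_mul c, integral_const_mul] at this
    simp only [norm_neg]
    linarith
  have hV1 : ∀ h : ℝ → ℂ, IntegrableOn h (Ioi 0) →
      M * ∫ y in Ioc 0 x, ‖-(c * h y)‖ ≤ M * (∫ y in Ioi (0 : ℝ), ‖h y‖) * ‖c‖ := by
    intro h hi
    have := integral_norm_mul_le (R := x) (w := fun _ => c) (fun _ _ => le_rfl) hc0 hi
    simp only [norm_neg]
    calc _ ≤ M * (‖c‖ * ∫ y in Ioi (0 : ℝ), ‖h y‖) := by gcongr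
      _ = _ := by ring
  rw [div_eq_mul_one_div _ (‖z‖ ^ (m + 1)), ← hcn]
  constructor
  · intro hκ
    have hMb : ∀ y ∈ Icc 0 x, ‖exp (2 * I * -(s * z) * (y : ℝ))‖ ≤ M := fun y hy =>
      norm_exp_le_exp_two (by rwa [neg_im, neg_neg]) hy
    obtain ⟨b1, b2⟩ := norm_le_of_hasDerivWithinAt_head hp.1 hq.1 hx hMb
      (f := fun x => headErrFst p q s (m + 1) x z) (g := fun x => headErrSnd p q s (m + 1) x z)
      (α := fun y => -(exp (2 * I * -(s * z) * (y : ℝ)) * (c * ρ' y)))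
      (β := fun y => -(c * ρ y)) (A := M * V' * ‖c‖) (B := M * V * ‖c‖) (P := P) (Q := M * Q)
      ((hexp _).continuousOn.mul (continuousOn_const.mul hρw'.1)).neg
      (continuousOn_const.mul hρw.1).neg
      (fun x hx => (hd x hx).1.congr_deriv (by
        rw [show -(2 * I * (s * z) * (x : ℂ)) = 2 * I * -(s * z) * x by ring]))
      (fun x hx => (hd x hx).2.congr_deriv (by ring)) z1 z2
      (hV _ hMb _ hρw'.integrableOn) (hV1 _ hρw.integrableOn) (le_of x hpi)
      (mul_le_mul_of_nonneg_left (le_of x hqi) hM.le)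
    have e : Real.exp (M * Q * P) * (M * V' * ‖c‖ + P * (M * V * ‖c‖)) = C₁ * ‖c‖ := by
      rw [hC₁]; ring
    rw [e] at b1 b2
    constructor
    · refine b1.trans (mul_le_mul_of_nonneg_right ?_ hc0)
      have : 0 ≤ M * Q * C₁ + M * V + (C₂ + (M * P * C₂ + M * V')) := by positivity
      linarith
    · refine b2.trans ?_
      have : 0 ≤ C₁ + (C₂ + (M * P * C₂ + M * V')) := by positivity
      have := mul_nonneg this hc0
      linarith
  · intro hκ
    have hMb : ∀ y ∈ Icc 0 x, ‖exp (2 * I * (s * z) * (y : ℝ))‖ ≤ M := fun y hy =>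
      norm_exp_le_exp_two hκ hy
    have ee : ∀ y : ℝ, exp (2 * I * (s * z) * y) * exp (-(2 * I * (s * z) * y)) = 1 := fun y => by
      rw [← Complex.exp_add, add_neg_cancel, Complex.exp_zero]
    obtain ⟨b1, b2⟩ := norm_le_of_hasDerivWithinAt_head hq.1 hp.1 hx hMb
      (f := fun x => exp (2 * I * (s * z) * (x : ℝ)) * headErrSnd p q s (m + 1) x z)
      (g := fun x => exp (2 * I * (s * z) * (x : ℝ)) * headErrFst p q s (m + 1) x z)
      (α := fun y => -(exp (2 * I * (s * z) * (y : ℝ)) * (c * ρ y)))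
      (β := fun y => -(c * ρ' y)) (A := M * V * ‖c‖) (B := M * V' * ‖c‖) (P := Q) (Q := M * P)
      ((hexp _).continuousOn.mul (continuousOn_const.mul hρw.1)).neg
      (continuousOn_const.mul hρw'.1).neg
      (fun x hx => ((hasDerivAt_exp_two_mul (s * z) x).hasDerivWithinAt.mul
        (hd x hx).2).congr_deriv (by ring))
      (fun x hx => ((hasDerivAt_exp_two_mul (s * z) x).hasDerivWithinAt.mul
        (hd x hx).1).congr_deriv (by linear_combination (-(c * ρ' x)) * ee x))
      (by simp only [z2, mul_zero]) (by simp only [z1, mul_zero])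
      (hV _ hMb _ hρw.integrableOn) (hV1 _ hρw'.integrableOn) (le_of x hqi)
      (mul_le_mul_of_nonneg_left (le_of x hpi) hM.le)
    have e : Real.exp (M * P * Q) * (M * V * ‖c‖ + Q * (M * V' * ‖c‖)) = C₂ * ‖c‖ := by
      rw [hC₂]; ring
    rw [e] at b1 b2
    constructor
    · refine b2.trans ?_
      have : 0 ≤ C₁ + (M * Q * C₁ + M * V) + C₂ := by positivity
      have := mul_nonneg this hc0
      linarith
    · refine b1.trans (mul_le_mul_of_nonneg_right ?_ hc0)
      have : 0 ≤ C₁ + (M * Q * C₁ + M * V) + (M * P * C₂ + M * V') := by positivity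
      linarith

end Errors

/-! ### Columns of matrices -/

section Columns

variable {lam : ℝ} {u : ℝ → ℝ} {m n : ℕ}

/-- The diagonal entries of `σ₃`. -/
def colSign (c : Fin 2) : ℝ := if c = 0 then 1 else -1

/-- The entries of the potential matrix, extended to the real line by their values at `0`. -/
def potExt (lam : ℝ) (u : ℝ → ℝ) (a b : Fin 2) (x : ℝ) : ℂ := potU lam u (max x 0) a b

/-- The matrix with diagonal entries `f c` and off-diagonal entries `g c` in the columns `c`. -/
def colMat (f g : Fin 2 → ℂ) : Mat := Matrix.of fun a c => if a = c then f c else g c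

@[simp] lemma colMat_diag (f g : Fin 2 → ℂ) (c : Fin 2) : colMat f g c c = f c := by simp [colMat]

@[simp] lemma colMat_off (f g : Fin 2 → ℂ) (c : Fin 2) : colMat f g (c + 1) c = g c := by
  simp [colMat]

lemma forall_fin_two_iff_add_one {P : Fin 2 → Prop} (c : Fin 2) : (∀ a, P a) ↔ P c ∧ P (c + 1) := by
  fin_cases c
  · simp [Fin.forall_fin_two]
  · simp [Fin.forall_fin_two, and_comm]

lemma mat_ext_iff {A B : Mat} : A = B ↔ ∀ c, A c c = B c c ∧ A (c + 1) c = B (c + 1) c := by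
  rw [← Matrix.ext_iff, forall_comm]
  exact forall_congr' fun c => forall_fin_two_iff_add_one c

lemma one_off (c : Fin 2) : (1 : Mat) (c + 1) c = 0 := by
  rw [Matrix.one_apply_ne]
  simp

lemma colSign_eq (c : Fin 2) : colSign c = 1 ∨ colSign c = -1 := by
  fin_cases c <;> simp [colSign]

lemma colSign_eq' (c : Fin 2) : (colSign c : ℂ) = 1 ∨ (colSign c : ℂ) = -1 := by
  fin_cases c <;> simp [colSign]

lemma colSign_mul_self (c : Fin 2) : (colSign c : ℂ) * colSign c = 1 := by
  fin_cases c <;> simp [colSign]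

lemma domUL_eq (c : Fin 2) : domUL c = {k | (colSign c : ℂ) * k ∈ closedUpper} := by
  ext k
  fin_cases c <;> simp [domUL, colSign, closedUpper, closedLower]

lemma mem_domUL_iff {c : Fin 2} {k : ℂ} : k ∈ domUL c ↔ (colSign c : ℂ) * k ∈ closedUpper := by
  rw [domUL_eq]
  rfl

lemma mem_domUL_iff_im {c : Fin 2} {k : ℂ} : k ∈ domUL c ↔ -colSign c * k.im ≤ 0 := by
  fin_cases c <;> simp [domUL, colSign, closedUpper, closedLower]

lemma mem_domLU_iff_im {c : Fin 2} {k : ℂ} : k ∈ domLU c ↔ colSign c * k.im ≤ 0 := by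
  fin_cases c <;> simp [domLU, colSign, closedUpper, closedLower]

lemma potExt_of_nonneg (lam : ℝ) (u : ℝ → ℝ) (a b : Fin 2) {x : ℝ} (hx : 0 ≤ x) :
    potExt lam u a b x = potU lam u x a b := by
  rw [potExt, max_eq_left hx]

lemma add_one_add_one (c : Fin 2) : c + 1 + 1 = c := by fin_cases c <;> rfl

lemma colSign_add_one (c : Fin 2) : (colSign (c + 1) : ℂ) = -colSign c := by
  fin_cases c <;> simp [colSign]

lemma sigma3_mul_apply (A : Mat) (a b : Fin 2) : (sigma3 * A) a b = colSign a * A a b := by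
  rw [Matrix.mul_apply, Fin.sum_univ_two]
  fin_cases a <;> simp [sigma3, colSign]

lemma mul_sigma3_apply (A : Mat) (a b : Fin 2) : (A * sigma3) a b = A a b * colSign b := by
  rw [Matrix.mul_apply, Fin.sum_univ_two]
  fin_cases b <;> simp [sigma3, colSign]

lemma expSigma3_mul_apply (z : ℂ) (A : Mat) (a b : Fin 2) :
    (expSigma3 z * A) a b = exp (colSign a * z) * A a b := by
  rw [Matrix.mul_apply, Fin.sum_univ_two]
  fin_cases a <;> simp [expSigma3, colSign]

lemma mul_expSigma3_apply (A : Mat) (z : ℂ) (a b : Fin 2) :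
    (A * expSigma3 z) a b = A a b * exp (colSign b * z) := by
  rw [Matrix.mul_apply, Fin.sum_univ_two]
  fin_cases b <;> simp [expSigma3, colSign]

lemma potU_mul_apply (lam : ℝ) (u : ℝ → ℝ) {x : ℝ} (hx : 0 ≤ x) (A : Mat) (a b : Fin 2) :
    (potU lam u x * A) a b = potExt lam u a (a + 1) x * A (a + 1) b := by
  rw [Matrix.mul_apply, Fin.sum_univ_two, potExt_of_nonneg _ _ _ _ hx]
  fin_cases a <;> simp [potU]

lemma diagPart_diag (A : Mat) (c : Fin 2) : diagPart A c c = A c c := by simp [diagPart]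

lemma diagPart_off (A : Mat) (c : Fin 2) : diagPart A (c + 1) c = 0 := by simp [diagPart]

lemma offPart_diag (A : Mat) (c : Fin 2) : offPart A c c = 0 := by simp [offPart, diagPart]

lemma offPart_off (A : Mat) (c : Fin 2) : offPart A (c + 1) c = A (c + 1) c := by
  simp [offPart, diagPart]

lemma volterraIntegrand_diag (lam : ℝ) (u : ℝ → ℝ) (k : ℂ) (F : ℝ → Mat) (x : ℝ) {y : ℝ}
    (hy : 0 ≤ y) (c : Fin 2) :
    volterraIntegrand lam u k F x y c c = potExt lam u c (c + 1) y * F y (c + 1) c := by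
  rw [volterraIntegrand, mul_expSigma3_apply, expSigma3_mul_apply, potU_mul_apply _ _ hy,
    mul_right_comm, ← Complex.exp_add, ← mul_add, neg_add_cancel, mul_zero, Complex.exp_zero,
    one_mul]

lemma volterraIntegrand_off (lam : ℝ) (u : ℝ → ℝ) (k : ℂ) (F : ℝ → Mat) (x : ℝ) {y : ℝ}
    (hy : 0 ≤ y) (c : Fin 2) :
    volterraIntegrand lam u k F x y (c + 1) c =
      exp (2 * (I * (colSign c * k) * (y - x))) * (potExt lam u (c + 1) c y * F y c c) := by
  rw [volterraIntegrand, mul_expSigma3_apply, expSigma3_mul_apply, potU_mul_apply _ _ hy,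
    mul_right_comm, ← Complex.exp_add, colSign_add_one, add_one_add_one]
  congr 2
  ring

/-- Column by column, the matrix equation is the scalar system with spectral parameter `k` for the
first column and `-k` for the second, so that `κ` always lies in the closed upper half-plane. -/
lemma isEigenX_iff {X : ℝ → ℂ → Mat} : IsEigenX lam u X ↔ ∀ c, ∀ k ∈ domUL c,
    SolvesTail (potExt lam u c (c + 1)) (potExt lam u (c + 1) c) (colSign c * k)
      (fun x => X x k c c) (fun x => X x k (c + 1) c) := by
  refine forall_congr' fun c => forall₂_congr fun k hk => ?_
  have e1 : ∀ x : ℝ, 0 ≤ x → EqOn (fun y => volterraIntegrand lam u k (fun y => X y k) x y c c)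
      (fun y => potExt lam u c (c + 1) y * X y k (c + 1) c) (Ioi x) := fun x hx y hy =>
    volterraIntegrand_diag lam u k _ x (hx.trans (le_of_lt hy)) c
  have e2 : ∀ x : ℝ, 0 ≤ x →
      EqOn (fun y => volterraIntegrand lam u k (fun y => X y k) x y (c + 1) c)
      (fun y : ℝ => exp (2 * (I * (colSign c * k) * (y - x))) *
        (potExt lam u (c + 1) c y * X y k c c)) (Ioi x) := fun x hx y hy =>
    volterraIntegrand_off lam u k _ x (hx.trans (le_of_lt hy)) c
  constructor
  · intro h
    refine ⟨fun x hx => ?_, fun x hx => ?_, fun x hx => ?_, fun x hx => ?_⟩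
    · exact (h x hx c).1.congr_fun (e1 x hx) measurableSet_Ioi
    · rw [(h x hx c).2, Matrix.one_apply_eq, setIntegral_congr_fun measurableSet_Ioi (e1 x hx)]
    · exact (h x hx (c + 1)).1.congr_fun (e2 x hx) measurableSet_Ioi
    · rw [(h x hx (c + 1)).2, one_off, setIntegral_congr_fun measurableSet_Ioi (e2 x hx), zero_sub]
  · intro h x hx
    rw [forall_fin_two_iff_add_one c]
    refine ⟨⟨?_, ?_⟩, ?_, ?_⟩
    · exact (h.1 x hx).congr_fun (e1 x hx).symm measurableSet_Ioi
    · rw [h.2 x hx, Matrix.one_apply_eq, setIntegral_congr_fun measurableSet_Ioi (e1 x hx)]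
    · exact (h.3 x hx).congr_fun (e2 x hx).symm measurableSet_Ioi
    · rw [h.4 x hx, one_off, setIntegral_congr_fun measurableSet_Ioi (e2 x hx), zero_sub]

lemma isEigenY_iff {Y : ℝ → ℂ → Mat} : IsEigenY lam u Y ↔ ∀ k, ∀ x : ℝ, 0 ≤ x → ∀ c,
    SolvesHead (potExt lam u c (c + 1)) (potExt lam u (c + 1) c) (colSign c * k)
      (fun x => Y x k c c) (fun x => Y x k (c + 1) c) x := by
  refine forall_congr' fun k => forall₂_congr fun x hx => ?_
  rw [forall_comm]
  refine forall_congr' fun c => ?_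
  rw [forall_fin_two_iff_add_one c]
  have e1 : ∀ y, 0 ≤ y → y ≤ x → volterraIntegrand lam u k (fun y => Y y k) x y c c =
      potExt lam u c (c + 1) y * Y y k (c + 1) c := fun y hy _ =>
    volterraIntegrand_diag lam u k _ x hy c
  have e2 : ∀ y, 0 ≤ y → y ≤ x → volterraIntegrand lam u k (fun y => Y y k) x y (c + 1) c =
      exp (2 * (I * (colSign c * k) * (y - x))) * (potExt lam u (c + 1) c y * Y y k c c) :=
    fun y hy _ => volterraIntegrand_off lam u k _ x hy c
  have hI : ∀ y ∈ uIoc 0 x, 0 ≤ y ∧ y ≤ x := fun y hy => by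
    rw [uIoc_of_le hx] at hy
    exact ⟨hy.1.le, hy.2⟩
  rw [setIntegral_head_congr hx e1, setIntegral_head_congr hx e2, Matrix.one_apply_eq, one_off,
    zero_add, intervalIntegrable_congr fun y hy => e1 y (hI y hy).1 (hI y hy).2,
    intervalIntegrable_congr fun y hy => e2 y (hI y hy).1 (hI y hy).2]
  exact ⟨fun h => ⟨h.1.1, h.1.2, h.2.1, h.2.2⟩, fun h => ⟨⟨h.1, h.2⟩, h.3, h.4⟩⟩

lemma solvesXPart_of_hasDerivWithinAt {k : ℂ} {F : ℝ → Mat} {c : Fin 2}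
    (h1 : ∀ x, 0 ≤ x → HasDerivWithinAt (fun y => F y c c)
      (potExt lam u c (c + 1) x * F x (c + 1) c) (Ici 0) x)
    (h2 : ∀ x, 0 ≤ x → HasDerivWithinAt (fun y => F y (c + 1) c)
      (potExt lam u (c + 1) c x * F x c c - 2 * I * (colSign c * k) * F x (c + 1) c) (Ici 0) x) :
    SolvesXPart lam u k F c := by
  intro x hx
  rw [forall_fin_two_iff_add_one c]
  refine ⟨(h1 x hx).congr_deriv ?_, (h2 x hx).congr_deriv ?_⟩
  · rw [Matrix.add_apply, Matrix.smul_apply, Matrix.sub_apply, sigma3_mul_apply, mul_sigma3_apply,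
      potU_mul_apply _ _ hx, smul_eq_mul]
    ring
  · rw [Matrix.add_apply, Matrix.smul_apply, Matrix.sub_apply, sigma3_mul_apply, mul_sigma3_apply,
      potU_mul_apply _ _ hx, smul_eq_mul, colSign_add_one, add_one_add_one]
    ring

/-- The matrix recursion in terms of the entries of each column: the off-diagonal entry is given
algebraically, the diagonal one by its derivative. -/
lemma recursionZ_iff {N : ℕ} {F : ℕ → ℝ → Mat} : RecursionZ lam u N F ↔
    ∀ j < N, ∀ x : ℝ, 0 ≤ x → ∀ c : Fin 2,
      F (j + 1) x (c + 1) c = offStep (potExt lam u (c + 1) c) (colSign c)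
        (fun y => F j y (c + 1) c) (fun y => F j y c c) x ∧
      derivWithin (fun y => F (j + 1) y c c) (Ici 0) x = potExt lam u c (c + 1) x *
        offStep (potExt lam u (c + 1) c) (colSign c)
          (fun y => F j y (c + 1) c) (fun y => F j y c c) x := by
  refine forall₂_congr fun j hj => forall₂_congr fun x hx => ?_
  rw [mat_ext_iff, mat_ext_iff, ← forall_and]
  refine forall_congr' fun c => ?_
  simp only [offPart_diag, offPart_off, diagPart_diag, diagPart_off, Matrix.smul_apply,
    sigma3_mul_apply, potU_mul_apply _ _ hx, Matrix.sub_apply, mul_assoc, smul_eq_mul,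
    colSign_add_one, add_one_add_one, dx, Matrix.of_apply, offStep, mul_zero, sub_zero, true_and,
    and_true]
  exact and_congr (Eq.congr_right (by ring)) (Eq.congr_right (by ring))

lemma recursionW_iff {N : ℕ} {F : ℕ → ℝ → Mat} : RecursionW lam u N F ↔
    ∀ j < N, ∀ x : ℝ, 0 ≤ x → ∀ c : Fin 2,
      F (j + 1) x c c = offStep (potExt lam u c (c + 1)) (-colSign c)
        (fun y => F j y c c) (fun y => F j y (c + 1) c) x ∧
      derivWithin (fun y => F (j + 1) y (c + 1) c) (Ici 0) x = potExt lam u (c + 1) c x *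
        offStep (potExt lam u c (c + 1)) (-colSign c)
          (fun y => F j y c c) (fun y => F j y (c + 1) c) x := by
  refine forall₂_congr fun j hj => forall₂_congr fun x hx => ?_
  rw [mat_ext_iff, mat_ext_iff, ← forall_and]
  refine forall_congr' fun c => ?_
  simp only [offPart_diag, offPart_off, diagPart_diag, diagPart_off, Matrix.smul_apply,
    sigma3_mul_apply, potU_mul_apply _ _ hx, Matrix.sub_apply, mul_assoc, smul_eq_mul,
    colSign_add_one, add_one_add_one, dx, Matrix.of_apply, offStep, mul_zero, sub_zero, true_and,
    and_true]
  exact and_congr (Eq.congr_right (by ring)) (Eq.congr_right (by ring))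

lemma hatX_apply {N : ℕ} {F : ℕ → ℝ → Mat} {x : ℝ} (h0 : F 0 x = 1) (k : ℂ) (a b : Fin 2) :
    hatX N F x k a b = truncSum N (fun j x => F j x a b) x k := by
  rw [hatX, partialSum, truncSum, Finset.sum_range_succ', Matrix.add_apply, Matrix.sum_apply, h0,
    Finset.range_eq_Ico, Finset.sum_Ico_add' (fun j => 1 / k ^ j * F j x a b) 0 N 1, add_comm]
  simp [Finset.Ico_add_one_right_eq_Icc]

lemma hatY_apply {N : ℕ} {F G : ℕ → ℝ → Mat} {x : ℝ} (h0 : F 0 x = 1) (h0' : G 0 x = 0) (k : ℂ)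
    (a c : Fin 2) :
    hatY N F G x k a c = truncSum N (fun j x => F j x a c) x k +
      exp (-(2 * I * (colSign c * k) * x)) * truncSum N (fun j x => G j x a c) x k := by
  have h1 : partialSum N G x k a c = truncSum N (fun j x => G j x a c) x k := by
    rw [partialSum, truncSum, Finset.sum_range_succ', Matrix.sum_apply, h0',
      Finset.range_eq_Ico, Finset.sum_Ico_add' (fun j => 1 / k ^ j * G j x a c) 0 N 1]
    simp [Finset.Ico_add_one_right_eq_Icc]
  rw [← hatX_apply h0 k a c, ← h1, hatY, hatX, Matrix.add_apply]
  congr 1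
  rw [mul_expSigma3_apply, mul_comm]
  congr 2
  ring

lemma col_eq (A : Mat) (c : Fin 2) : col A c =
    A c c • EuclideanSpace.single c (1 : ℂ) +
      A (c + 1) c • EuclideanSpace.single (c + 1) (1 : ℂ) := by
  ext a
  fin_cases c <;> fin_cases a <;> simp [col]

lemma norm_col_le (A : Mat) (c : Fin 2) : ‖col A c‖ ≤ ‖A c c‖ + ‖A (c + 1) c‖ := by
  rw [col_eq]
  refine (norm_add_le _ _).trans (le_of_eq ?_)
  simp [norm_smul]

end Columns

/-! ### The potential matrix -/

section Potential

variable {lam : ℝ} {u : ℝ → ℝ} {m n : ℕ}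

lemma RegularDecay.regOn_iteratedDerivWithin (hu : RegularDecay m n u) : ∀ r i, i + r = m + 1 →
    RegOn (WeightedL1 n) r fun x => ((iteratedDerivWithin i u (Ici 0) x : ℝ) : ℂ) := by
  have hc : ∀ i ≤ m + 1, ContinuousOn (iteratedDerivWithin i u (Ici 0)) (Ici 0) := fun i hi =>
    hu.contDiffOn.continuousOn_iteratedDerivWithin (by exact_mod_cast hi) (uniqueDiffOn_Ici 0)
  have h0 : ∀ i ≤ m + 1, WeightedL1 n fun x => ((iteratedDerivWithin i u (Ici 0) x : ℝ) : ℂ) := by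
    refine fun i hi => ⟨continuous_ofReal.comp_continuousOn (hc i hi), ?_⟩
    refine IntegrableOn.congr_fun ((hu.integrableOn i hi).mono_set Ioi_subset_Ici_self).norm
      (fun y hy => ?_) measurableSet_Ioi
    have hy : (0 : ℝ) < y := hy
    simp only [norm_mul, norm_real]
    rw [Real.norm_of_nonneg (by positivity)]
  intro r
  induction r with
  | zero => exact fun i hi => h0 i (by omega)
  | succ r ih =>
    refine fun i hi => ⟨h0 i (by omega), _, fun x hx => ?_, ih (i + 1) (by omega)⟩
    have hd := (hu.contDiffOn.differentiableOn_iteratedDerivWithin (m := i)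
      (by exact_mod_cast (by omega : i < m + 1)) (uniqueDiffOn_Ici 0) x hx).hasDerivWithinAt
    rw [← iteratedDerivWithin_succ] at hd
    exact hd.ofReal_comp

lemma RegularDecay.regOn_potExt (hu : RegularDecay m n u) (lam : ℝ) (a b : Fin 2) :
    RegOn (WeightedL1 n) (m + 1) (potExt lam u a b) := by
  have h := hu.regOn_iteratedDerivWithin (m + 1) 0 (zero_add _)
  simp only [iteratedDerivWithin_zero] at h
  refine (RegOn.const_mul WeightedL1.const_mul ((!![0, 1; (lam : ℂ), 0] : Mat) a b) h).congr
    WeightedL1.congr fun x hx => ?_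
  rw [potExt_of_nonneg _ _ _ _ hx]
  fin_cases a <;> fin_cases b <;> simp [potU]

lemma RegularDecay.isPotential_potExt (hu : RegularDecay m n u) (lam : ℝ) (a b : Fin 2) :
    IsPotential n (potExt lam u a b) := by
  have h := (hu.regOn_potExt lam a b).base
  refine ⟨?_, h.2⟩
  have hc : Continuous fun x => potExt lam u a b (max x 0) :=
    h.1.comp_continuous (by fun_prop) fun x => mem_Ici.2 (le_max_right _ _)
  refine hc.congr fun x => ?_
  rw [potExt, potExt, max_eq_left (le_max_right x 0)]

end Potential

/-! ### The eigenfunctions and their formal coefficients -/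

/-- The eigenfunction `X` normalized at infinity. -/
def eigenX (lam : ℝ) (u : ℝ → ℝ) (x : ℝ) (k : ℂ) : Mat :=
  colMat (fun c => tailFst (potExt lam u c (c + 1)) (potExt lam u (c + 1) c) (colSign c * k) x)
    fun c => tailSnd (potExt lam u c (c + 1)) (potExt lam u (c + 1) c) (colSign c * k) x

/-- The eigenfunction `Y` normalized at zero. -/
def eigenY (lam : ℝ) (u : ℝ → ℝ) (x : ℝ) (k : ℂ) : Mat :=
  colMat (fun c => headFst (potExt lam u c (c + 1)) (potExt lam u (c + 1) c) x (colSign c * k))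
    fun c => headSnd (potExt lam u c (c + 1)) (potExt lam u (c + 1) c) x (colSign c * k)

/-- The coefficients `X_j`. -/
def coefX (lam : ℝ) (u : ℝ → ℝ) (j : ℕ) (x : ℝ) : Mat :=
  colMat (fun c => (formalTail (potExt lam u c (c + 1)) (potExt lam u (c + 1) c) (colSign c) j).2 x)
    fun c => (formalTail (potExt lam u c (c + 1)) (potExt lam u (c + 1) c) (colSign c) j).1 x

/-- The coefficients `Z_j`. -/
def coefZ (lam : ℝ) (u : ℝ → ℝ) (j : ℕ) (x : ℝ) : Mat :=
  colMat
    (fun c => (formalHead (potExt lam u c (c + 1)) (potExt lam u (c + 1) c) (colSign c) j).1.2 x)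
    fun c => (formalHead (potExt lam u c (c + 1)) (potExt lam u (c + 1) c) (colSign c) j).1.1 x

/-- The coefficients `W_j`. -/
def coefW (lam : ℝ) (u : ℝ → ℝ) (j : ℕ) (x : ℝ) : Mat :=
  colMat
    (fun c => (formalHead (potExt lam u c (c + 1)) (potExt lam u (c + 1) c) (colSign c) j).2.1 x)
    fun c => (formalHead (potExt lam u c (c + 1)) (potExt lam u (c + 1) c) (colSign c) j).2.2 x

section Eigen

lemma coeffC1_of_forall {N : ℕ} {F : ℕ → ℝ → Mat}
    (h : ∀ j ≤ N, ∀ c, ContDiffOn ℝ 1 (fun x => F j x c c) (Ici 0) ∧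
      ContDiffOn ℝ 1 (fun x => F j x (c + 1) c) (Ici 0)) : CoeffC1 N F := by
  refine fun j hj a b => ?_
  revert a
  rw [forall_fin_two_iff_add_one b]
  exact h j hj b

lemma colMat_one_zero : colMat (fun _ => 1) (fun _ => 0) = 1 := by
  refine mat_ext_iff.2 fun c => ?_
  simp only [colMat_diag, colMat_off, one_off, Matrix.one_apply_eq, and_self]

variable {lam : ℝ} {u : ℝ → ℝ} {m n : ℕ} (hu : RegularDecay m n u)
include hu

lemma isEigenX_eigenX : IsEigenX lam u (eigenX lam u) := by
  refine isEigenX_iff.2 fun c k hk => ?_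
  simp only [eigenX, colMat_diag, colMat_off]
  exact solvesTail_tailFst (hu.isPotential_potExt lam _ _) (hu.isPotential_potExt lam _ _)
    (mem_domUL_iff.1 hk)

lemma IsEigenX.col_eq_eigenX {X : ℝ → ℂ → Mat} (h : IsEigenX lam u X) {c : Fin 2} {k : ℂ}
    (hk : k ∈ domUL c) {x : ℝ} (hx : 0 ≤ x) : col (X x k) c = col (eigenX lam u x k) c := by
  obtain ⟨h1, h2⟩ := (isEigenX_iff.1 h c k hk).eq_tail (hu.isPotential_potExt lam _ _)
    (hu.isPotential_potExt lam _ _) (mem_domUL_iff.1 hk) hx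
  rw [col_eq, col_eq, h1, h2]
  simp only [eigenX, colMat_diag, colMat_off]

lemma isEigenY_eigenY : IsEigenY lam u (eigenY lam u) := by
  refine isEigenY_iff.2 fun k x hx c => ?_
  simp only [eigenY, colMat_diag, colMat_off]
  exact solvesHead_head (hu.isPotential_potExt lam _ _).1 (hu.isPotential_potExt lam _ _).1 _ hx

lemma IsEigenY.eq_eigenY {Y : ℝ → ℂ → Mat} (h : IsEigenY lam u Y) (k : ℂ) {x : ℝ} (hx : 0 ≤ x) :
    Y x k = eigenY lam u x k := by
  refine mat_ext_iff.2 fun c => ?_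
  simp only [eigenY, colMat_diag, colMat_off]
  exact SolvesHead.eq_head (hu.isPotential_potExt lam _ _).1 (hu.isPotential_potExt lam _ _).1 hx
    (fun y hy => isEigenY_iff.1 h k y hy.1 c) (right_mem_Icc.2 hx)

lemma solvesXPart_eigenX {c : Fin 2} {k : ℂ} (hk : k ∈ domUL c) :
    SolvesXPart lam u k (fun x => eigenX lam u x k) c := by
  have h := isEigenX_iff.1 (isEigenX_eigenX (lam := lam) hu) c k hk
  have hp := hu.isPotential_potExt lam c (c + 1)
  have hq := hu.isPotential_potExt lam (c + 1) c
  exact solvesXPart_of_hasDerivWithinAt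
    (fun x hx => h.hasDerivWithinAt_fst hp hq (mem_domUL_iff.1 hk) hx)
    (fun x hx => h.hasDerivWithinAt_snd hp hq (mem_domUL_iff.1 hk) hx)

lemma solvesXPart_eigenY (c : Fin 2) (k : ℂ) :
    SolvesXPart lam u k (fun x => eigenY lam u x k) c := by
  have hp := (hu.isPotential_potExt lam c (c + 1)).1
  have hq := (hu.isPotential_potExt lam (c + 1) c).1
  refine solvesXPart_of_hasDerivWithinAt (fun x hx => ?_) (fun x hx => ?_)
  · simp only [eigenY, colMat_diag, colMat_off]
    exact hasDerivWithinAt_headFst hp hq _ hx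
  · simp only [eigenY, colMat_diag, colMat_off]
    exact hasDerivWithinAt_headSnd hp hq _ hx

lemma isFormalX_coefX : IsFormalX lam u (m + 1) (coefX lam u) := by
  have hF := fun c : Fin 2 => formalPair_formalTail (potExt lam u c (c + 1))
    (potExt lam u (c + 1) c) (colSign c)
  have hr := hu.regOn_potExt lam
  refine ⟨coeffC1_of_forall fun j hj c => ?_, fun x _ => colMat_one_zero,
    recursionZ_iff.2 fun j hj x hx c => ?_, fun j hj hj' => ?_⟩
  · simp only [coefX, colMat_diag, colMat_off]
    exact ⟨(hF c).contDiffOn_d (hr _ _) (hr _ _) hj, (hF c).contDiffOn_o (hr _ _) (hr _ _) hj⟩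
  · simp only [coefX, colMat_diag, colMat_off]
    refine ⟨rfl, ?_⟩
    exact ((hF c).hasDerivWithinAt_d (hr _ _) (hr _ _) (by omega : j + 1 ≤ m + 1) hx).derivWithin
      (uniqueDiffOn_Ici 0 x hx)
  · obtain ⟨j, rfl⟩ : ∃ i, j = i + 1 := ⟨j - 1, by omega⟩
    refine tendsto_pi_nhds.2 fun a => tendsto_pi_nhds.2 fun c => ?_
    revert a
    rw [forall_fin_two_iff_add_one c]
    simp only [coefX, colMat_diag, colMat_off]
    exact ⟨tendsto_formalTail (hr _ _) (hr _ _) _ hj', (hF c).tendsto_o (hr _ _) (hr _ _) hj'⟩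

lemma isFormalY_coef : IsFormalY lam u (m + 1) (coefZ lam u) (coefW lam u) := by
  have hF := fun c : Fin 2 => formalPair_formalHead_fst (potExt lam u c (c + 1))
    (potExt lam u (c + 1) c) (colSign c)
  have hG := fun c : Fin 2 => formalPair_formalHead_snd (potExt lam u c (c + 1))
    (potExt lam u (c + 1) c) (colSign c)
  have hr := hu.regOn_potExt lam
  refine ⟨coeffC1_of_forall fun j hj c => ?_, coeffC1_of_forall fun j hj c => ?_,
    fun x _ => colMat_one_zero, fun x _ => ?_, recursionZ_iff.2 fun j hj x hx c => ?_,
    recursionW_iff.2 fun j hj x hx c => ?_, fun j hj hj' => ?_⟩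
  · simp only [coefZ, colMat_diag, colMat_off]
    exact ⟨(hF c).contDiffOn_d (hr _ _) (hr _ _) hj, (hF c).contDiffOn_o (hr _ _) (hr _ _) hj⟩
  · simp only [coefW, colMat_diag, colMat_off]
    exact ⟨(hG c).contDiffOn_o (hr _ _) (hr _ _) hj, (hG c).contDiffOn_d (hr _ _) (hr _ _) hj⟩
  · refine mat_ext_iff.2 fun c => ?_
    simp only [coefW, colMat_diag, colMat_off]
    exact ⟨rfl, rfl⟩
  · simp only [coefZ, colMat_diag, colMat_off]
    refine ⟨rfl, ?_⟩
    exact ((hF c).hasDerivWithinAt_d (hr _ _) (hr _ _) (by omega : j + 1 ≤ m + 1) hx).derivWithin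
      (uniqueDiffOn_Ici 0 x hx)
  · simp only [coefW, colMat_diag, colMat_off]
    refine ⟨rfl, ?_⟩
    exact ((hG c).hasDerivWithinAt_d (hr _ _) (hr _ _) (by omega : j + 1 ≤ m + 1) hx).derivWithin
      (uniqueDiffOn_Ici 0 x hx)
  · obtain ⟨j, rfl⟩ : ∃ i, j = i + 1 := ⟨j - 1, by omega⟩
    refine mat_ext_iff.2 fun c => ?_
    have h := formalHead_initial (potExt lam u c (c + 1)) (potExt lam u (c + 1) c) (colSign c) j
    simp only [Matrix.add_apply, Matrix.zero_apply, coefZ, coefW, colMat_diag, colMat_off]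
    rw [h.1, h.2]
    exact ⟨neg_add_cancel _, add_neg_cancel _⟩

omit hu

lemma sub_eq_sub_of_derivWithin_eq {f g : ℝ → ℂ} (hf : ContDiffOn ℝ 1 f (Ici 0))
    (hg : ContDiffOn ℝ 1 g (Ici 0))
    (h : ∀ x, 0 ≤ x → derivWithin f (Ici 0) x = derivWithin g (Ici 0) x) {x : ℝ} (hx : 0 ≤ x) :
    f x - g x = f 0 - g 0 := by
  have hd : ∀ x, 0 ≤ x → HasDerivWithinAt (fun x => f x - g x) 0 (Ici 0) x := fun x hx => by
    have := (hf.differentiableOn one_ne_zero x hx).hasDerivWithinAt.sub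
      (hg.differentiableOn one_ne_zero x hx).hasDerivWithinAt
    rwa [h x hx, sub_self] at this
  have := integral_eq_sub_of_hasDerivWithinAt_Ici hx hd continuousOn_const
  rw [intervalIntegral.integral_zero] at this
  exact sub_eq_zero.1 this.symm

lemma offStep_congr {q : ℝ → ℂ} {s : ℂ} {o d o' d' : ℝ → ℂ} (ho : EqOn o o' (Ici 0))
    (hd : EqOn d d' (Ici 0)) {x : ℝ} (hx : 0 ≤ x) : offStep q s o d x = offStep q s o' d' x := by
  rw [offStep, offStep, derivWithin_congr ho (ho hx), hd hx]

/-- The recursion determines the off-diagonal part of the next coefficient and the derivative of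
its diagonal part, so that the condition at infinity fixes the constant of integration. -/
lemma IsFormalX.unique {N : ℕ} {F G : ℕ → ℝ → Mat} (hF : IsFormalX lam u N F)
    (hG : IsFormalX lam u N G) : ∀ j ≤ N, ∀ x : ℝ, 0 ≤ x → F j x = G j x := by
  intro j
  induction j with
  | zero => exact fun _ x hx => by rw [hF.zero x hx, hG.zero x hx]
  | succ j ih =>
    intro hj x hx
    have ih := ih (by omega)
    have e : ∀ a c, EqOn (fun y => F j y a c) (fun y => G j y a c) (Ici 0) := fun a c y hy => by
      simp only [ih y hy]
    have rF := recursionZ_iff.1 hF.recursion j hj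
    have rG := recursionZ_iff.1 hG.recursion j hj
    refine mat_ext_iff.2 fun c => ⟨?_, ?_⟩
    · have hc := fun x (hx : 0 ≤ x) => sub_eq_sub_of_derivWithin_eq (hF.smooth (j + 1) hj c c)
        (hG.smooth (j + 1) hj c c) (fun x hx => by
          rw [(rF x hx c).2, (rG x hx c).2, offStep_congr (e _ _) (e _ _) hx]) hx
      have hlim :=
        (tendsto_pi_nhds.1 (tendsto_pi_nhds.1 (hF.tendsto (j + 1) (by omega) hj) c) c).sub
        (tendsto_pi_nhds.1 (tendsto_pi_nhds.1 (hG.tendsto (j + 1) (by omega) hj) c) c)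
      have hlim' : Tendsto (fun x => F (j + 1) x c c - G (j + 1) x c c) atTop
          (𝓝 (F (j + 1) 0 c c - G (j + 1) 0 c c)) := by
        refine tendsto_const_nhds.congr' ?_
        filter_upwards [eventually_ge_atTop 0] with x hx using (hc x hx).symm
      have h0 := tendsto_nhds_unique hlim' hlim
      simp only [Matrix.zero_apply, sub_self] at h0
      exact sub_eq_zero.1 ((hc x hx).trans h0)
    · rw [(rF x hx c).1, (rG x hx c).1, offStep_congr (e _ _) (e _ _) hx]

lemma IsFormalY.unique {N : ℕ} {F G F' G' : ℕ → ℝ → Mat} (hF : IsFormalY lam u N F G)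
    (hF' : IsFormalY lam u N F' G') :
    ∀ j ≤ N, ∀ x : ℝ, 0 ≤ x → F j x = F' j x ∧ G j x = G' j x := by
  intro j
  induction j with
  | zero =>
    intro _ x hx
    rw [hF.zeroZ x hx, hF.zeroW x hx, hF'.zeroZ x hx, hF'.zeroW x hx]
    exact ⟨rfl, rfl⟩
  | succ j ih =>
    intro hj
    have ih := ih (by omega)
    have e : ∀ a c, EqOn (fun y => F j y a c) (fun y => F' j y a c) (Ici 0) := fun a c y hy => by
      simp only [(ih y hy).1]
    have e' : ∀ a c, EqOn (fun y => G j y a c) (fun y => G' j y a c) (Ici 0) := fun a c y hy => by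
      simp only [(ih y hy).2]
    have rF := recursionZ_iff.1 hF.recursionZ j hj
    have rF' := recursionZ_iff.1 hF'.recursionZ j hj
    have rG := recursionW_iff.1 hF.recursionW j hj
    have rG' := recursionW_iff.1 hF'.recursionW j hj
    have oZ : ∀ x, 0 ≤ x → ∀ c, F (j + 1) x (c + 1) c = F' (j + 1) x (c + 1) c := fun x hx c => by
      rw [(rF x hx c).1, (rF' x hx c).1, offStep_congr (e _ _) (e _ _) hx]
    have oW : ∀ x, 0 ≤ x → ∀ c, G (j + 1) x c c = G' (j + 1) x c c := fun x hx c => by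
      rw [(rG x hx c).1, (rG' x hx c).1, offStep_congr (e' _ _) (e' _ _) hx]
    have i0 : ∀ a c, F (j + 1) 0 a c + G (j + 1) 0 a c = F' (j + 1) 0 a c + G' (j + 1) 0 a c :=
      fun a c => by
        rw [← Matrix.add_apply, ← Matrix.add_apply, hF.initial _ (by omega) hj,
          hF'.initial _ (by omega) hj]
    have dZ : ∀ x, 0 ≤ x → ∀ c, F (j + 1) x c c = F' (j + 1) x c c := fun x hx c => by
      have hc := sub_eq_sub_of_derivWithin_eq (hF.smoothZ (j + 1) hj c c)
        (hF'.smoothZ (j + 1) hj c c) (fun x hx => by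
          rw [(rF x hx c).2, (rF' x hx c).2, offStep_congr (e _ _) (e _ _) hx]) hx
      linear_combination hc + i0 c c - oW 0 le_rfl c
    have dW : ∀ x, 0 ≤ x → ∀ c, G (j + 1) x (c + 1) c = G' (j + 1) x (c + 1) c := fun x hx c => by
      have hc := sub_eq_sub_of_derivWithin_eq (hF.smoothW (j + 1) hj (c + 1) c)
        (hF'.smoothW (j + 1) hj (c + 1) c) (fun x hx => by
          rw [(rG x hx c).2, (rG' x hx c).2, offStep_congr (e' _ _) (e' _ _) hx]) hx
      linear_combination hc + i0 (c + 1) c - oZ 0 le_rfl c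
    exact fun x hx => ⟨mat_ext_iff.2 fun c => ⟨dZ x hx c, oZ x hx c⟩,
      mat_ext_iff.2 fun c => ⟨oW x hx c, dW x hx c⟩⟩

include hu

/-! ### Regularity in the spectral parameter and estimates -/

lemma contDiffOn_col_eigenX (c : Fin 2) (x : ℝ) :
    ContDiffOn ℂ n (fun k => col (eigenX lam u x k) c) (domUL c) := by
  have hp := hu.isPotential_potExt lam c (c + 1)
  have hq := hu.isPotential_potExt lam (c + 1) c
  have hm : ContDiffOn ℂ n (fun k : ℂ => (colSign c : ℂ) * k) (domUL c) :=
    (contDiff_const.mul contDiff_id).contDiffOn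
  have hev : ContDiff ℂ n (BoundedContinuousFunction.evalCLM ℂ x : (ℝ →ᵇ ℂ) →L[ℂ] ℂ) :=
    ContinuousLinearMap.contDiff _
  have hmaps : MapsTo (fun k : ℂ => (colSign c : ℂ) * k) (domUL c) closedUpper :=
    fun k hk => mem_domUL_iff.1 hk
  have h1 := hev.comp_contDiffOn ((contDiffOn_tailFst hp hq).comp hm hmaps)
  have h2 := hev.comp_contDiffOn ((contDiffOn_tailSnd hp hq).comp hm hmaps)
  simp only [col_eq, eigenX, colMat_diag, colMat_off]
  exact (h1.smul contDiffOn_const).add (h2.smul contDiffOn_const)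

lemma differentiable_col_eigenY (c : Fin 2) {x : ℝ} (hx : 0 ≤ x) :
    Differentiable ℂ fun k => col (eigenY lam u x k) c := by
  have hp := (hu.isPotential_potExt lam c (c + 1)).1
  have hq := (hu.isPotential_potExt lam (c + 1) c).1
  have hm : Differentiable ℂ fun k : ℂ => (colSign c : ℂ) * k := by fun_prop
  have h1 := (differentiable_headFst hp hq hx).comp hm
  have h2 := (differentiable_headSnd hp hq hx).comp hm
  simp only [col_eq, eigenY, colMat_diag, colMat_off]
  exact (h1.smul_const _).add (h2.smul_const _)

/-- The error is `k ^ -(m + 1)` times the error functions on `[x, ∞)`, evaluated at the left end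
point `x`. -/
lemma exists_estimate_eigenX (c : Fin 2) : ∃ A, 0 ≤ A ∧ ∀ k ∈ domUL c, 4 < ‖k‖ → ∀ x : ℝ, 0 ≤ x →
    ∀ j ≤ n, ‖iteratedDerivWithin j
      (fun z => col (eigenX lam u x z - hatX (m + 1) (coefX lam u) x z) c) (domUL c) k‖ ≤
        A / (‖k‖ ^ (m + 1) * (1 + x) ^ (n - j)) := by
  have hp := hu.isPotential_potExt lam c (c + 1)
  have hq := hu.isPotential_potExt lam (c + 1) c
  have hpr := hu.regOn_potExt lam c (c + 1)
  have hqr := hu.regOn_potExt lam (c + 1) c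
  set p := potExt lam u c (c + 1) with hpd
  set q := potExt lam u (c + 1) c with hqd
  set ρ := residual q (fun j => (formalTail p q (colSign c) j).1)
    (fun j => (formalTail p q (colSign c) j).2) (m + 1) with hρ
  have hr : WeightedL1 n ρ := (formalPair_formalTail p q (colSign c)).weightedL1_residual hpr hqr
  obtain ⟨C, hC, hB⟩ := exists_bddDeriv_tailErr hp hq hr.1 hr.2
  have hDu : UniqueDiffOn ℂ (domUL c) := by
    rw [domUL_eq]
    exact uniqueDiffOn_preimage_sign (colSign_eq' c) uniqueDiffOn_closedUpper
  refine ⟨2 ^ n * (n.factorial * 2 ^ (m + 1) * (2 * C)), by positivity,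
    fun k hk hk4 x hx j hj => ?_⟩
  obtain ⟨h1, h2⟩ := hB j hj x hx
  have hx1 : 0 < (1 + x) ^ (n - j) := pow_pos (by linarith) _
  -- evaluation at `x`, followed by the inclusion of a coordinate, has norm at most one
  have key : ∀ (G : ℂ → ℝ →ᵇ ℂ) (a : Fin 2), BddDeriv j closedUpper (C / (1 + x) ^ (n - j)) G →
      BddDeriv j (domUL c) (C / (1 + x) ^ (n - j))
        fun k => G (colSign c * k) x • EuclideanSpace.single a (1 : ℂ) := by
    intro G a hG
    have h3 := hG.comp_sign (colSign_eq' c) uniqueDiffOn_closedUpper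
    rw [← domUL_eq] at h3
    set L : (ℝ →ᵇ ℂ) →L[ℂ] EuclideanSpace ℂ (Fin 2) :=
      (BoundedContinuousFunction.evalCLM ℂ x : (ℝ →ᵇ ℂ) →L[ℂ] ℂ).smulRight
        (EuclideanSpace.single a (1 : ℂ)) with hL
    have hLn : ‖L‖ ≤ 1 := by
      refine L.opNorm_le_bound zero_le_one fun f => ?_
      rw [hL, ContinuousLinearMap.smulRight_apply, norm_smul, one_mul]
      simpa using f.norm_coe_le_norm x
    refine (h3.clm_comp hDu L).mono le_rfl ?_
    exact mul_le_of_le_one_left (div_nonneg hC hx1.le) hLn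
  have hG := (key _ c h1).add hDu (key _ (c + 1) h2)
  refine (norm_iteratedDerivWithin_le_of_eq_one_div_pow_smul (N := m + 1) hDu hG
    (fun z hz hz0 => ?_) hk hk4).trans ?_
  · obtain ⟨e1, e2⟩ := tail_sub_truncSum_eq hp hq hpr hqr (colSign_mul_self c) hz0
      (mem_domUL_iff.1 hz) hx hρ
    have h0 : coefX lam u 0 x = 1 := (isFormalX_coefX hu).zero x hx
    rw [col_eq, Matrix.sub_apply, Matrix.sub_apply, hatX_apply h0, hatX_apply h0]
    simp only [eigenX, coefX, colMat_diag, colMat_off, ← hpd, ← hqd]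
    rw [e1, e2, smul_add, smul_smul, smul_smul]
  · have hk0 : 0 < ‖k‖ ^ (m + 1) := pow_pos (by linarith) _
    rw [div_le_div_iff₀ hk0 (mul_pos hk0 hx1)]
    have e : 2 ^ j * (j.factorial * 2 ^ (m + 1) * (C / (1 + x) ^ (n - j) + C / (1 + x) ^ (n - j))) *
        (‖k‖ ^ (m + 1) * (1 + x) ^ (n - j)) =
        2 ^ j * (j.factorial * 2 ^ (m + 1) * (2 * C)) * ‖k‖ ^ (m + 1) := by
      field_simp
      ring
    rw [e]
    have := Nat.factorial_le hj
    gcongr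
    norm_num

/-- These bounds are stronger than needed: a bound for the error in a strip of width `1 / (1 + x)`
around the half-plane and Cauchy's estimate leave one factor `1 + x` for each derivative. -/
lemma exists_estimate_eigenY (c : Fin 2) : ∃ B, 0 ≤ B ∧
    (∀ k ∈ domLU c, 2 < ‖k‖ → ∀ x : ℝ, 0 ≤ x → ∀ j ≤ n,
      ‖iteratedDeriv j
        (fun z => col (eigenY lam u x z - hatY (m + 1) (coefZ lam u) (coefW lam u) x z) c) k‖ ≤
          B * (1 + x) ^ j / ‖k‖ ^ (m + 1)) ∧
    (∀ k ∈ domUL c, 2 < ‖k‖ → ∀ x : ℝ, 0 ≤ x → ∀ j ≤ n,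
      ‖iteratedDeriv j
        (fun z => col ((eigenY lam u x z - hatY (m + 1) (coefZ lam u) (coefW lam u) x z) *
          expSigma3 (2 * I * z * (x : ℂ))) c) k‖ ≤ B * (1 + x) ^ j / ‖k‖ ^ (m + 1)) := by
  have hp := hu.isPotential_potExt lam c (c + 1)
  have hq := hu.isPotential_potExt lam (c + 1) c
  have hpr := hu.regOn_potExt lam c (c + 1)
  have hqr := hu.regOn_potExt lam (c + 1) c
  set p := potExt lam u c (c + 1) with hpd
  set q := potExt lam u (c + 1) c with hqd
  obtain ⟨C, hC, hB⟩ := exists_headErr_le hp hq hpr hqr (colSign_mul_self c)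
  have him : ∀ z : ℂ, ((colSign c : ℂ) * z).im = colSign c * z.im := fun z => by simp
  simp only [him, ← neg_mul] at hB
  have hF := isFormalY_coef (lam := lam) hu
  have e : ∀ x : ℝ, 0 ≤ x → ∀ z,
      (eigenY lam u x z - hatY (m + 1) (coefZ lam u) (coefW lam u) x z) c c =
        headErrFst p q (colSign c) (m + 1) x z ∧
      (eigenY lam u x z - hatY (m + 1) (coefZ lam u) (coefW lam u) x z) (c + 1) c =
        headErrSnd p q (colSign c) (m + 1) x z := fun x hx z => by
    rw [Matrix.sub_apply, Matrix.sub_apply, hatY_apply (hF.zeroZ x hx) (hF.zeroW x hx),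
      hatY_apply (hF.zeroZ x hx) (hF.zeroW x hx)]
    simp only [eigenY, coefZ, coefW, colMat_diag, colMat_off, ← hpd, ← hqd, headErrFst, headErrSnd,
      sub_sub, and_self]
  have hdiff : ∀ x : ℝ, 0 ≤ x → ∀ z ≠ 0, DifferentiableAt ℂ
      (fun z => col (eigenY lam u x z - hatY (m + 1) (coefZ lam u) (coefW lam u) x z) c) z ∧
      DifferentiableAt ℂ
      (fun z => col ((eigenY lam u x z - hatY (m + 1) (coefZ lam u) (coefW lam u) x z) *
        expSigma3 (2 * I * z * (x : ℂ))) c) z := fun x hx z hz => by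
    obtain ⟨d1, d2⟩ := differentiableAt_headErr hp.1 hq.1 (colSign c) (m + 1) hx hz
    have he : DifferentiableAt ℂ (fun z : ℂ => exp (colSign c * (2 * I * z * x))) z := by fun_prop
    simp only [col_eq, mul_expSigma3_apply, (e x hx _).1, (e x hx _).2]
    exact ⟨(d1.smul_const _).add (d2.smul_const _),
      ((d1.mul he).smul_const _).add ((d2.mul he).smul_const _)⟩
  have hfin : ∀ (j : ℕ) (x : ℝ) (k : ℂ), j ≤ n → 0 ≤ x →
      j.factorial * 2 ^ (m + 1) * (2 * C) * (1 + x) ^ j / ‖k‖ ^ (m + 1) ≤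
      n.factorial * 2 ^ (m + 1) * (2 * C) * (1 + x) ^ j / ‖k‖ ^ (m + 1) := fun j x k hj hx => by
    have := Nat.factorial_le hj
    have hx1 : 0 ≤ 1 + x := by linarith
    gcongr
  refine ⟨n.factorial * 2 ^ (m + 1) * (2 * C), by positivity, fun k hk hk2 x hx j hj => ?_,
    fun k hk hk2 x hx j hj => ?_⟩
  · refine (norm_iteratedDeriv_le_of_strip (N := m + 1) (b := 2 * C) (colSign_eq c) hx
      (fun z hz => (hdiff x hx z hz).1) (fun z hz hzi => ?_) (by positivity) j hk2
      (mem_domLU_iff_im.1 hk)).trans (hfin j x k hj hx)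
    obtain ⟨b1, b2⟩ := (hB x hx z hz).1 hzi
    refine (norm_col_le _ _).trans ?_
    rw [(e x hx z).1, (e x hx z).2, two_mul, add_div]
    exact add_le_add b1 b2
  · have hσ : -colSign c = 1 ∨ -colSign c = -1 := by
      rcases colSign_eq c with h | h <;> simp [h]
    refine (norm_iteratedDeriv_le_of_strip (N := m + 1) (b := 2 * C) hσ hx
      (fun z hz => (hdiff x hx z hz).2) (fun z hz hzi => ?_) (by positivity) j hk2
      (mem_domUL_iff_im.1 hk)).trans (hfin j x k hj hx)
    obtain ⟨b1, b2⟩ := (hB x hx z hz).2 hzi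
    have ee : colSign c * (2 * I * z * x) = 2 * I * (colSign c * z) * x := by ring
    refine (norm_col_le _ _).trans ?_
    rw [mul_expSigma3_apply, mul_expSigma3_apply, (e x hx z).1, (e x hx z).2, ee,
      mul_comm (headErrFst _ _ _ _ _ _), mul_comm (headErrSnd _ _ _ _ _ _), two_mul C, add_div]
    exact add_le_add b1 b2

end Eigen

end MKdV

end

theorem theorem3p2 (lam : ℝ) (hlam : lam = 1 ∨ lam = -1) (m n : ℕ) (hm : 1 ≤ m) (hn : 1 ≤ n)
    (u : ℝ → ℝ) (hu : MKdV.RegularDecay m n u) :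
    ∃ (X Y : ℝ → ℂ → MKdV.Mat) (Xc Zc Wc : ℕ → ℝ → MKdV.Mat),
      -- the Volterra equations define `X` and `Y` uniquely
      MKdV.IsEigenX lam u X ∧
      (∀ X' : ℝ → ℂ → MKdV.Mat, MKdV.IsEigenX lam u X' →
        ∀ c : Fin 2, ∀ k ∈ MKdV.domUL c, ∀ x : ℝ, 0 ≤ x →
          MKdV.col (X' x k) c = MKdV.col (X x k) c) ∧
      MKdV.IsEigenY lam u Y ∧
      (∀ Y' : ℝ → ℂ → MKdV.Mat, MKdV.IsEigenY lam u Y' →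
        ∀ k : ℂ, ∀ x : ℝ, 0 ≤ x → Y' x k = Y x k) ∧
      -- `X` and `Y` solve the `x`-part
      (∀ c : Fin 2, ∀ k ∈ MKdV.domUL c, MKdV.SolvesXPart lam u k (fun x => X x k) c) ∧
      (∀ c : Fin 2, ∀ k : ℂ, MKdV.SolvesXPart lam u k (fun x => Y x k) c) ∧
      -- the coefficients up to order `m + 1` are well-defined
      MKdV.IsFormalX lam u (m + 1) Xc ∧
      (∀ F : ℕ → ℝ → MKdV.Mat, MKdV.IsFormalX lam u (m + 1) F →
        ∀ j ≤ m + 1, ∀ x : ℝ, 0 ≤ x → F j x = Xc j x) ∧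
      MKdV.IsFormalY lam u (m + 1) Zc Wc ∧
      (∀ F G : ℕ → ℝ → MKdV.Mat, MKdV.IsFormalY lam u (m + 1) F G →
        ∀ j ≤ m + 1, ∀ x : ℝ, 0 ≤ x → F j x = Zc j x ∧ G j x = Wc j x) ∧
      -- the `k`-derivatives in the estimates exist
      (∀ c : Fin 2, ∀ x : ℝ, 0 ≤ x →
        ContDiffOn ℂ (n : WithTop ℕ∞) (fun k => MKdV.col (X x k) c) (MKdV.domUL c)) ∧
      (∀ c : Fin 2, ∀ x : ℝ, 0 ≤ x → Differentiable ℂ (fun k => MKdV.col (Y x k) c)) ∧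
      -- the estimates
      ∃ K : ℝ, 0 < K ∧ ∃ C : ℝ, 0 < C ∧
        (∀ c : Fin 2, ∀ k ∈ MKdV.domUL c, K < ‖k‖ → ∀ x : ℝ, 0 ≤ x → ∀ j ≤ n,
          ‖iteratedDerivWithin j
              (fun z => MKdV.col (X x z - MKdV.hatX (m + 1) Xc x z) c) (MKdV.domUL c) k‖ ≤
            C / (‖k‖ ^ (m + 1) * (1 + x) ^ (n - j))) ∧
        (∀ c : Fin 2, ∀ k ∈ MKdV.domLU c, K < ‖k‖ → ∀ x : ℝ, 0 ≤ x → ∀ j ≤ n,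
          ‖iteratedDeriv j
              (fun z => MKdV.col (Y x z - MKdV.hatY (m + 1) Zc Wc x z) c) k‖ ≤
            C * (1 + x) ^ (j + 2) * Real.exp (C * x / ‖k‖ ^ (m + 1)) / ‖k‖ ^ (m + 1)) ∧
        (∀ c : Fin 2, ∀ k ∈ MKdV.domUL c, K < ‖k‖ → ∀ x : ℝ, 0 ≤ x → ∀ j ≤ n,
          ‖iteratedDeriv j
              (fun z => MKdV.col ((Y x z - MKdV.hatY (m + 1) Zc Wc x z) *
                MKdV.expSigma3 (2 * Complex.I * z * (x : ℂ))) c) k‖ ≤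
            C * (1 + x) ^ (j + 2) * Real.exp (C * x / ‖k‖ ^ (m + 1)) / ‖k‖ ^ (m + 1)) := by
  have hA := fun c => MKdV.exists_estimate_eigenX (lam := lam) hu c
  have hB := fun c => MKdV.exists_estimate_eigenY (lam := lam) hu c
  choose A hA0 hA using hA
  choose B hB0 hB hB' using hB
  set C : ℝ := (∑ c, A c) + (∑ c, B c) + 1
  have hSA : 0 ≤ ∑ c, A c := Finset.sum_nonneg fun c _ => hA0 c
  have hSB : 0 ≤ ∑ c, B c := Finset.sum_nonneg fun c _ => hB0 c
  have hC : 0 < C := by positivity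
  have hAC : ∀ c, A c ≤ C := fun c => by
    have := Finset.single_le_sum (fun c _ => hA0 c) (Finset.mem_univ c)
    linarith
  have hBC : ∀ c, B c ≤ C := fun c => by
    have := Finset.single_le_sum (fun c _ => hB0 c) (Finset.mem_univ c)
    linarith
  -- the bounds for `Y` hold without the exponential and with a smaller power of `1 + x`
  have hY : ∀ (c : Fin 2) (k : ℂ) (x : ℝ) (j : ℕ), 0 ≤ x →
      B c * (1 + x) ^ j / ‖k‖ ^ (m + 1) ≤
        C * (1 + x) ^ (j + 2) * Real.exp (C * x / ‖k‖ ^ (m + 1)) / ‖k‖ ^ (m + 1) := by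
    intro c k x j hx
    have h1 : 1 ≤ Real.exp (C * x / ‖k‖ ^ (m + 1)) := Real.one_le_exp (by positivity)
    have h2 : (1 + x) ^ j ≤ (1 + x) ^ (j + 2) := pow_le_pow_right₀ (by linarith) (by omega)
    refine div_le_div_of_nonneg_right ?_ (by positivity)
    calc B c * (1 + x) ^ j ≤ C * (1 + x) ^ (j + 2) := by
          gcongr
          exact hBC c
      _ ≤ _ := le_mul_of_one_le_right (by positivity) h1
  refine ⟨MKdV.eigenX lam u, MKdV.eigenY lam u, MKdV.coefX lam u, MKdV.coefZ lam u,
    MKdV.coefW lam u, MKdV.isEigenX_eigenX hu, fun X' h c k hk x hx => h.col_eq_eigenX hu hk hx,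
    MKdV.isEigenY_eigenY hu, fun Y' h k x hx => h.eq_eigenY hu k hx,
    fun c k hk => MKdV.solvesXPart_eigenX hu hk, fun c k => MKdV.solvesXPart_eigenY hu c k,
    MKdV.isFormalX_coefX hu, fun F hF => hF.unique (MKdV.isFormalX_coefX hu),
    MKdV.isFormalY_coef hu, fun F G hF => hF.unique (MKdV.isFormalY_coef hu),
    fun c x _ => MKdV.contDiffOn_col_eigenX hu c x,
    fun c x hx => MKdV.differentiable_col_eigenY hu c hx, 4, by norm_num, C, hC,
    fun c k hk hk4 x hx j hj => ?_, fun c k hk hk4 x hx j hj => ?_,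
    fun c k hk hk4 x hx j hj => ?_⟩
  · refine (hA c k hk hk4 x hx j hj).trans ?_
    have : 0 ≤ (1 + x) ^ (n - j) := pow_nonneg (by linarith) _
    gcongr
    exact hAC c
  · exact (hB c k hk (by linarith) x hx j hj).trans (hY c k x j hx)
  · exact (hB' c k hk (by linarith) x hx j hj).trans (hY c k x j hx)
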